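/- **Setting.** Let $n\ge 2$ and let $U\subset\mathbb R^n$ be non-empty, open and bounded with boundary $\Gamma$ of class $C^1$ and outward unit normal $\vec\nu$. Let $a\in(0,1)$, $\lambda>0$, $c_{\mathcal Z}>0$, $\chi_*\ge 1$. Let $\phi:U\to(0,\infty)$ be measurable; let $X:\bar U\times[0,\infty)\times\mathbb R^n\to\mathbb R^n$ and positive functions $W_0,W_1,W_2$ on $\bar U$, measurable on $U$, satisfy for all $x\in\bar U$, $z\ge0$, $y\in\mathbb R^n$ $$|X(x,z,y)|\le W_0(x)|y|^{1-a},\qquad X(x,z,y)\cdot y\ge \frac{W_1(x)|y|^{2-a}}{\chi_*^2(1+z)^{2\lambda}}-W_2(x);$$ let $\mathcal Z:\bar U\times(0,\infty)\to\mathbb R^n$ satisfy $|\mathcal Z(x,t)|\le c_{\mathcal Z}\chi_*^2$; let $u_0:U\to[0,\infty)$, and let $\psi_1,\psi_2:\Gamma\times(0,\infty)\to\mathbb R$ be measurable. Let $u\ge0$ on $\bar U\times[0,\infty)$ be a solution of $$\phi\,(u^\lambda)_t=\nabla\cdot\big(X(x,u,\nabla u+u^{2\lambda}\mathcal Z)\big)\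 \text{in }U\times(0,\infty),\qquad u(\cdot,0)=u_0\ \text{in }U,$$ $$X(x,u,\nabla u+u^{2\lambda}\mathcal Z)\cdot\vec\nu+\psi_1+\psi_2u^\lambda=0\ \text{on }\Gamma\times(0,\infty),$$ in the following sense: $u$ is Lipschitz in $(x,t)$ on $\bar U\times[t_1,t_2]$ whenever $0<t_1<t_2$; $u(x,0)=u_0(x)$ on $U$, and $u(x,t)\to u_0(x)$ as $t\to0^+$ for a.e. $x\in U$; for all $0<t_1<t_2$, $\phi u^\lambda$ and $X(x,u,\nabla u+u^{2\lambda}\mathcal Z)$ are integrable on $U\times(t_1,t_2)$ and $\psi_1+\psi_2u^\lambda$ is integrable on $\Gamma\times(t_1,t_2)$; and $$\int_0^\infty\!\!\int_U\phi u^\lambda\eta_t\,dx\,dt=\int_0^\infty\!\!\int_U X(x,u,\nabla u+u^{2\lambda}\mathcal Z)\cdot\nabla\eta\,dx\,dt+\int_0^\infty\!\!\int_\Gamma(\psi_1+\psi_2u^\lambda)\,\eta\,dS\,dt$$ for every $\eta$ that is Lipschitz on $\bar U\times\mathbb R$ and vanishes for $t$ outside a compact subinterval of $(0,\infty)$. Put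 $z^-=\max\{0,-z\}$, $W_3=W_0^{2-a}W_1^{a-1}+W_1$, $W_4=W_2+W_3$, and $\|u\|_{L^p_\phi(U\times(T_1,T))}=\big(\int_{T_1}^T\int_U u^p\phi\,dx\,dt\big)^{1/p}\in[0,\infty]$. **Claim.** Let $\widetilde\kappa>1$ and $p_1,\dots,p_5>1$ satisfy $$p_1,\;p_2,\;p_3p_4<\widetilde\kappa,\qquad p_6:=\frac{p_5[p_3(2-a)-1]}{1-a}<\widetilde\kappa,$$ and let $q_i=p_i/(p_i-1)$. Assume that $$\int_U\Big\{\phi+\phi^{-\frac{q_4}{p_4}}+W_4^{q_1}\phi^{-\frac{q_1}{p_1}}+W_3^{q_2}\phi^{-\frac{q_2}{p_2}}+W_1^{-\frac{q_5}{1-a}}\phi^{-\frac{q_5}{p_5}}\Big\}dx\quad\text{and}\quad \int_0^T\!\!\int_\Gamma(\psi_1^-)^{q_3}+(\psi_2^-)^{q_3}\,dS\,dt$$ are finite. There are constants $c_8,c_9>1$ depending only on $U,a,\lambda,c_{\mathcal Z},p_3$ such that, whenever $T>T_2>T_1\ge0$ and $$\alpha>\max\Big\{\lambda+1,\ \frac{p_2(\lambda(5-4a)-1)}{\widetilde\kappa-p_2},\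 \frac{p_5(a+3\lambda-1)}{(1-a)(\widetilde\kappa-p_6)}\Big\},$$ one has, with $N=\|u\|_{L^{\widetilde\kappa\alpha}_\phi(U\times(T_1,T))}$, $$\operatorname*{ess\,sup}_{t\in(T_2,T)}\int_U u^\alpha(x,t)\phi(x)\,dx\le c_8\,\chi_*^{\gamma}\,\alpha^{\frac{3-2a}{1-a}}(1+T)\Big(1+\frac1{T_2-T_1}\Big)\mathcal N_1\Psi_T\big(N^{\alpha-h_1}+N^{\alpha+h_2}\big)$$ and $$\int_{T_2}^T\!\int_U\frac{u^{\alpha-\lambda-1}}{(1+u)^{2\lambda}}|\nabla u|^{2-a}W_1\,dx\,dt\le c_9\,\chi_*^{2+\gamma}\,\alpha^{\frac{2-a}{1-a}}(1+T)\Big(1+\frac1{T_2-T_1}\Big)\mathcal N_1\Psi_T\big(N^{\alpha-h_1}+N^{\alpha+h_2}\big),$$ where $$\gamma=2\max\Big\{3-2a,\frac1{p_3(2-a)-1}\Big\},\quad h_1=\lambda+1,\quad h_2=\max\Big\{0,\lambda(5-4a)-1,\frac{a+3\lambda-1}{p_3(2-a)-1}\Big\},$$ $$\mathcal N_1=\Big(1+\int_U\phi\Big)\Big\{1+\Big(\int_UW_4^{q_1}\phi^{-\frac{q_1}{p_1}}\Big)^{\frac1{q_1}}+\Big(\int_UW_3^{q_2}\phi^{-\frac{q_2}{p_2}}\Big)^{\frac1{q_2}}+\Big(\int_U\phi^{-\frac{q_4}{p_4}}\Big)^{\frac1{p_3q_4}}+\Big(\int_UW_1^{-\frac{q_5}{1-a}}\phi^{-\frac{q_5}{p_5}}\Big)^{\frac{1-a}{q_5(p_3(2-a)-1)}}\Big\},$$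 $$\Psi_T=1+\Big(\int_0^T\!\!\int_\Gamma(\psi_1^-)^{q_3}+(\psi_2^-)^{q_3}\,dS\,dt\Big)^{\frac{p_3(2-a)}{q_3(p_3(2-a)-1)}}.$$ -/

import Mathlib

open MeasureTheory Set Filter Topology

noncomputable section

namespace Forchheimer

/-- `n`-dimensional Euclidean space. -/
abbrev Euc (n : ℕ) : Type := EuclideanSpace ℝ (Fin n)

/-- The boundary of `U` is of class `C¹`: near each boundary point, `U` is the negativity set of a
`C¹` function with non-vanishing differential (so `U` lies locally on one side of a `C¹`
hypersurface). -/
def HasC1Boundary {n : ℕ} (U : Set (Euc n)) : Prop :=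
  ∀ x₀ ∈ frontier U, ∃ V : Set (Euc n), IsOpen V ∧ x₀ ∈ V ∧
    ∃ ρ : Euc n → ℝ, ContDiffOn ℝ 1 ρ V ∧ fderiv ℝ ρ x₀ ≠ 0 ∧ ∀ x ∈ V, (x ∈ U ↔ ρ x < 0)

/-- Surface measure on the boundary `Γ` of `U`: the `(n-1)`-dimensional Hausdorff measure,
normalised so that it extends Lebesgue measure on hyperplanes, restricted to `Γ`. -/
def surfaceMeasure {n : ℕ} (U : Set (Euc n)) : Measure (Euc n) :=
  (Measure.euclideanHausdorffMeasure (n - 1)).restrict (frontier U)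

/-- The measure `dx dt` on `U × (s, t)`. -/
def cylinderMeasure {n : ℕ} (U : Set (Euc n)) (s t : ℝ) : Measure (Euc n × ℝ) :=
  (volume.restrict U).prod (volume.restrict (Ioo s t))

/-- The measure `dS dt` on `Γ × (s, t)`. -/
def lateralMeasure {n : ℕ} (U : Set (Euc n)) (s t : ℝ) : Measure (Euc n × ℝ) :=
  (surfaceMeasure U).prod (volume.restrict (Ioo s t))

/-- The measure `dx dt` on `U × (0, ∞)`. -/
def globalCylinderMeasure {n : ℕ} (U : Set (Euc n)) : Measure (Euc n × ℝ) :=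
  (volume.restrict U).prod (volume.restrict (Ioi 0))

/-- The measure `dS dt` on `Γ × (0, ∞)`. -/
def globalLateralMeasure {n : ℕ} (U : Set (Euc n)) : Measure (Euc n × ℝ) :=
  (surfaceMeasure U).prod (volume.restrict (Ioi 0))

/-- The structural conditions on the nonlinearity: for `x ∈ Ū`, `z ≥ 0` and all `y`,
`|X(x,z,y)| ≤ W₀(x)|y|^(1-a)` and
`X(x,z,y)·y ≥ W₁(x)|y|^(2-a) / (χ² (1+z)^(2λ)) - W₂(x)`, with positive weights `W₀, W₁, W₂`. -/
structure StructureConditions {n : ℕ} (U : Set (Euc n)) (a lam χ : ℝ)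
    (X : Euc n → ℝ → Euc n → Euc n) (W₀ W₁ W₂ : Euc n → ℝ) : Prop where
  pos₀ : ∀ x ∈ closure U, 0 < W₀ x
  pos₁ : ∀ x ∈ closure U, 0 < W₁ x
  pos₂ : ∀ x ∈ closure U, 0 < W₂ x
  meas₀ : AEMeasurable W₀ (volume.restrict U)
  meas₁ : AEMeasurable W₁ (volume.restrict U)
  meas₂ : AEMeasurable W₂ (volume.restrict U)
  growth : ∀ x ∈ closure U, ∀ z : ℝ, 0 ≤ z → ∀ y : Euc n,
    ‖X x z y‖ ≤ W₀ x * ‖y‖ ^ (1 - a)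
  coercive : ∀ x ∈ closure U, ∀ z : ℝ, 0 ≤ z → ∀ y : Euc n,
    W₁ x * ‖y‖ ^ (2 - a) / (χ ^ 2 * (1 + z) ^ (2 * lam)) - W₂ x ≤ inner ℝ (X x z y) y

/-- The flux `X(x, u, ∇u + u^(2λ) Z(x,t))`, with `∇` the spatial gradient. -/
def flux {n : ℕ} (lam : ℝ) (X : Euc n → ℝ → Euc n → Euc n) (Z : Euc n → ℝ → Euc n)
    (u : Euc n → ℝ → ℝ) (x : Euc n) (t : ℝ) : Euc n :=
  X x (u x t) (gradient (fun y => u y t) x + (u x t ^ (2 * lam)) • Z x t)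

/-- Test functions for the problem on `Ū × (0,∞)`: Lipschitz functions of `(x,t)` on `Ū × ℝ` which
vanish outside a compact time interval in `(0,∞)`. No condition is imposed on `Γ`. -/
def IsTestFunction {n : ℕ} (U : Set (Euc n)) (η : Euc n → ℝ → ℝ) : Prop :=
  (∃ K : NNReal, LipschitzOnWith K (fun p : Euc n × ℝ => η p.1 p.2) (closure U ×ˢ univ)) ∧
  ∃ t₁ t₂ : ℝ, 0 < t₁ ∧ t₁ < t₂ ∧ ∀ x t, t ∉ Icc t₁ t₂ → η x t = 0

/-- `u` is a non-negative (weak) solution, locally Lipschitz on `Ū × (0,∞)`, of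
`φ (u^λ)_t = ∇·(X(x,u,∇u+u^(2λ)Z))` in `U × (0,∞)`, `u(x,0) = u₀(x)` in `U`,
`X(x,u,∇u+u^(2λ)Z)·ν + ψ₁ + ψ₂ u^λ = 0` on `Γ × (0,∞)`. The equation and the boundary condition are
understood against test functions which need not vanish on `Γ`. -/
structure IsSolution {n : ℕ} (U : Set (Euc n)) (lam : ℝ) (φ : Euc n → ℝ)
    (X : Euc n → ℝ → Euc n → Euc n) (Z : Euc n → ℝ → Euc n) (u₀ : Euc n → ℝ)
    (ψ₁ ψ₂ : Euc n → ℝ → ℝ) (u : Euc n → ℝ → ℝ) : Prop where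
  nonneg : ∀ x ∈ closure U, ∀ t : ℝ, 0 ≤ t → 0 ≤ u x t
  lipschitz : ∀ t₁ t₂ : ℝ, 0 < t₁ → t₁ < t₂ → ∃ K : NNReal,
    LipschitzOnWith K (fun p : Euc n × ℝ => u p.1 p.2) (closure U ×ˢ Icc t₁ t₂)
  initial : ∀ x ∈ U, u x 0 = u₀ x
  initial_tendsto : ∀ᵐ x ∂(volume.restrict U), Tendsto (fun t => u x t) (𝓝[>] 0) (𝓝 (u₀ x))
  integrable_accumulation : ∀ t₁ t₂ : ℝ, 0 < t₁ → t₁ < t₂ →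
    Integrable (fun p : Euc n × ℝ => φ p.1 * u p.1 p.2 ^ lam) (cylinderMeasure U t₁ t₂)
  integrable_flux : ∀ t₁ t₂ : ℝ, 0 < t₁ → t₁ < t₂ →
    Integrable (fun p : Euc n × ℝ => flux lam X Z u p.1 p.2) (cylinderMeasure U t₁ t₂)
  integrable_boundary : ∀ t₁ t₂ : ℝ, 0 < t₁ → t₁ < t₂ →
    Integrable (fun p : Euc n × ℝ => ψ₁ p.1 p.2 + ψ₂ p.1 p.2 * u p.1 p.2 ^ lam)
      (lateralMeasure U t₁ t₂)
  weak_equation : ∀ η : Euc n → ℝ → ℝ, IsTestFunction U η →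
    ∫ p, φ p.1 * u p.1 p.2 ^ lam * deriv (fun s => η p.1 s) p.2 ∂(globalCylinderMeasure U) =
      (∫ p, inner ℝ (flux lam X Z u p.1 p.2) (gradient (fun y => η y p.2) p.1)
          ∂(globalCylinderMeasure U)) +
        ∫ p, (ψ₁ p.1 p.2 + ψ₂ p.1 p.2 * u p.1 p.2 ^ lam) * η p.1 p.2 ∂(globalLateralMeasure U)

/-- The Hölder conjugate exponent `p / (p - 1)`. -/
abbrev conj (p : ℝ) : ℝ := Real.conjExponent p

/-- `W₃ = W₀^(2-a) W₁^(a-1) + W₁`. -/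
def W₃ {n : ℕ} (a : ℝ) (W₀ W₁ : Euc n → ℝ) (x : Euc n) : ℝ :=
  W₀ x ^ (2 - a) * W₁ x ^ (a - 1) + W₁ x

/-- `W₄ = W₂ + W₃`. -/
def W₄ {n : ℕ} (a : ℝ) (W₀ W₁ W₂ : Euc n → ℝ) (x : Euc n) : ℝ :=
  W₂ x + W₃ a W₀ W₁ x

/-- `p₆ = p₅ (p₃ (2-a) - 1) / (1-a)`. -/
def exponentP₆ (a p₃ p₅ : ℝ) : ℝ := p₅ * (p₃ * (2 - a) - 1) / (1 - a)

/-- The integrand of the integrability condition on the weights. -/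
def weightIntegrand {n : ℕ} (a p₁ p₂ p₄ p₅ : ℝ) (φ W₀ W₁ W₂ : Euc n → ℝ) (x : Euc n) : ℝ :=
  φ x + φ x ^ (-(conj p₄ / p₄))
    + W₄ a W₀ W₁ W₂ x ^ conj p₁ * φ x ^ (-(conj p₁ / p₁))
    + W₃ a W₀ W₁ x ^ conj p₂ * φ x ^ (-(conj p₂ / p₂))
    + W₁ x ^ (-(conj p₅ / (1 - a))) * φ x ^ (-(conj p₅ / p₅))

/-- `(ψ₁⁻)^q₃ + (ψ₂⁻)^q₃`, where `z⁻ = max (0, -z)`. -/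
def boundaryIntegrand {n : ℕ} (p₃ : ℝ) (ψ₁ ψ₂ : Euc n → ℝ → ℝ) (p : Euc n × ℝ) : ℝ :=
  max 0 (-ψ₁ p.1 p.2) ^ conj p₃ + max 0 (-ψ₂ p.1 p.2) ^ conj p₃

/-- The quantity `𝒩₁` measuring the weights. -/
def weightQuantity {n : ℕ} (U : Set (Euc n)) (a p₁ p₂ p₃ p₄ p₅ : ℝ)
    (φ W₀ W₁ W₂ : Euc n → ℝ) : ℝ :=
  (1 + ∫ x in U, φ x) *
    (1 + (∫ x in U, W₄ a W₀ W₁ W₂ x ^ conj p₁ * φ x ^ (-(conj p₁ / p₁))) ^ (1 / conj p₁)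
      + (∫ x in U, W₃ a W₀ W₁ x ^ conj p₂ * φ x ^ (-(conj p₂ / p₂))) ^ (1 / conj p₂)
      + (∫ x in U, φ x ^ (-(conj p₄ / p₄))) ^ (1 / (p₃ * conj p₄))
      + (∫ x in U, W₁ x ^ (-(conj p₅ / (1 - a))) * φ x ^ (-(conj p₅ / p₅)))
          ^ ((1 - a) / (conj p₅ * (p₃ * (2 - a) - 1))))

/-- The quantity `Ψ_T` measuring the boundary data. -/
def boundaryQuantity {n : ℕ} (U : Set (Euc n)) (a p₃ T : ℝ) (ψ₁ ψ₂ : Euc n → ℝ → ℝ) : ℝ :=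
  1 + (∫ p, boundaryIntegrand p₃ ψ₁ ψ₂ p ∂(lateralMeasure U 0 T))
        ^ (p₃ * (2 - a) / (conj p₃ * (p₃ * (2 - a) - 1)))

/-- `γ = 2 max {3 - 2a, 1 / (p₃(2-a) - 1)}`. -/
def exponentγ (a p₃ : ℝ) : ℝ := 2 * max (3 - 2 * a) (1 / (p₃ * (2 - a) - 1))

/-- `h₁ = λ + 1`. -/
def h₁ (lam : ℝ) : ℝ := lam + 1

/-- `h₂ = max {0, λ(5-4a) - 1, (a + 3λ - 1) / (p₃(2-a) - 1)}`. -/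
def h₂ (a lam p₃ : ℝ) : ℝ :=
  max 0 (max (lam * (5 - 4 * a) - 1) ((a + 3 * lam - 1) / (p₃ * (2 - a) - 1)))

/-- The lower bound required of `α`. -/
def alphaThreshold (a lam κ p₂ p₃ p₅ : ℝ) : ℝ :=
  max (lam + 1) (max (p₂ * (lam * (5 - 4 * a) - 1) / (κ - p₂))
    (p₅ * (a + 3 * lam - 1) / ((1 - a) * (κ - exponentP₆ a p₃ p₅))))

/-- `∫_U u(x,t)^α φ(x) dx`, with values in `[0,∞]`. -/
def weightedMass {n : ℕ} (U : Set (Euc n)) (φ : Euc n → ℝ) (α : ℝ) (u : Euc n → ℝ → ℝ)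
    (t : ℝ) : ENNReal :=
  ∫⁻ x in U, ENNReal.ofReal (u x t ^ α * φ x)

/-- `‖u‖` in `L^p_φ(U × (s,t))` for a non-negative function `u`, with values in `[0,∞]`. -/
def weightedNorm {n : ℕ} (U : Set (Euc n)) (φ : Euc n → ℝ) (p s t : ℝ) (u : Euc n → ℝ → ℝ) :
    ENNReal :=
  (∫⁻ τ in Ioo s t, weightedMass U φ p u τ) ^ (1 / p)

/-- `∫_s^t ∫_U u^(α-λ-1) (1+u)^(-2λ) |∇u|^(2-a) W₁ dx dτ`, with values in `[0,∞]`. -/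
def gradientEnergy {n : ℕ} (U : Set (Euc n)) (W₁ : Euc n → ℝ) (a lam α s t : ℝ)
    (u : Euc n → ℝ → ℝ) : ENNReal :=
  ∫⁻ τ in Ioo s t, ∫⁻ x in U, ENNReal.ofReal
    (u x τ ^ (α - lam - 1) / (1 + u x τ) ^ (2 * lam)
      * ‖gradient (fun y => u y τ) x‖ ^ (2 - a) * W₁ x)

end Forchheimer

end

/-! The proof is an energy estimate. On a time slab [s,t] with s > 0 the solution is bounded and
Lipschitz, so u^(α-λ) θ(t) with a Lipschitz time cut-off θ is admissible as it stands: since α-λ >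
1, this power is Lipschitz too, and no mollification is needed. The chain rule in time turns the
accumulation term into (λ/α)∫φ u^α θ', and the flux term becomes (α-λ)∫θ u^(α-λ-1) X·∇u
(`weak_identity`). Growth and coercivity of X, with Young's inequality for the drift u^(2λ)Z, bound
X·∇u below by a multiple of W₁|∇u|^(2-a)/(1+u)^(2λ), up to terms in W₂ and W₃
(`inner_flux_lower_bound`). Together these give `energy_inequality`, whose right side has interior
integrals of powers of u and boundary integrals of ψ₁⁻u^(α-λ) and ψ₂⁻u^α.

Interior integrals are estimated by Hölder's inequality with three weights: a purely spatial one,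
u^(κα)φ, and φ (`lintegral_holder_cylinder`). The lower bound on α is what keeps the three Hölder
exponents non-negative. Each estimate produces some power N^x with α-h₁ ≤ x ≤ α+h₂, hence at most
the sum of the two extreme powers.

For a boundary integral of ψ⁻u^β, Hölder with exponent p₃ separates the datum, and the W^{1,1} trace
inequality (`exists_trace_inequality`) for u^(p₃β) moves the rest into U. This creates
u^(p₃β-1)|∇u|, which a further Hölder inequality writes through the energy E and a weighted power of
u (`lateral_integral_le`). After the root 1/p₃, E appears with the exponent 1/(p₃(2-a)) < 1, so
Young's inequality absorbs it into the left side (`boundary_absorption`). The conjugate exponent of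
this Young inequality explains the denominators p₃(2-a)-1 in the statement. The result is
`absorbed_energy`.

The trace inequality is proved by hand: near a boundary point Γ projects injectively along a
coordinate axis with Lipschitz inverse, short segments along that axis enter U, and the fundamental
theorem of calculus on them followed by Fubini gives the bound; compactness of Γ patches the pieces.

Finally θ is taken trapezoidal. Its rising flank costs 1/(T₂-T₁); its falling flank, of slope
-1/(t-r), produces the mass ∫φu^α at time t as r increases to t (`time_term_le`). Mass and energy
then stand together, both non-negative, on the left of one inequality (`trapezoid_energy`), and each
is bounded separately in `mass_and_gradient_bounds`. -/

noncomputable section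

namespace Forchheimer

/-! ### Trace inequality over graph pieces of the boundary -/

/-- The projection of `ℝ^(m+1)` forgetting the `i`-th coordinate. -/
def dropCoord {m : ℕ} (i : Fin (m + 1)) (x : Euc (m + 1)) : Fin m → ℝ := fun j => x (i.succAbove j)

theorem continuous_dropCoord {m : ℕ} (i : Fin (m + 1)) : Continuous (dropCoord i) := by
  unfold dropCoord
  fun_prop

/-- On S the projection is antilipschitz, and such maps control Hausdorff measure from above by K^m
times the measure of the image. In the sup metric on `Fin m → ℝ` the m-dimensional Hausdorff measure
is Lebesgue measure; the factor c only accounts for the Euclidean normalisation. The constant is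
independent of S. -/
theorem exists_map_dropCoord_le {m : ℕ} (i : Fin (m + 1)) (K : NNReal) :
    ∃ C : NNReal, ∀ S : Set (Euc (m + 1)), MeasurableSet S →
      (∀ x ∈ S, ∀ y ∈ S, dist x y ≤ K * dist (dropCoord i x) (dropCoord i y)) →
      ((Measure.euclideanHausdorffMeasure m).restrict S).map (dropCoord i) ≤
        (C : ENNReal) • (volume : Measure (Fin m → ℝ)) := by
  set c : NNReal := Measure.addHaarScalarFactor (volume : Measure (EuclideanSpace ℝ (Fin m)))
    (Measure.hausdorffMeasure m) with hc
  refine ⟨c * K ^ m, fun S hS h => Measure.le_intro fun A hA _ => ?_⟩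
  rw [Measure.map_apply (continuous_dropCoord i).measurable hA,
    Measure.restrict_apply ((continuous_dropCoord i).measurable hA),
    Measure.euclideanHausdorffMeasure_def, ← hc]
  have h1 : AntilipschitzWith K (fun x : S => dropCoord i (x : Euc (m + 1))) :=
    AntilipschitzWith.of_le_mul_dist fun x y => h x x.2 y y.2
  have h2 := h1.hausdorffMeasure_preimage_le (d := m) (Nat.cast_nonneg m) A
  have h3 : Measure.hausdorffMeasure m ((fun x : S => dropCoord i (x : Euc (m + 1))) ⁻¹' A) =
      (Measure.hausdorffMeasure m (dropCoord i ⁻¹' A ∩ S) : ENNReal) := by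
    rw [← (isometry_subtype_coe (s := S)).hausdorffMeasure_image (Or.inl (Nat.cast_nonneg m))]
    congr 1
    ext x
    simp only [mem_image, mem_preimage, Subtype.exists, exists_and_left, exists_prop, mem_inter_iff]
    constructor
    · rintro ⟨y, h1, h2, rfl⟩; exact ⟨h1, h2⟩
    · rintro ⟨h1, h2⟩; exact ⟨x, h1, h2, rfl⟩
  have h4 : (Measure.hausdorffMeasure (m : ℝ) : Measure (Fin m → ℝ)) = volume := by
    simpa using (hausdorffMeasure_pi_real (ι := Fin m))
  rw [h3, h4] at h2
  simp only [Measure.smul_apply, smul_eq_mul, ENNReal.smul_def]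
  refine (mul_le_mul_right h2 _).trans (le_of_eq ?_)
  simp [mul_assoc, ENNReal.rpow_natCast]

theorem lintegral_insertNth_eq {m : ℕ} (i : Fin (m + 1)) (g : Euc (m + 1) → ENNReal)
    (hg : Measurable g) :
    Measurable (fun y : Fin m → ℝ => ∫⁻ r : ℝ, g (WithLp.toLp 2 (i.insertNth r y))) ∧
    ∫⁻ y : Fin m → ℝ, ∫⁻ r : ℝ, g (WithLp.toLp 2 (i.insertNth r y)) = ∫⁻ x, g x := by
  have hmp := (volume_preserving_piFinSuccAbove (fun _ : Fin (m + 1) => ℝ) i).symm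
  have hmp2 := (PiLp.volume_preserving_toLp (Fin (m + 1))).comp hmp
  have hm : Measurable (fun p : ℝ × (Fin m → ℝ) =>
      g (WithLp.toLp 2 ((MeasurableEquiv.piFinSuccAbove (fun _ : Fin (m + 1) => ℝ) i).symm p))) :=
    hg.comp hmp2.measurable
  refine ⟨?_, ?_⟩
  · exact Measurable.lintegral_prod_left' hm
  · rw [← hmp2.lintegral_comp hg]
    exact (lintegral_prod_symm' _ hm).symm

/-- A segment entering U from x is part of a full line, and the integral of g over the part of that
line inside U depends only on the projection of x. The surface integral is therefore an integral
against the projected measure, which is dominated by Lebesgue measure, and Fubini reassembles the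
lines. -/
theorem exists_lintegral_translate_le {m : ℕ} (i : Fin (m + 1)) (K : NNReal) (σ : ℝ)
    (hσ : σ = 1 ∨ σ = -1) :
    ∃ C : NNReal, ∀ (S U : Set (Euc (m + 1))) (δ : ℝ), MeasurableSet S → MeasurableSet U →
      (∀ x ∈ S, ∀ y ∈ S, dist x y ≤ K * dist (dropCoord i x) (dropCoord i y)) →
      (∀ x ∈ S, ∀ s ∈ Ioo 0 δ, x - s • EuclideanSpace.single i σ ∈ U) →
      ∀ g : Euc (m + 1) → ENNReal, Measurable g →
        ∫⁻ x in S, (∫⁻ s in Ioo 0 δ, g (x - s • EuclideanSpace.single i σ))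
            ∂(Measure.euclideanHausdorffMeasure m) ≤ C * ∫⁻ x in U, g x := by
  obtain ⟨C, hC⟩ := exists_map_dropCoord_le i K
  refine ⟨C, fun S U δ hS hU hK hSU g hg => ?_⟩
  have hG : Measurable (U.indicator g) := hg.indicator hU
  obtain ⟨hm, he⟩ := lintegral_insertNth_eq i _ hG
  have key : ∀ x ∈ S, ∫⁻ s in Ioo 0 δ, g (x - s • EuclideanSpace.single i σ) ≤
      ∫⁻ r : ℝ, U.indicator g (WithLp.toLp 2 (i.insertNth r (dropCoord i x))) := by
    intro x hx
    have e1 : ∀ s : ℝ, x - s • EuclideanSpace.single i σ =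
        WithLp.toLp 2 (i.insertNth (x i - s * σ) (dropCoord i x)) := by
      intro s
      ext j
      refine Fin.succAboveCases i ?_ (fun k => ?_) j
      · simp
      · simp [dropCoord, Fin.succAbove_ne]
    have e2 : ∫⁻ r : ℝ, U.indicator g (WithLp.toLp 2 (i.insertNth r (dropCoord i x))) =
        ∫⁻ s : ℝ, U.indicator g (x - s • EuclideanSpace.single i σ) := by
      simp_rw [e1]
      rcases hσ with rfl | rfl
      · simp only [mul_one]
        rw [lintegral_sub_left_eq_self
          (fun r => U.indicator g (WithLp.toLp 2 (i.insertNth r (dropCoord i x)))) (x i)]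
      · simp only [mul_neg, mul_one, sub_neg_eq_add]
        rw [lintegral_add_left_eq_self
          (fun r => U.indicator g (WithLp.toLp 2 (i.insertNth r (dropCoord i x)))) (x i)]
    rw [e2]
    refine le_trans (le_of_eq ?_) (setLIntegral_le_lintegral (Ioo 0 δ) _)
    refine setLIntegral_congr_fun measurableSet_Ioo fun s hs => ?_
    simp only [indicator_of_mem (hSU x hx s hs)]
  calc ∫⁻ x in S, (∫⁻ s in Ioo 0 δ, g (x - s • EuclideanSpace.single i σ))
            ∂(Measure.euclideanHausdorffMeasure m)
      ≤ ∫⁻ x in S, (fun y => ∫⁻ r : ℝ, U.indicator g (WithLp.toLp 2 (i.insertNth r y)))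
          (dropCoord i x) ∂(Measure.euclideanHausdorffMeasure m) :=
        setLIntegral_mono' hS key
    _ = ∫⁻ y, (fun y => ∫⁻ r : ℝ, U.indicator g (WithLp.toLp 2 (i.insertNth r y))) y
          ∂(((Measure.euclideanHausdorffMeasure m).restrict S).map (dropCoord i)) :=
        (lintegral_map hm (continuous_dropCoord i).measurable).symm
    _ ≤ ∫⁻ y, (fun y => ∫⁻ r : ℝ, U.indicator g (WithLp.toLp 2 (i.insertNth r y))) y
          ∂((C : ENNReal) • (volume : Measure (Fin m → ℝ))) :=
        lintegral_mono' (hC S hS hK) le_rfl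
    _ = C * ∫⁻ x in U, g x := by
        rw [lintegral_smul_measure, he, lintegral_indicator hU]
        rfl

/-- Fundamental theorem of calculus for an absolutely continuous function. The derivative is
integrated over all of (0,δ), so the second term no longer depends on s and the bound can be
averaged over s. -/
theorem ofReal_le_add_lintegral_deriv {h : ℝ → ℝ} {K : NNReal} (hh : LipschitzWith K h)
    {s δ : ℝ} (hs : s ∈ Ioo 0 δ) :
    ENNReal.ofReal (h 0) ≤ ENNReal.ofReal (h s) + ∫⁻ r in Ioo 0 δ, ‖deriv h r‖ₑ := by
  have h1 := (hh.lipschitzOnWith (s := uIcc 0 s)).absolutelyContinuousOnInterval.integral_deriv_eq_sub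
  have h2 : h 0 = h s + -(∫ r in (0 : ℝ)..s, deriv h r) := by rw [h1]; ring
  rw [h2]
  refine ENNReal.ofReal_add_le.trans (add_le_add le_rfl ?_)
  calc ENNReal.ofReal (-(∫ r in (0 : ℝ)..s, deriv h r))
      ≤ ENNReal.ofReal ‖∫ r in (0 : ℝ)..s, deriv h r‖ :=
        ENNReal.ofReal_le_ofReal (neg_le_abs _)
    _ = ‖∫ r in Ioc 0 s, deriv h r‖ₑ := by
        rw [intervalIntegral.integral_of_le hs.1.le, ofReal_norm]
    _ ≤ ∫⁻ r in Ioc 0 s, ‖deriv h r‖ₑ := enorm_integral_le_lintegral_enorm _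
    _ ≤ ∫⁻ r in Ioo 0 δ, ‖deriv h r‖ₑ :=
        lintegral_mono_set fun r hr => ⟨hr.1, hr.2.trans_lt hs.2⟩

theorem norm_gradient_eq {n : ℕ} (f : Euc n → ℝ) (x : Euc n) :
    ‖gradient f x‖ = ‖fderiv ℝ f x‖ := by
  simp [gradient]

theorem measurable_gradient {n : ℕ} (f : Euc n → ℝ) : Measurable (gradient f) := by
  unfold gradient
  exact (LinearIsometryEquiv.continuous _).measurable.comp (measurable_fderiv ℝ f)

/-- A trace inequality over a piece `S` of the boundary which is a graph in a coordinate direction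
and from which segments of length `δ` enter `U`. -/
theorem exists_lintegral_le_of_graph {m : ℕ} (i : Fin (m + 1)) (K : NNReal) (σ : ℝ)
    (hσ : σ = 1 ∨ σ = -1) (S U : Set (Euc (m + 1))) (δ : ℝ) (hδ : 0 < δ) (hδ1 : δ ≤ 1)
    (hS : MeasurableSet S) (hU : MeasurableSet U)
    (hK : ∀ x ∈ S, ∀ y ∈ S, dist x y ≤ K * dist (dropCoord i x) (dropCoord i y))
    (hSU : ∀ x ∈ S, ∀ s ∈ Ioo 0 δ, x - s • EuclideanSpace.single i σ ∈ U) :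
    ∃ C : NNReal, ∀ (L : NNReal) (f : Euc (m + 1) → ℝ), LipschitzWith L f →
      ∫⁻ x in S, ENNReal.ofReal (f x) ∂(Measure.euclideanHausdorffMeasure m) ≤
        C * ∫⁻ x in U, (ENNReal.ofReal (f x) + ENNReal.ofReal ‖gradient f x‖) := by
  obtain ⟨C, hC⟩ := exists_lintegral_translate_le i K σ hσ
  refine ⟨C * (Real.toNNReal δ)⁻¹, fun L f hf => ?_⟩
  classical
  set e : Euc (m + 1) := EuclideanSpace.single i σ with he
  have hen : ‖e‖ = 1 := by
    rcases hσ with rfl | rfl <;> simp [he]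
  -- At points of non-differentiability the gradient defaults to 0, while a directional derivative
  -- may exist and be nonzero there; a single segment could even lie inside that exceptional set.
  -- The value ⊤ makes the pointwise bound `hder` hold everywhere, and Rademacher's theorem makes
  -- the change invisible to the volume integral.
  set G : Euc (m + 1) → ENNReal := fun y => ENNReal.ofReal (f y) +
    {y | DifferentiableAt ℝ f y}.piecewise (fun y => ENNReal.ofReal ‖gradient f y‖) (fun _ => ⊤) y
    with hG
  have hGm : Measurable G := by
    refine (ENNReal.measurable_ofReal.comp hf.continuous.measurable).add
      (Measurable.piecewise (measurableSet_of_differentiableAt ℝ f)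
      (ENNReal.measurable_ofReal.comp (measurable_gradient f).norm) measurable_const)
  have hGae : ∫⁻ x in U, G x =
      ∫⁻ x in U, (ENNReal.ofReal (f x) + ENNReal.ofReal ‖gradient f x‖) := by
    refine lintegral_congr_ae (ae_restrict_of_ae ?_)
    filter_upwards [hf.ae_differentiableAt (μ := volume)] with x hx
    have hx' : x ∈ {y | DifferentiableAt ℝ f y} := hx
    simp only [hG, piecewise_eq_of_mem _ _ _ hx']
  have key : ∀ x, ENNReal.ofReal δ * ENNReal.ofReal (f x) ≤ ∫⁻ s in Ioo 0 δ, G (x - s • e) := by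
    intro x
    have hline : LipschitzWith 1 (fun s : ℝ => x - s • e) := by
      refine LipschitzWith.of_dist_le_mul fun s t => ?_
      rw [dist_eq_norm, dist_eq_norm]
      have : x - s • e - (x - t • e) = (t - s) • e := by rw [sub_smul]; abel
      rw [this, norm_smul, hen, norm_sub_rev]; simp
    have hh : LipschitzWith (L * 1) (fun s : ℝ => f (x - s • e)) := hf.comp hline
    have hder : ∀ s, ENNReal.ofReal (f (x - s • e)) + ‖deriv (fun s : ℝ => f (x - s • e)) s‖ₑ ≤
        G (x - s • e) := by
      intro s
      simp only [hG]
      refine add_le_add le_rfl ?_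
      by_cases hd : DifferentiableAt ℝ f (x - s • e)
      · have hx' : x - s • e ∈ {y | DifferentiableAt ℝ f y} := hd
        rw [piecewise_eq_of_mem _ _ _ hx']
        have h1 : HasDerivAt (fun s : ℝ => x - s • e) (-e) s := by
          simpa using ((hasDerivAt_id s).smul_const e).const_sub x
        have h2 := hd.hasFDerivAt.comp_hasDerivAt s h1
        have h3 : deriv (fun s : ℝ => f (x - s • e)) s = fderiv ℝ f (x - s • e) (-e) := h2.deriv
        rw [h3, ← ofReal_norm, norm_gradient_eq]
        refine ENNReal.ofReal_le_ofReal (((fderiv ℝ f (x - s • e)).le_opNorm _).trans ?_)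
        simp [hen]
      · have hx' : x - s • e ∉ {y | DifferentiableAt ℝ f y} := hd
        rw [piecewise_eq_of_notMem _ _ _ hx']
        exact le_top
    have hm1 : Measurable (fun s : ℝ => ENNReal.ofReal (f (x - s • e))) :=
      ENNReal.measurable_ofReal.comp hh.continuous.measurable
    calc ENNReal.ofReal δ * ENNReal.ofReal (f x)
        = ∫⁻ s in Ioo 0 δ, ENNReal.ofReal (f x) := by
          simp [mul_comm]
      _ ≤ ∫⁻ s in Ioo 0 δ, (ENNReal.ofReal (f (x - s • e)) +
            ∫⁻ r in Ioo 0 δ, ‖deriv (fun s : ℝ => f (x - s • e)) r‖ₑ) := by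
          refine setLIntegral_mono' measurableSet_Ioo fun s hs => ?_
          simpa using ofReal_le_add_lintegral_deriv hh hs
      _ = (∫⁻ s in Ioo 0 δ, ENNReal.ofReal (f (x - s • e))) +
            ENNReal.ofReal δ * ∫⁻ r in Ioo 0 δ, ‖deriv (fun s : ℝ => f (x - s • e)) r‖ₑ := by
          rw [lintegral_add_left hm1]
          simp [mul_comm]
      _ ≤ (∫⁻ s in Ioo 0 δ, ENNReal.ofReal (f (x - s • e))) +
            1 * ∫⁻ r in Ioo 0 δ, ‖deriv (fun s : ℝ => f (x - s • e)) r‖ₑ := by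
          gcongr
          exact ENNReal.ofReal_le_one.2 hδ1
      _ ≤ ∫⁻ s in Ioo 0 δ, G (x - s • e) := by
          rw [one_mul, ← lintegral_add_left hm1]
          exact lintegral_mono hder
  have h1 := hC S U δ hS hU hK hSU G hGm
  rw [hGae] at h1
  have h2 : ENNReal.ofReal δ *
      ∫⁻ x in S, ENNReal.ofReal (f x) ∂(Measure.euclideanHausdorffMeasure m) ≤
      C * ∫⁻ x in U, (ENNReal.ofReal (f x) + ENNReal.ofReal ‖gradient f x‖) := by
    rw [← lintegral_const_mul (f := fun x => ENNReal.ofReal (f x)) _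
      (ENNReal.measurable_ofReal.comp hf.continuous.measurable)]
    exact (lintegral_mono key).trans h1
  have hδ0 : Real.toNNReal δ ≠ 0 := by simpa using hδ
  have hδ' : ENNReal.ofReal δ ≠ 0 := by simpa using hδ
  calc ∫⁻ x in S, ENNReal.ofReal (f x) ∂(Measure.euclideanHausdorffMeasure m)
      = (ENNReal.ofReal δ)⁻¹ * (ENNReal.ofReal δ *
          ∫⁻ x in S, ENNReal.ofReal (f x) ∂(Measure.euclideanHausdorffMeasure m)) := by
        rw [← mul_assoc, ENNReal.inv_mul_cancel hδ' ENNReal.ofReal_ne_top, one_mul]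
    _ ≤ (ENNReal.ofReal δ)⁻¹ *
          (C * ∫⁻ x in U, (ENNReal.ofReal (f x) + ENNReal.ofReal ‖gradient f x‖)) := by gcongr
    _ = _ := by
        rw [ENNReal.coe_mul, ENNReal.coe_inv hδ0, ← mul_assoc, mul_comm (C : ENNReal)]
        rfl

theorem restrict_biUnion_finset_le {α ι : Type*} [MeasurableSpace α] {μ : Measure α}
    (t : Finset ι) (S : ι → Set α) : μ.restrict (⋃ i ∈ t, S i) ≤ ∑ i ∈ t, μ.restrict (S i) := by
  classical
  induction t using Finset.induction with
  | empty => simp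
  | insert a t ha ih =>
    rw [Finset.set_biUnion_insert, Finset.sum_insert ha]
    exact (Measure.restrict_union_le _ _).trans (add_le_add le_rfl ih)

/-! ### Local charts of a C¹ boundary and the global trace inequality -/

theorem eq_zero_of_mem_frontier {n : ℕ} {U V : Set (Euc n)} (hU : IsOpen U) (hV : IsOpen V)
    {ρ : Euc n → ℝ} (hρ : ContinuousOn ρ V) (h : ∀ x ∈ V, (x ∈ U ↔ ρ x < 0)) {x : Euc n}
    (hx : x ∈ frontier U) (hxV : x ∈ V) : ρ x = 0 := by
  refine le_antisymm ?_ ?_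
  · by_contra! hpos
    have h1 : ∀ᶠ y in 𝓝 x, 0 < ρ y :=
      (hρ.continuousAt (hV.mem_nhds hxV)).eventually (lt_mem_nhds hpos)
    obtain ⟨y, ⟨hy1, hy2⟩, hyU⟩ := mem_closure_iff_nhds.1 (frontier_subset_closure hx) _
      (h1.and (hV.mem_nhds hxV))
    exact absurd ((h y hy2).1 hyU) (not_lt.2 hy1.le)
  · by_contra! hneg
    have : x ∈ U := (h x hxV).2 hneg
    rw [hU.frontier_eq] at hx
    exact hx.2 this

theorem norm_le_sqrt_mul_dropCoord {m : ℕ} (i : Fin (m + 1)) (x : Euc (m + 1)) :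
    ‖x - (x i) • EuclideanSpace.single i (1 : ℝ)‖ ≤ (m + 1) * ‖dropCoord i x‖ := by
  set w := x - (x i) • EuclideanSpace.single i (1 : ℝ) with hw
  have hwi : ∀ j, |w j| ≤ ‖dropCoord i x‖ := by
    intro j
    refine Fin.succAboveCases i ?_ (fun k => ?_) j
    · simp [hw]
    · have := norm_le_pi_norm (dropCoord i x) k
      simpa [hw, dropCoord, Fin.succAbove_ne] using this
  have h1 : w = ∑ j, w j • EuclideanSpace.single j (1 : ℝ) := by
    ext k
    simp [Finset.sum_apply, Pi.single_apply]
  rw [h1]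
  refine (norm_sum_le _ _).trans ?_
  refine (Finset.sum_le_card_nsmul _ _ ‖dropCoord i x‖ fun j _ => ?_).trans (by simp)
  simpa [norm_smul] using hwi j

/-- Some partial derivative of the defining function ρ is nonzero at x₀, and strict
differentiability makes ρ uniformly close to its linear part near x₀. This one estimate gives both
conclusions: applied to two boundary points, where ρ vanishes, it bounds their difference by its
projection; applied to x and x - se it shows that ρ is negative at the latter. -/
theorem exists_graph_chart {m : ℕ} {U : Set (Euc (m + 1))} (hU : IsOpen U) (hC1 : HasC1Boundary U)
    {x₀ : Euc (m + 1)} (hx₀ : x₀ ∈ frontier U) :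
    ∃ (i : Fin (m + 1)) (K : NNReal) (σ r : ℝ), (σ = 1 ∨ σ = -1) ∧ 0 < r ∧ r ≤ 1 ∧
      (∀ x ∈ frontier U ∩ Metric.ball x₀ r, ∀ y ∈ frontier U ∩ Metric.ball x₀ r,
        dist x y ≤ K * dist (dropCoord i x) (dropCoord i y)) ∧
      (∀ x ∈ frontier U ∩ Metric.ball x₀ r, ∀ s ∈ Ioo 0 r,
        x - s • EuclideanSpace.single i σ ∈ U) := by
  obtain ⟨V, hV, hxV, ρ, hρ, hd, hVU⟩ := hC1 x₀ hx₀
  set L := fderiv ℝ ρ x₀ with hL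
  obtain ⟨i, hi⟩ : ∃ i, L (EuclideanSpace.single i (1 : ℝ)) ≠ 0 := by
    by_contra! h0
    refine hd (ContinuousLinearMap.ext fun x => ?_)
    have h1 : x = ∑ j, x j • EuclideanSpace.single j (1 : ℝ) := by
      ext k
      simp [Finset.sum_apply, Pi.single_apply]
    rw [h1, map_sum]
    simp [h0]
  -- The sign σ makes ρ increase along e. The slope is written 2c so that an error of at most c
  -- times the distance leaves a margin of c.
  obtain ⟨σ, c, hσ, hc, hLc⟩ : ∃ σ c : ℝ, (σ = 1 ∨ σ = -1) ∧ 0 < c ∧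
      L (EuclideanSpace.single i σ) = 2 * c := by
    rcases lt_or_gt_of_ne hi with h | h
    · refine ⟨-1, -L (EuclideanSpace.single i (1 : ℝ)) / 2, Or.inr rfl, by linarith, ?_⟩
      have : EuclideanSpace.single i (-1 : ℝ) = -EuclideanSpace.single i (1 : ℝ) := by
        ext k; by_cases hk : k = i <;> simp [hk]
      rw [this, map_neg]; ring
    · exact ⟨1, L (EuclideanSpace.single i (1 : ℝ)) / 2, Or.inl rfl, by linarith, by ring⟩
  set e : Euc (m + 1) := EuclideanSpace.single i σ with he
  have hen : ‖e‖ = 1 := by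
    rcases hσ with rfl | rfl <;> simp [he]
  have hstrict : HasStrictFDerivAt ρ L x₀ :=
    (hρ.contDiffAt (hV.mem_nhds hxV)).hasStrictFDerivAt (by simp)
  have hev := (hasStrictFDerivAt_iff_isLittleO.1 hstrict).def hc
  obtain ⟨r₀, hr₀, hball⟩ := Metric.eventually_nhds_iff_ball.1
    (hev.and ((hV.prod hV).mem_nhds (show (x₀, x₀) ∈ V ×ˢ V from ⟨hxV, hxV⟩)))
  have hB : ∀ x ∈ Metric.ball x₀ r₀, ∀ y ∈ Metric.ball x₀ r₀,
      |ρ x - ρ y - L (x - y)| ≤ c * ‖x - y‖ ∧ x ∈ V ∧ y ∈ V := by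
    intro x hx y hy
    have hmem : (x, y) ∈ Metric.ball (x₀, x₀) r₀ := by
      rw [Metric.mem_ball, Prod.dist_eq]
      exact max_lt hx hy
    have := hball (x, y) hmem
    exact ⟨this.1, this.2.1, this.2.2⟩
  have hρ0 : ∀ x ∈ frontier U, x ∈ V → ρ x = 0 := fun x hx hxV =>
    eq_zero_of_mem_frontier hU hV hρ.continuousOn hVU hx hxV
  set r := min (r₀ / 2) 1 with hr
  have hrpos : 0 < r := lt_min (by linarith) one_pos
  have hr2 : r ≤ r₀ / 2 := min_le_left _ _
  have hsub : Metric.ball x₀ r ⊆ Metric.ball x₀ r₀ := Metric.ball_subset_ball (by linarith)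
  refine ⟨i, Real.toNNReal (((‖L‖ + c) / c + 1) * (m + 1)), σ, r, hσ, hrpos, min_le_right _ _,
    ?_, ?_⟩
  · rintro x ⟨hxU, hxB⟩ y ⟨hyU, hyB⟩
    obtain ⟨h1, hxV, hyV⟩ := hB x (hsub hxB) y (hsub hyB)
    rw [hρ0 x hxU hxV, hρ0 y hyU hyV] at h1
    have hdd : dist (dropCoord i x) (dropCoord i y) = ‖dropCoord i (x - y)‖ := by
      rw [dist_eq_norm]; rfl
    rw [dist_eq_norm, hdd, Real.coe_toNNReal _ (by positivity)]
    set z := x - y with hz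
    set w := z - (z i) • EuclideanSpace.single i (1 : ℝ) with hw
    have hwn : ‖w‖ ≤ (m + 1) * ‖dropCoord i z‖ := norm_le_sqrt_mul_dropCoord i z
    have hze : z = w + (z i * σ) • e := by
      have : (z i * σ) • e = (z i) • EuclideanSpace.single i (1 : ℝ) := by
        rw [he]
        ext k
        by_cases hk : k = i
        · subst hk; rcases hσ with rfl | rfl <;> simp
        · simp [hk]
      rw [this, hw]; abel
    set h := z i * σ with hh
    have hLz : L z = L w + h * (2 * c) := by
      rw [hze, map_add, map_smul, hLc]; simp
    have hzn : ‖z‖ ≤ ‖w‖ + |h| := by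
      conv_lhs => rw [hze]
      refine (norm_add_le _ _).trans ?_
      simp [norm_smul, hen]
    have hLw : |L w| ≤ ‖L‖ * ‖w‖ := L.le_opNorm w
    have h2 : |h| * (2 * c) ≤ |L z| + |L w| := by
      have : h * (2 * c) = L z - L w := by rw [hLz]; ring
      calc |h| * (2 * c) = |h * (2 * c)| := by rw [abs_mul h, abs_of_pos (by positivity : 0 < 2 * c)]
        _ = |L z - L w| := by rw [this]
        _ ≤ |L z| + |L w| := abs_sub _ _
    have h3 : |L z| ≤ c * ‖z‖ := by simpa using h1
    -- Of the slope 2c, half is spent on the part c|h| of c‖z‖ ≤ c(‖w‖+|h|).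
    have h4 : |h| * c ≤ (‖L‖ + c) * ‖w‖ := by nlinarith
    have h5 : |h| ≤ (‖L‖ + c) / c * ‖w‖ := by
      rw [div_mul_eq_mul_div, le_div_iff₀ hc]; exact h4
    calc ‖z‖ ≤ ((‖L‖ + c) / c + 1) * ‖w‖ := by linarith
      _ ≤ ((‖L‖ + c) / c + 1) * ((m + 1) * ‖dropCoord i z‖) := by gcongr
      _ = _ := by ring
  · rintro x ⟨hxU, hxB⟩ s hs
    have hxs : x - s • e ∈ Metric.ball x₀ r₀ := by
      rw [Metric.mem_ball, dist_eq_norm]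
      have h1 : ‖x - x₀‖ < r := by simpa [dist_eq_norm] using hxB
      have h2 : x - s • e - x₀ = (x - x₀) - s • e := by abel
      rw [h2]
      refine (norm_sub_le _ _).trans_lt ?_
      rw [norm_smul, hen, Real.norm_of_nonneg hs.1.le]
      have := hs.2
      linarith
    obtain ⟨h1, hyV, hxV⟩ := hB _ hxs x (hsub hxB)
    refine (hVU _ hyV).2 ?_
    rw [hρ0 x hxU hxV] at h1
    have h2 : x - s • e - x = -(s • e) := by abel
    rw [h2, map_neg, map_smul, hLc, norm_neg, norm_smul, hen, Real.norm_of_nonneg hs.1.le] at h1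
    have h3 := (abs_le.1 h1).2
    simp only [smul_eq_mul, mul_one, sub_zero] at h3
    have := mul_pos hs.1 hc
    linarith

/-- The trace inequality for Lipschitz functions on a bounded `C¹` domain. -/
theorem exists_trace_inequality {n : ℕ} (hn : n ≠ 0) {U : Set (Euc n)} (hU : IsOpen U)
    (hb : Bornology.IsBounded U) (hC1 : HasC1Boundary U) :
    ∃ C : NNReal, ∀ (L : NNReal) (f : Euc n → ℝ), LipschitzWith L f →
      ∫⁻ x, ENNReal.ofReal (f x) ∂(surfaceMeasure U) ≤
        C * ∫⁻ x in U, (ENNReal.ofReal (f x) + ENNReal.ofReal ‖gradient f x‖) := by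
  obtain ⟨m, rfl⟩ := Nat.exists_eq_succ_of_ne_zero hn
  have hloc : ∀ x₀ ∈ frontier U, ∃ r > 0, ∃ C : NNReal, ∀ (L : NNReal) (f : Euc (m + 1) → ℝ),
      LipschitzWith L f → ∫⁻ x in frontier U ∩ Metric.ball x₀ r, ENNReal.ofReal (f x)
        ∂(Measure.euclideanHausdorffMeasure m) ≤
        C * ∫⁻ x in U, (ENNReal.ofReal (f x) + ENNReal.ofReal ‖gradient f x‖) := by
    intro x₀ hx₀
    obtain ⟨i, K, σ, r, hσ, hr, hr1, hK, hSU⟩ := exists_graph_chart hU hC1 hx₀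
    exact ⟨r, hr, exists_lintegral_le_of_graph i K σ hσ _ U r hr hr1
      (isClosed_frontier.measurableSet.inter Metric.isOpen_ball.measurableSet)
      hU.measurableSet hK hSU⟩
  choose! r hr C hC using hloc
  have hcomp : IsCompact (frontier U) :=
    Metric.isCompact_of_isClosed_isBounded isClosed_frontier
      (hb.closure.subset frontier_subset_closure)
  obtain ⟨t, ht, hcov⟩ := hcomp.elim_nhds_subcover (fun x => Metric.ball x (r x))
    fun x hx => Metric.ball_mem_nhds x (hr x hx)
  refine ⟨∑ x ∈ t, C x, fun L f hf => ?_⟩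
  have h1 : frontier U ⊆ ⋃ x ∈ t, frontier U ∩ Metric.ball x (r x) := by
    intro y hy
    obtain ⟨x, hx, hyx⟩ := mem_iUnion₂.1 (hcov hy)
    exact mem_iUnion₂.2 ⟨x, hx, hy, hyx⟩
  calc ∫⁻ x, ENNReal.ofReal (f x) ∂(surfaceMeasure U)
      ≤ ∫⁻ x in ⋃ x ∈ t, frontier U ∩ Metric.ball x (r x), ENNReal.ofReal (f x)
          ∂(Measure.euclideanHausdorffMeasure m) := lintegral_mono_set h1
    _ ≤ ∑ x ∈ t, ∫⁻ y in frontier U ∩ Metric.ball x (r x), ENNReal.ofReal (f y)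
          ∂(Measure.euclideanHausdorffMeasure m) := by
        rw [← lintegral_finsetSum_measure]
        exact lintegral_mono' (restrict_biUnion_finset_le _ _) le_rfl
    _ ≤ ∑ x ∈ t, C x * ∫⁻ y in U, (ENNReal.ofReal (f y) + ENNReal.ofReal ‖gradient f y‖) :=
        Finset.sum_le_sum fun x hx => hC x (ht x hx) L f hf
    _ = _ := by rw [← Finset.sum_mul]; push_cast; rfl

/-- The trace inequality for the constant function 1 bounds the area of Γ by a multiple of the
volume of U. Finiteness is needed for product measures on the lateral boundary. -/
theorem isFiniteMeasure_surfaceMeasure {n : ℕ} (hn : n ≠ 0) {U : Set (Euc n)} (hU : IsOpen U)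
    (hb : Bornology.IsBounded U) (hC1 : HasC1Boundary U) : IsFiniteMeasure (surfaceMeasure U) := by
  obtain ⟨C, hC⟩ := exists_trace_inequality hn hU hb hC1
  have h := hC 0 (fun _ => 1) (LipschitzWith.const 1)
  simp only [ENNReal.ofReal_one, lintegral_const, one_mul, gradient_fun_const, norm_zero,
    ENNReal.ofReal_zero, add_zero, Measure.restrict_apply_univ] at h
  exact ⟨h.trans_lt (ENNReal.mul_lt_top ENNReal.coe_lt_top hb.measure_lt_top)⟩

/-! ### Powers of bounded Lipschitz functions and the chain rule in time -/

theorem exists_lipschitzWith_rpow {E : Type*} [PseudoMetricSpace E] {f : E → ℝ} {K : NNReal}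
    {M β : ℝ} (hf : LipschitzWith K f) (h0 : ∀ x, 0 ≤ f x) (hM : ∀ x, f x ≤ M) (hβ : 1 ≤ β) :
    ∃ K' : NNReal, LipschitzWith K' (fun x => f x ^ β) := by
  have h1 : LipschitzOnWith (Real.toNNReal (β * M ^ (β - 1))) (fun x : ℝ => x ^ β) (Icc 0 M) := by
    refine (convex_Icc 0 M).lipschitzOnWith_of_nnnorm_deriv_le
      (fun x _ => (Real.hasDerivAt_rpow_const (Or.inr hβ)).differentiableAt) fun x hx => ?_
    rw [(Real.hasDerivAt_rpow_const (Or.inr hβ)).deriv, ← NNReal.coe_le_coe, coe_nnnorm,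
      Real.norm_of_nonneg (by have := hx.1; positivity), Real.coe_toNNReal _ (by
        have := hx.1.trans hx.2; positivity)]
    exact mul_le_mul_of_nonneg_left (Real.rpow_le_rpow hx.1 hx.2 (by linarith)) (by linarith)
  refine ⟨Real.toNNReal (β * M ^ (β - 1)) * K, LipschitzWith.of_dist_le_mul fun x y => ?_⟩
  have h2 := h1.dist_le_mul (f x) ⟨h0 x, hM x⟩ (f y) ⟨h0 y, hM y⟩
  refine h2.trans ?_
  rw [NNReal.coe_mul, mul_assoc]
  exact mul_le_mul_of_nonneg_left (hf.dist_le_mul x y) (NNReal.coe_nonneg _)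

theorem exists_lipschitzWith_mul {E : Type*} [PseudoMetricSpace E] {f g : E → ℝ}
    {Kf Kg : NNReal} {A B : ℝ} (hf : LipschitzWith Kf f) (hg : LipschitzWith Kg g)
    (hA : ∀ x, |f x| ≤ A) (hB : ∀ x, |g x| ≤ B) :
    ∃ K : NNReal, LipschitzWith K (fun x => f x * g x) := by
  refine ⟨Real.toNNReal (A * Kg + B * Kf), LipschitzWith.of_dist_le_mul fun x y => ?_⟩
  have hA0 : 0 ≤ A := (abs_nonneg _).trans (hA x)
  have hB0 : 0 ≤ B := (abs_nonneg _).trans (hB x)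
  rw [Real.coe_toNNReal _ (by positivity), Real.dist_eq]
  have h1 := hf.dist_le_mul x y
  have h2 := hg.dist_le_mul x y
  rw [Real.dist_eq] at h1 h2
  have : f x * g x - f y * g y = f x * (g x - g y) + g y * (f x - f y) := by ring
  rw [this]
  refine (abs_add_le _ _).trans ?_
  rw [abs_mul, abs_mul]
  calc |f x| * |g x - g y| + |g y| * |f x - f y|
      ≤ A * (Kg * dist x y) + B * (Kf * dist x y) := by
        gcongr
        · exact hA x
        · exact hB y
    _ = _ := by ring

theorem ae_differentiableAt_of_lipschitz {w : ℝ → ℝ} {K : NNReal} (hw : LipschitzWith K w) :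
    ∀ᵐ s, DifferentiableAt ℝ w s := by
  simpa using hw.ae_differentiableAt (μ := volume)

theorem intervalIntegrable_deriv_of_lipschitz {w : ℝ → ℝ} {K : NNReal} (hw : LipschitzWith K w)
    (a b : ℝ) : IntervalIntegrable (deriv w) volume a b :=
  (hw.lipschitzOnWith (s := uIcc a b)).absolutelyContinuousOnInterval.intervalIntegrable_deriv

/-- The chain rule in time behind testing `(u^λ)_t` with `u^(α-λ) θ`. -/
theorem integral_rpow_mul_deriv {w θ : ℝ → ℝ} {Kw Kθ : NNReal} {M lam α t₁ t₂ : ℝ}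
    (hw : LipschitzWith Kw w) (hw0 : ∀ s, 0 ≤ w s) (hwM : ∀ s, w s ≤ M)
    (hθ : LipschitzWith Kθ θ) (hθ1 : ∀ s, |θ s| ≤ 1) (h1 : θ t₁ = 0) (h2 : θ t₂ = 0)
    (h12 : t₁ ≤ t₂) (hlam : 0 < lam) (hα : lam + 1 < α) :
    ∫ s in Ioo t₁ t₂, w s ^ lam * deriv (fun s => w s ^ (α - lam) * θ s) s =
      lam / α * ∫ s in Ioo t₁ t₂, w s ^ α * deriv θ s := by
  have hα0 : 0 < α := by linarith
  obtain ⟨K₁, hK₁⟩ := exists_lipschitzWith_rpow hw hw0 hwM (β := α) (by linarith)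
  have hbd : ∀ s, |w s ^ α| ≤ M ^ α := fun s => by
    rw [abs_of_nonneg (Real.rpow_nonneg (hw0 s) _)]
    exact Real.rpow_le_rpow (hw0 s) (hwM s) hα0.le
  obtain ⟨K₂, hK₂⟩ := exists_lipschitzWith_mul hK₁ hθ hbd hθ1
  have hFTC := (hK₂.lipschitzOnWith
    (s := uIcc t₁ t₂)).absolutelyContinuousOnInterval.integral_deriv_eq_sub
  simp only [h1, h2, mul_zero, sub_zero] at hFTC
  have hi1 : IntervalIntegrable (deriv fun s => w s ^ α * θ s) volume t₁ t₂ :=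
    intervalIntegrable_deriv_of_lipschitz hK₂ _ _
  have hi2 : IntervalIntegrable (fun s => w s ^ α * deriv θ s) volume t₁ t₂ :=
    (intervalIntegrable_deriv_of_lipschitz hθ t₁ t₂).continuousOn_mul
      hK₁.continuous.continuousOn
  -- The first summand is an exact derivative of a function vanishing at both ends, so only the term
  -- with θ' survives integration.
  have hae : ∀ᵐ s, w s ^ lam * deriv (fun s => w s ^ (α - lam) * θ s) s =
      (α - lam) / α * deriv (fun s => w s ^ α * θ s) s + lam / α * (w s ^ α * deriv θ s) := by
    filter_upwards [ae_differentiableAt_of_lipschitz hw, ae_differentiableAt_of_lipschitz hθ]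
      with s hs hs'
    have d1 := (hs.hasDerivAt.rpow_const (p := α - lam) (Or.inr (by linarith))).mul hs'.hasDerivAt
    have d2 := (hs.hasDerivAt.rpow_const (p := α) (Or.inr (by linarith))).mul hs'.hasDerivAt
    have e1 : w s ^ lam * w s ^ (α - lam - 1) = w s ^ (α - 1) := by
      rw [← Real.rpow_add_of_nonneg (hw0 s) hlam.le (by linarith)]; congr 1; ring
    have e2 : w s ^ lam * w s ^ (α - lam) = w s ^ α := by
      rw [← Real.rpow_add_of_nonneg (hw0 s) hlam.le (by linarith)]; congr 1; ring
    have d1' : deriv (fun s => w s ^ (α - lam) * θ s) s = _ := d1.deriv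
    have d2' : deriv (fun s => w s ^ α * θ s) s = _ := d2.deriv
    rw [d1', d2']
    calc _ = (w s ^ lam * w s ^ (α - lam - 1)) * (deriv w s * (α - lam) * θ s) +
          (w s ^ lam * w s ^ (α - lam)) * deriv θ s := by ring
      _ = _ := by
        rw [e1, e2]
        field_simp
        ring
  rw [← integral_Ioc_eq_integral_Ioo, ← integral_Ioc_eq_integral_Ioo,
    ← intervalIntegral.integral_of_le h12, ← intervalIntegral.integral_of_le h12,
    intervalIntegral.integral_congr_ae (hae.mono fun s hs _ => hs),
    intervalIntegral.integral_add (hi1.const_mul _) (hi2.const_mul _),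
    intervalIntegral.integral_const_mul, intervalIntegral.integral_const_mul, hFTC]
  ring

/-! ### Pointwise lower bound for the flux -/

theorem add_rpow_le_two_mul {a b p : ℝ} (ha : 0 ≤ a) (hb : 0 ≤ b) (hp : 1 ≤ p) (hp2 : p ≤ 2) :
    (a + b) ^ p ≤ 2 * (a ^ p + b ^ p) := by
  have h := NNReal.rpow_add_le_mul_rpow_add_rpow ⟨a, ha⟩ ⟨b, hb⟩ hp
  have h' : (a + b) ^ p ≤ 2 ^ (p - 1) * (a ^ p + b ^ p) := by exact_mod_cast h
  refine h'.trans (mul_le_mul_of_nonneg_right ?_ (by positivity))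
  calc (2 : ℝ) ^ (p - 1) ≤ 2 ^ (1 : ℝ) :=
        Real.rpow_le_rpow_of_exponent_le (by norm_num) (by linarith)
    _ = 2 := Real.rpow_one 2

/-- Coercivity concerns y = g + z^(2λ)ζ rather than g. The defect X·z^(2λ)ζ is bounded by growth and
split by Young's inequality; one part is absorbed into the coercive term, and the convexity bound
for the power 2-a converts |y| back to |g|. -/
theorem inner_flux_lower_bound {E : Type*} [NormedAddCommGroup E] [InnerProductSpace ℝ E]
    {a lam χ cZ z w₀ w₁ w₂ : ℝ} (ha0 : 0 < a) (ha1 : a < 1) (hlam : 0 < lam) (hχ : 1 ≤ χ)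
    (hcZ : 0 < cZ) (hz : 0 ≤ z) (hw₀ : 0 < w₀) (hw₁ : 0 < w₁) {X ζ g : E}
    (hζ : ‖ζ‖ ≤ cZ * χ ^ 2)
    (hgrowth : ‖X‖ ≤ w₀ * ‖g + z ^ (2 * lam) • ζ‖ ^ (1 - a))
    (hcoer : w₁ * ‖g + z ^ (2 * lam) • ζ‖ ^ (2 - a) / (χ ^ 2 * (1 + z) ^ (2 * lam)) - w₂ ≤
      inner ℝ X (g + z ^ (2 * lam) • ζ)) :
    1 / (4 * χ ^ 2) * (w₁ * ‖g‖ ^ (2 - a) / (1 + z) ^ (2 * lam)) ≤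
      inner ℝ X g + (w₂ + cZ ^ (2 - a) * χ ^ (2 * (3 - 2 * a)) *
        ((w₀ ^ (2 - a) * w₁ ^ (a - 1) + w₁) *
          ((1 + z) ^ (2 * lam * (1 - a)) * z ^ (2 * lam * (2 - a))))) := by
  set y := g + z ^ (2 * lam) • ζ with hy
  set Y := ‖y‖ with hY
  set B := χ ^ 2 * (1 + z) ^ (2 * lam) with hB
  set b := z ^ (2 * lam) * (cZ * χ ^ 2) with hb
  have hz1 : 1 ≤ (1 + z) ^ (2 * lam) := Real.one_le_rpow (by linarith) (by linarith)
  have hB1 : 1 ≤ B := one_le_mul_of_one_le_of_one_le (one_le_pow₀ hχ) hz1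
  have hB0 : 0 < B := by linarith
  have hY0 : 0 ≤ Y := norm_nonneg _
  have hb0 : 0 ≤ b := by positivity
  have hbn : ‖z ^ (2 * lam) • ζ‖ ≤ b := by
    rw [norm_smul, Real.norm_of_nonneg (by positivity)]
    exact mul_le_mul_of_nonneg_left hζ (by positivity)
  have hsplit : inner ℝ X g = inner ℝ X y - inner ℝ X (z ^ (2 * lam) • ζ) := by
    rw [hy, inner_add_right]; ring
  have hcs : inner ℝ X (z ^ (2 * lam) • ζ) ≤ w₀ * Y ^ (1 - a) * b :=
    (real_inner_le_norm _ _).trans (mul_le_mul hgrowth hbn (norm_nonneg _) (by positivity))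
  -- Young's inequality
  have hpq : ((2 - a) / (1 - a)).HolderConjugate (2 - a) := by
    rw [Real.holderConjugate_iff]
    refine ⟨by rw [lt_div_iff₀] <;> linarith, ?_⟩
    have : 2 - a ≠ 0 := by linarith
    rw [inv_div]; field_simp; ring
  have h1a : 0 < 1 - a := by linarith
  have hY' : w₀ * Y ^ (1 - a) * b ≤ (1 - a) / (2 - a) * (w₁ * Y ^ (2 - a) / B) +
      1 / (2 - a) * (w₀ ^ (2 - a) * w₁ ^ (a - 1) * B ^ (1 - a) * b ^ (2 - a)) := by
    -- Young's inequality is weighted by w₁/B, the coefficient of the coercive term, so that its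
    -- first part is exactly a multiple of that term. The multiple (1-a)/(2-a) is at most 1/2, which
    -- leaves half of it.
    have hk : 0 < w₁ / B := by positivity
    have h := Real.young_inequality_of_nonneg
      (a := (w₁ / B) ^ ((1 - a) / (2 - a)) * Y ^ (1 - a))
      (b := w₀ * b * (w₁ / B) ^ (-((1 - a) / (2 - a)))) (by positivity) (by positivity) hpq
    have e1 : (w₁ / B) ^ ((1 - a) / (2 - a)) * Y ^ (1 - a) *
        (w₀ * b * (w₁ / B) ^ (-((1 - a) / (2 - a)))) = w₀ * Y ^ (1 - a) * b := by
      rw [Real.rpow_neg hk.le]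
      have : (w₁ / B) ^ ((1 - a) / (2 - a)) ≠ 0 := (Real.rpow_pos_of_pos hk _).ne'
      field_simp
    have e2 : ((w₁ / B) ^ ((1 - a) / (2 - a)) * Y ^ (1 - a)) ^ ((2 - a) / (1 - a)) =
        w₁ * Y ^ (2 - a) / B := by
      rw [Real.mul_rpow (by positivity) (by positivity), ← Real.rpow_mul hk.le,
        ← Real.rpow_mul hY0]
      have i1 : (1 - a) / (2 - a) * ((2 - a) / (1 - a)) = 1 := by
        have : 2 - a ≠ 0 := by linarith
        field_simp
      have i2 : (1 - a) * ((2 - a) / (1 - a)) = 2 - a := by field_simp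
      rw [i1, i2, Real.rpow_one]; ring
    have e3 : (w₀ * b * (w₁ / B) ^ (-((1 - a) / (2 - a)))) ^ (2 - a) =
        w₀ ^ (2 - a) * w₁ ^ (a - 1) * B ^ (1 - a) * b ^ (2 - a) := by
      rw [Real.mul_rpow (by positivity) (by positivity), Real.mul_rpow hw₀.le hb0,
        ← Real.rpow_mul hk.le]
      have i1 : -((1 - a) / (2 - a)) * (2 - a) = a - 1 := by
        have : 2 - a ≠ 0 := by linarith
        field_simp; ring
      have i2 : B ^ (1 - a) = (B ^ (a - 1))⁻¹ := by
        rw [← Real.rpow_neg hB0.le]; congr 1; ring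
      rw [i1, Real.div_rpow hw₁.le hB0.le, i2]
      ring
    rw [e1, e2, e3] at h
    refine h.trans (le_of_eq ?_)
    have : 2 - a ≠ 0 := by linarith
    field_simp
  set R := w₀ ^ (2 - a) * w₁ ^ (a - 1) * B ^ (1 - a) * b ^ (2 - a) with hR
  have hR0 : 0 ≤ R := by positivity
  set A := w₁ * Y ^ (2 - a) / B with hA
  have hA0 : 0 ≤ A := by positivity
  have hc1 : (1 - a) / (2 - a) ≤ 1 / 2 := by
    rw [div_le_div_iff₀ (by linarith) (by norm_num)]; linarith
  have hc2 : 1 / (2 - a) ≤ 1 := by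
    rw [div_le_one (by linarith)]; linarith
  have hlow : A / 2 ≤ inner ℝ X g + w₂ + R := by
    have := mul_le_mul_of_nonneg_right hc1 hA0
    have := mul_le_mul_of_nonneg_right hc2 hR0
    rw [hsplit]
    linarith
  have hg : ‖g‖ ^ (2 - a) ≤ 2 * (Y ^ (2 - a) + b ^ (2 - a)) := by
    have : ‖g‖ ≤ Y + b := by
      have : g = y - z ^ (2 * lam) • ζ := by rw [hy]; abel
      rw [this]
      exact (norm_sub_le _ _).trans (add_le_add le_rfl hbn)
    exact (Real.rpow_le_rpow (norm_nonneg _) this (by linarith)).trans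
      (add_rpow_le_two_mul hY0 hb0 (by linarith) (by linarith))
  -- Converting |y| to |g| leaves w₁ b^(2-a)/B. Enlarging 1/B to B^(1-a) gives it the form of the
  -- Young remainder; this is the origin of the summand W₁ in W₃.
  have hBB : 1 / B ≤ B ^ (1 - a) :=
    ((div_le_one hB0).2 hB1).trans (Real.one_le_rpow hB1 h1a.le)
  have hfin : B ^ (1 - a) * b ^ (2 - a) = cZ ^ (2 - a) * χ ^ (2 * (3 - 2 * a)) *
      ((1 + z) ^ (2 * lam * (1 - a)) * z ^ (2 * lam * (2 - a))) := by
    have hχ0 : 0 < χ := by linarith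
    rw [hB, hb, Real.mul_rpow (by positivity) (by positivity),
      Real.mul_rpow (by positivity) (by positivity), Real.mul_rpow (by positivity) (by positivity),
      ← Real.rpow_mul (by linarith), ← Real.rpow_mul hz, ← Real.rpow_natCast,
      ← Real.rpow_mul hχ0.le, ← Real.rpow_mul hχ0.le]
    have : χ ^ (2 * (3 - 2 * a)) = χ ^ (((2 : ℕ) : ℝ) * (1 - a)) * χ ^ (((2 : ℕ) : ℝ) * (2 - a)) := by
      rw [← Real.rpow_add hχ0]; congr 1; push_cast; ring
    rw [this]; ring
  calc 1 / (4 * χ ^ 2) * (w₁ * ‖g‖ ^ (2 - a) / (1 + z) ^ (2 * lam))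
      = w₁ / (4 * B) * ‖g‖ ^ (2 - a) := by rw [hB]; field_simp
    _ ≤ w₁ / (4 * B) * (2 * (Y ^ (2 - a) + b ^ (2 - a))) := by gcongr
    _ = A / 2 + w₁ / 2 * (1 / B) * b ^ (2 - a) := by rw [hA]; field_simp; ring
    _ ≤ (inner ℝ X g + w₂ + R) + w₁ * B ^ (1 - a) * b ^ (2 - a) := by
        gcongr
        linarith
    _ = inner ℝ X g + (w₂ + (w₀ ^ (2 - a) * w₁ ^ (a - 1) + w₁) * (B ^ (1 - a) * b ^ (2 - a))) := by
        rw [hR]; ring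
    _ = _ := by rw [hfin]; ring

/-! ### Global Lipschitz models of the solution and their spatial gradients -/

theorem exists_bounded_extension {n : ℕ} {U : Set (Euc n)} (hb : Bornology.IsBounded U)
    {u : Euc n → ℝ → ℝ} {t₁ t₂ : ℝ} {K : NNReal}
    (hu : LipschitzOnWith K (fun p : Euc n × ℝ => u p.1 p.2) (closure U ×ˢ Icc t₁ t₂))
    (h0 : ∀ x ∈ closure U, ∀ t ∈ Icc t₁ t₂, 0 ≤ u x t) :
    ∃ (v : Euc n × ℝ → ℝ) (M : ℝ), 0 ≤ M ∧ LipschitzWith K v ∧ (∀ p, 0 ≤ v p) ∧ (∀ p, v p ≤ M) ∧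
      ∀ x ∈ closure U, ∀ t ∈ Icc t₁ t₂, v (x, t) = u x t := by
  obtain ⟨w, hw, hwu⟩ := hu.extend_real
  have hc : IsCompact (closure U ×ˢ Icc t₁ t₂) := hb.isCompact_closure.prod isCompact_Icc
  obtain ⟨M, hM⟩ := (hc.bddAbove_image hu.continuousOn)
  -- Truncating the extension to [0, M] keeps its Lipschitz constant and makes its powers with
  -- exponent at least 1 globally Lipschitz.
  refine ⟨fun p => max 0 (min (w p) (max M 0)), max M 0, le_max_right _ _,
    (hw.min_const _).const_max 0, fun p => le_max_left _ _,
    fun p => max_le (le_max_right _ _) (min_le_right _ _), fun x hx t ht => ?_⟩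
  have h1 : u x t = w (x, t) := hwu (show (x, t) ∈ closure U ×ˢ Icc t₁ t₂ from ⟨hx, ht⟩)
  have h2 : u x t ≤ M := hM ⟨(x, t), ⟨hx, ht⟩, rfl⟩
  show max 0 (min (w (x, t)) (max M 0)) = u x t
  rw [← h1, min_eq_left (h2.trans (le_max_left _ _)), max_eq_right (h0 x hx t ht)]

/-- This passes from the integrals over (0,∞) in the weak formulation to a slab, where u agrees with
a Lipschitz model. -/
theorem integral_eq_of_time_support {X F : Type*} [MeasurableSpace X] [NormedAddCommGroup F]
    [NormedSpace ℝ F] (μ : Measure X) [SFinite μ] {t₁ t₂ : ℝ} (h1 : 0 < t₁) (f : X × ℝ → F)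
    (hf : ∀ p : X × ℝ, p.2 ∉ Icc t₁ t₂ → f p = 0) :
    ∫ p, f p ∂(μ.prod (volume.restrict (Ioi 0))) =
      ∫ p, f p ∂(μ.prod (volume.restrict (Ioo t₁ t₂))) := by
  have h2 : μ.prod (volume.restrict (Ioo t₁ t₂)) =
      (μ.prod (volume.restrict (Ioi (0 : ℝ)))).restrict (univ ×ˢ Icc t₁ t₂) := by
    rw [← Measure.prod_restrict, Measure.restrict_univ, Measure.restrict_restrict measurableSet_Icc,
      inter_eq_left.2 (show Icc t₁ t₂ ⊆ Ioi 0 from fun t ht => h1.trans_le ht.1), Measure.restrict_congr_set Ioo_ae_eq_Icc]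
  rw [h2, setIntegral_eq_integral_of_forall_compl_eq_zero]
  intro p hp
  exact hf p fun h => hp ⟨mem_univ _, h⟩

/-- The spatial gradient of a function of space and time. -/
def spaceGrad {n : ℕ} (v : Euc n × ℝ → ℝ) (p : Euc n × ℝ) : Euc n :=
  gradient (fun y => v (y, p.2)) p.1

theorem measurable_spaceGrad {n : ℕ} {v : Euc n × ℝ → ℝ} (hv : Continuous v) :
    Measurable (spaceGrad v) := by
  have h1 : Continuous (Function.uncurry fun (t : ℝ) (y : Euc n) => v (y, t)) :=
    hv.comp continuous_swap
  have h2 := (measurable_fderiv_with_param ℝ h1).comp measurable_swap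
  exact (LinearIsometryEquiv.continuous (InnerProductSpace.toDual ℝ (Euc n)).symm).measurable.comp h2

theorem lipschitzWith_slice {n : ℕ} {v : Euc n × ℝ → ℝ} {K : NNReal} (hv : LipschitzWith K v)
    (t : ℝ) : LipschitzWith K (fun y => v (y, t)) := by
  have h := hv.comp (LipschitzWith.prodMk_right t)
  rwa [mul_one] at h

theorem lipschitzWith_time_slice {n : ℕ} {v : Euc n × ℝ → ℝ} {K : NNReal} (hv : LipschitzWith K v)
    (x : Euc n) : LipschitzWith K (fun t => v (x, t)) := by
  have h := hv.comp (LipschitzWith.prodMk_left x)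
  rwa [mul_one] at h

theorem norm_spaceGrad_le {n : ℕ} {v : Euc n × ℝ → ℝ} {K : NNReal} (hv : LipschitzWith K v)
    (p : Euc n × ℝ) : ‖spaceGrad v p‖ ≤ K := by
  rw [spaceGrad, norm_gradient_eq]
  exact norm_fderiv_le_of_lipschitz ℝ (lipschitzWith_slice hv p.2)

/-- Rademacher's theorem holds in every time slice; Fubini assembles the slices because the set of
points of differentiability is jointly measurable for a continuous function. -/
theorem ae_differentiableAt_slice {n : ℕ} {v : Euc n × ℝ → ℝ} {K : NNReal} (hv : LipschitzWith K v)
    (U : Set (Euc n)) (s t : ℝ) :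
    ∀ᵐ p ∂(cylinderMeasure U s t), DifferentiableAt ℝ (fun y => v (y, p.2)) p.1 := by
  have h1 : Continuous (Function.uncurry fun (t : ℝ) (y : Euc n) => v (y, t)) :=
    hv.continuous.comp continuous_swap
  have h2 : MeasurableSet {p : ℝ × Euc n | DifferentiableAt ℝ (fun y => v (y, p.1)) p.2} :=
    measurableSet_of_differentiableAt_with_param ℝ h1
  have h3 : ∀ᵐ p ∂((volume.restrict (Ioo s t)).prod (volume.restrict U)),
      DifferentiableAt ℝ (fun y => v (y, p.1)) p.2 := by
    rw [Measure.ae_prod_iff_ae_ae h2]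
    exact Eventually.of_forall fun τ =>
      ae_restrict_of_ae ((lipschitzWith_slice hv τ).ae_differentiableAt (μ := volume))
  rw [cylinderMeasure, ← Measure.prod_swap]
  exact (ae_map_iff measurable_swap.aemeasurable (measurable_swap h2)).2 h3

theorem spaceGrad_eq_of_eqOn {n : ℕ} {U : Set (Euc n)} (hU : IsOpen U) {v : Euc n × ℝ → ℝ}
    {u : Euc n → ℝ → ℝ} {t : ℝ} (h : ∀ x ∈ closure U, v (x, t) = u x t) {x : Euc n} (hx : x ∈ U) :
    gradient (fun y => u y t) x = spaceGrad v (x, t) := by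
  refine Filter.EventuallyEq.gradient_eq ?_
  filter_upwards [hU.mem_nhds hx] with y hy
  exact (h y (subset_closure hy)).symm

theorem gradient_rpow_mul {n : ℕ} {f : Euc n → ℝ} {x : Euc n} {β c : ℝ} (hβ : 1 ≤ β)
    (hf : DifferentiableAt ℝ f x) :
    gradient (fun y => f y ^ β * c) x = (c * (β * f x ^ (β - 1))) • gradient f x := by
  have h1 : HasFDerivAt (fun y => f y ^ β * c) (c • ((β * f x ^ (β - 1)) • fderiv ℝ f x)) x :=
    (hf.hasFDerivAt.rpow_const (Or.inr hβ)).mul_const c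
  rw [gradient, h1.fderiv, map_smul, map_smul, smul_smul]
  rfl

theorem ae_cylinder {n : ℕ} {U : Set (Euc n)} (hU : MeasurableSet U) (s t : ℝ) :
    ∀ᵐ p ∂(cylinderMeasure U s t), p.1 ∈ U ∧ p.2 ∈ Ioo s t := by
  rw [cylinderMeasure, Measure.prod_restrict]
  filter_upwards [ae_restrict_mem (hU.prod measurableSet_Ioo)] with p hp
  exact hp

theorem ae_lateral {n : ℕ} {U : Set (Euc n)} [IsFiniteMeasure (surfaceMeasure U)] (s t : ℝ) :
    ∀ᵐ p ∂(lateralMeasure U s t), p.1 ∈ closure U ∧ p.2 ∈ Ioo s t := by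
  have h1 : ∀ᵐ x ∂(surfaceMeasure U), x ∈ closure U := by
    filter_upwards [ae_restrict_mem isClosed_frontier.measurableSet] with x hx
    exact frontier_subset_closure hx
  have h2 : ∀ᵐ τ ∂(volume.restrict (Ioo s t)), τ ∈ Ioo s t := ae_restrict_mem measurableSet_Ioo
  have e1 := Measure.quasiMeasurePreserving_fst (μ := surfaceMeasure U)
    (ν := volume.restrict (Ioo s t))
  have e2 := Measure.quasiMeasurePreserving_snd (μ := surfaceMeasure U)
    (ν := volume.restrict (Ioo s t))
  filter_upwards [e1.ae h1, e2.ae h2] with p hp1 hp2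
  exact ⟨hp1, hp2⟩

theorem integrable_fst_mul_bdd {n : ℕ} {U : Set (Euc n)} {s t : ℝ} {w : Euc n → ℝ}
    (hw : IntegrableOn w U) {g : Euc n × ℝ → ℝ} (hg : Measurable g) {C : ℝ} (hC : ∀ p, |g p| ≤ C) :
    Integrable (fun p : Euc n × ℝ => w p.1 * g p) (cylinderMeasure U s t) := by
  have h1 : Integrable (fun p : Euc n × ℝ => w p.1) (cylinderMeasure U s t) :=
    Integrable.comp_fst hw _
  exact h1.mul_bdd hg.aestronglyMeasurable (Eventually.of_forall hC)

/-! ### Testing the equation with a power of the solution -/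

/-- A bounded global Lipschitz function agreeing with `u` on `Ū × [t₁, t₂]`. -/
structure IsSlabModel {n : ℕ} (U : Set (Euc n)) (u : Euc n → ℝ → ℝ) (t₁ t₂ : ℝ)
    (v : Euc n × ℝ → ℝ) (K : NNReal) (M : ℝ) : Prop where
  nonneg_bound : 0 ≤ M
  lipschitz : LipschitzWith K v
  nonneg : ∀ p, 0 ≤ v p
  le_bound : ∀ p, v p ≤ M
  eq : ∀ x ∈ closure U, ∀ t ∈ Icc t₁ t₂, v (x, t) = u x t

/-- A Lipschitz cut-off function in time with values in `[0,1]`. -/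
structure IsTimeCutoff (θ : ℝ → ℝ) (K : NNReal) (t₁ t₂ : ℝ) : Prop where
  lipschitz : LipschitzWith K θ
  nonneg : ∀ t, 0 ≤ θ t
  le_one : ∀ t, θ t ≤ 1
  eq_zero : ∀ t, t ∉ Ioo t₁ t₂ → θ t = 0

variable {n : ℕ} {U : Set (Euc n)} {a lam χ cZ α t₁ t₂ M : ℝ} {φ W₀ W₁ W₂ : Euc n → ℝ}
  {X : Euc n → ℝ → Euc n → Euc n} {Z : Euc n → ℝ → Euc n} {u₀ : Euc n → ℝ}
  {ψ₁ ψ₂ u : Euc n → ℝ → ℝ} {v : Euc n × ℝ → ℝ} {K Kθ : NNReal} {θ : ℝ → ℝ}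

theorem IsTimeCutoff.abs_le_one (h : IsTimeCutoff θ Kθ t₁ t₂) (t : ℝ) : |θ t| ≤ 1 := by
  rw [abs_of_nonneg (h.nonneg t)]; exact h.le_one t

theorem IsSlabModel.rpow_le (h : IsSlabModel U u t₁ t₂ v K M) {s : ℝ} (hs : 0 ≤ s)
    (p : Euc n × ℝ) : |v p ^ s| ≤ M ^ s := by
  rw [abs_of_nonneg (Real.rpow_nonneg (h.nonneg p) _)]
  exact Real.rpow_le_rpow (h.nonneg p) (h.le_bound p) hs

theorem IsSlabModel.measurable_rpow (h : IsSlabModel U u t₁ t₂ v K M) (s : ℝ) :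
    Measurable (fun p => v p ^ s) :=
  h.lipschitz.continuous.measurable.pow_const s

theorem exists_lipschitzWith_test (hv : IsSlabModel U u t₁ t₂ v K M)
    (hθ : IsTimeCutoff θ Kθ t₁ t₂) {β : ℝ} (hβ : 1 ≤ β) :
    ∃ K' : NNReal, LipschitzWith K' (fun p : Euc n × ℝ => v p ^ β * θ p.2) := by
  obtain ⟨K₁, hK₁⟩ := exists_lipschitzWith_rpow hv.lipschitz hv.nonneg hv.le_bound hβ
  have h2 : LipschitzWith (Kθ * 1) (fun p : Euc n × ℝ => θ p.2) :=
    hθ.lipschitz.comp LipschitzWith.prod_snd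
  exact exists_lipschitzWith_mul hK₁ h2 (hv.rpow_le (by linarith)) fun p => hθ.abs_le_one p.2

theorem integrable_flux_inner (hsol : IsSolution U lam φ X Z u₀ ψ₁ ψ₂ u)
    (hv : IsSlabModel U u t₁ t₂ v K M) (h1 : 0 < t₁) (h12 : t₁ < t₂) {g : Euc n × ℝ → ℝ}
    (hg : Measurable g) {C : ℝ} (hC : ∀ p, |g p| ≤ C) :
    Integrable (fun p : Euc n × ℝ => g p * inner ℝ (flux lam X Z u p.1 p.2) (spaceGrad v p))
      (cylinderMeasure U t₁ t₂) := by
  have h2 := hsol.integrable_flux t₁ t₂ h1 h12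
  have h3 := (measurable_spaceGrad hv.lipschitz.continuous).aestronglyMeasurable
    (μ := cylinderMeasure U t₁ t₂)
  refine Integrable.mono' (h2.norm.const_mul (C * K))
    (hg.aestronglyMeasurable.mul (h2.aestronglyMeasurable.inner h3))
    (Eventually.of_forall fun p => ?_)
  rw [norm_mul]
  have hC0 : 0 ≤ C := (abs_nonneg _).trans (hC p)
  calc ‖g p‖ * ‖inner ℝ (flux lam X Z u p.1 p.2) (spaceGrad v p)‖
      ≤ C * (‖flux lam X Z u p.1 p.2‖ * K) := by
        gcongr
        · exact hC p
        · exact (norm_inner_le_norm _ _).trans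
            (mul_le_mul_of_nonneg_left (norm_spaceGrad_le hv.lipschitz p) (norm_nonneg _))
    _ = _ := by ring

theorem abs_deriv_le_of_lipschitz {f : ℝ → ℝ} {K : NNReal} (hf : LipschitzWith K f) (t : ℝ) :
    |deriv f t| ≤ K := norm_deriv_le_of_lipschitz hf

theorem time_term_eq (hU : IsOpen U) (hφ : IntegrableOn φ U)
    (hv : IsSlabModel U u t₁ t₂ v K M) (hθ : IsTimeCutoff θ Kθ t₁ t₂) (h12 : t₁ < t₂)
    (hlam : 0 < lam) (hα : lam + 1 < α) :
    ∫ p, φ p.1 * u p.1 p.2 ^ lam * deriv (fun s => v (p.1, s) ^ (α - lam) * θ s) p.2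
        ∂(cylinderMeasure U t₁ t₂) =
      lam / α * ∫ p, φ p.1 * (v p ^ α * deriv θ p.2) ∂(cylinderMeasure U t₁ t₂) := by
  obtain ⟨K', hK'⟩ := exists_lipschitzWith_test hv hθ (β := α - lam) (by linarith)
  have hsl : ∀ x, LipschitzWith K' (fun s => v (x, s) ^ (α - lam) * θ s) := fun x =>
    lipschitzWith_time_slice hK' x
  have hm1 : Measurable (fun p : Euc n × ℝ =>
      deriv (fun s => v (p.1, s) ^ (α - lam) * θ s) p.2) :=
    measurable_deriv_with_param (f := fun (x : Euc n) (s : ℝ) => v (x, s) ^ (α - lam) * θ s)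
      hK'.continuous
  have hm2 : Measurable (fun p : Euc n × ℝ => deriv θ p.2) :=
    (measurable_deriv θ).comp measurable_snd
  have hi1 : Integrable (fun p : Euc n × ℝ => φ p.1 *
      (v p ^ lam * deriv (fun s => v (p.1, s) ^ (α - lam) * θ s) p.2))
      (cylinderMeasure U t₁ t₂) := by
    refine integrable_fst_mul_bdd hφ ((hv.measurable_rpow lam).mul hm1) (C := M ^ lam * K')
      fun p => ?_
    rw [abs_mul]
    exact mul_le_mul (hv.rpow_le hlam.le p) (abs_deriv_le_of_lipschitz (hsl p.1) p.2)
      (abs_nonneg _) (Real.rpow_nonneg hv.nonneg_bound _)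
  have hi2 : Integrable (fun p : Euc n × ℝ => φ p.1 * (v p ^ α * deriv θ p.2))
      (cylinderMeasure U t₁ t₂) := by
    refine integrable_fst_mul_bdd hφ ((hv.measurable_rpow α).mul hm2) (C := M ^ α * Kθ)
      fun p => ?_
    rw [abs_mul]
    exact mul_le_mul (hv.rpow_le (by linarith) p) (abs_deriv_le_of_lipschitz hθ.lipschitz p.2)
      (abs_nonneg _) (Real.rpow_nonneg hv.nonneg_bound _)
  have hcongr : ∫ p, φ p.1 * u p.1 p.2 ^ lam * deriv (fun s => v (p.1, s) ^ (α - lam) * θ s) p.2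
        ∂(cylinderMeasure U t₁ t₂) = ∫ p, φ p.1 *
      (v p ^ lam * deriv (fun s => v (p.1, s) ^ (α - lam) * θ s) p.2)
        ∂(cylinderMeasure U t₁ t₂) := by
    refine integral_congr_ae ?_
    filter_upwards [ae_cylinder hU.measurableSet t₁ t₂] with p hp
    rw [← hv.eq p.1 (subset_closure hp.1) p.2 (Ioo_subset_Icc_self hp.2)]
    ring
  rw [hcongr]
  unfold cylinderMeasure at hi1 hi2 ⊢
  -- For fixed x the inner integral is one-dimensional, where the chain rule in time applies.
  rw [integral_prod _ hi1, integral_prod _ hi2, ← integral_const_mul]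
  refine integral_congr_ae (Eventually.of_forall fun x => ?_)
  simp only [integral_const_mul]
  rw [integral_rpow_mul_deriv (lipschitzWith_time_slice hv.lipschitz x)
    (fun s => hv.nonneg _) (fun s => hv.le_bound _) hθ.lipschitz hθ.abs_le_one
    (hθ.eq_zero _ (by simp)) (hθ.eq_zero _ (by simp)) h12.le hlam hα]
  ring

/-- The weak equation tested with `u^(α-λ) θ(t)`. -/
theorem weak_identity (hU : IsOpen U) [IsFiniteMeasure (surfaceMeasure U)]
    (hφ : IntegrableOn φ U) (hsol : IsSolution U lam φ X Z u₀ ψ₁ ψ₂ u)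
    (hv : IsSlabModel U u t₁ t₂ v K M) (hθ : IsTimeCutoff θ Kθ t₁ t₂) (h1 : 0 < t₁)
    (h12 : t₁ < t₂) (hlam : 0 < lam) (hα : lam + 1 < α) :
    lam / α * ∫ p, φ p.1 * (v p ^ α * deriv θ p.2) ∂(cylinderMeasure U t₁ t₂) =
      (∫ p, (θ p.2 * ((α - lam) * v p ^ (α - lam - 1))) *
          inner ℝ (flux lam X Z u p.1 p.2) (spaceGrad v p) ∂(cylinderMeasure U t₁ t₂)) +
        ∫ p, (ψ₁ p.1 p.2 + ψ₂ p.1 p.2 * v p ^ lam) * (v p ^ (α - lam) * θ p.2)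
          ∂(lateralMeasure U t₁ t₂) := by
  obtain ⟨K', hK'⟩ := exists_lipschitzWith_test hv hθ (β := α - lam) (by linarith)
  have hoff : ∀ t, t ∉ Icc t₁ t₂ → θ t = 0 := fun t ht =>
    hθ.eq_zero t fun h => ht (Ioo_subset_Icc_self h)
  have htest : IsTestFunction U (fun x t => v (x, t) ^ (α - lam) * θ t) :=
    ⟨⟨K', hK'.lipschitzOnWith⟩, t₁, t₂, h1, h12, fun x t ht => by simp [hoff t ht]⟩
  have heq := hsol.weak_equation _ htest
  unfold globalCylinderMeasure globalLateralMeasure at heq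
  rw [integral_eq_of_time_support _ (t₁ := t₁) (t₂ := t₂) h1, integral_eq_of_time_support _ (t₁ := t₁) (t₂ := t₂) h1,
    integral_eq_of_time_support _ (t₁ := t₁) (t₂ := t₂) h1] at heq
  rotate_left
  · intro p hp; simp [hoff _ hp]
  · intro p hp; simp [hoff _ hp]
  · intro p hp
    have : (fun s => v (p.1, s) ^ (α - lam) * θ s) =ᶠ[𝓝 p.2] fun _ => 0 := by
      filter_upwards [isClosed_Icc.isOpen_compl.mem_nhds hp] with s hs
      simp [hoff s hs]
    rw [this.deriv_eq]; simp
  have h2 := time_term_eq hU hφ hv hθ h12 hlam hα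
  rw [← h2]
  refine heq.trans ?_
  congr 1
  · refine integral_congr_ae ?_
    filter_upwards [ae_differentiableAt_slice hv.lipschitz U t₁ t₂] with p hp
    have h3 := gradient_rpow_mul (β := α - lam) (c := θ p.2) (by linarith) hp
    beta_reduce at h3 ⊢
    rw [h3, inner_smul_right]
    rfl
  · refine integral_congr_ae ?_
    filter_upwards [ae_lateral (U := U) t₁ t₂] with p hp
    rw [← hv.eq p.1 hp.1 p.2 (Ioo_subset_Icc_self hp.2)]

/-- The density of the weighted gradient energy, without the weight. -/
def energyDensity (a lam α : ℝ) (v : Euc n × ℝ → ℝ) (p : Euc n × ℝ) : ℝ :=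
  v p ^ (α - lam - 1) / (1 + v p) ^ (2 * lam) * ‖spaceGrad v p‖ ^ (2 - a)

theorem measurable_energyDensity (hv : Continuous v) : Measurable (energyDensity a lam α v) := by
  unfold energyDensity
  have h1 := hv.measurable
  have h2 := measurable_spaceGrad hv
  fun_prop

theorem energyDensity_nonneg (hv : ∀ p, 0 ≤ v p) (p : Euc n × ℝ) :
    0 ≤ energyDensity a lam α v p := by
  unfold energyDensity
  have := hv p
  positivity

theorem energyDensity_le (hv : IsSlabModel U u t₁ t₂ v K M) (ha1 : a < 1) (hlam : 0 < lam)
    (hα : lam + 1 < α) (p : Euc n × ℝ) :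
    energyDensity a lam α v p ≤ M ^ (α - lam - 1) * K ^ (2 - a) := by
  unfold energyDensity
  have h0 := hv.nonneg p
  have hM := hv.nonneg_bound
  have h1 : 1 ≤ (1 + v p) ^ (2 * lam) := Real.one_le_rpow (by linarith) (by linarith)
  have h2 : v p ^ (α - lam - 1) / (1 + v p) ^ (2 * lam) ≤ M ^ (α - lam - 1) :=
    (div_le_self (by positivity) h1).trans (Real.rpow_le_rpow h0 (hv.le_bound p) (by linarith))
  exact mul_le_mul h2 (Real.rpow_le_rpow (norm_nonneg _) (norm_spaceGrad_le hv.lipschitz p)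
    (by linarith)) (by positivity) (by positivity)

/-- The tested equation is combined with the pointwise lower bound for the flux multiplied by
(α-λ)θv^(α-lam-1). Only negative parts of the boundary data survive, since v and θ are non-negative.
All integrals are finite because v and its gradient are bounded on the slab. -/
theorem energy_inequality (hU : IsOpen U) [IsFiniteMeasure (surfaceMeasure U)]
    (ha0 : 0 < a) (ha1 : a < 1) (hlam : 0 < lam) (hχ : 1 ≤ χ) (hcZ : 0 < cZ)
    (hφ : IntegrableOn φ U) (hW₁ : IntegrableOn W₁ U) (hW₂ : IntegrableOn W₂ U)
    (hW₃ : IntegrableOn (W₃ a W₀ W₁) U)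
    (hX : StructureConditions U a lam χ X W₀ W₁ W₂)
    (hZ : ∀ x ∈ closure U, ∀ t : ℝ, 0 < t → ‖Z x t‖ ≤ cZ * χ ^ 2)
    (hsol : IsSolution U lam φ X Z u₀ ψ₁ ψ₂ u)
    (h1 : 0 < t₁) (h12 : t₁ < t₂) (hα : lam + 1 < α)
    (hψ₁ : Integrable (fun p : Euc n × ℝ => max 0 (-ψ₁ p.1 p.2)) (lateralMeasure U t₁ t₂))
    (hψ₂ : Integrable (fun p : Euc n × ℝ => max 0 (-ψ₂ p.1 p.2)) (lateralMeasure U t₁ t₂))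
    (hv : IsSlabModel U u t₁ t₂ v K M) (hθ : IsTimeCutoff θ Kθ t₁ t₂) :
    (α - lam) / (4 * χ ^ 2) *
        ∫ p, W₁ p.1 * (θ p.2 * energyDensity a lam α v p) ∂(cylinderMeasure U t₁ t₂) ≤
      lam / α * (∫ p, φ p.1 * (v p ^ α * deriv θ p.2) ∂(cylinderMeasure U t₁ t₂)) +
      ((α - lam) * ∫ p, W₂ p.1 * (θ p.2 * v p ^ (α - lam - 1)) ∂(cylinderMeasure U t₁ t₂)) +
      ((α - lam) * (cZ ^ (2 - a) * χ ^ (2 * (3 - 2 * a))) * ∫ p, W₃ a W₀ W₁ p.1 *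
        (θ p.2 * (v p ^ (α - lam - 1) *
          ((1 + v p) ^ (2 * lam * (1 - a)) * v p ^ (2 * lam * (2 - a)))))
        ∂(cylinderMeasure U t₁ t₂)) +
      ((∫ p, max 0 (-ψ₁ p.1 p.2) * (v p ^ (α - lam) * θ p.2) ∂(lateralMeasure U t₁ t₂)) +
      ∫ p, max 0 (-ψ₂ p.1 p.2) * (v p ^ α * θ p.2) ∂(lateralMeasure U t₁ t₂)) := by
  have hβ : 0 < α - lam - 1 := by linarith
  have hM0 := hv.nonneg_bound
  have hvm := hv.lipschitz.continuous.measurable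
  have hθm0 : Measurable θ := hθ.lipschitz.continuous.measurable
  have hθm : Measurable (fun p : Euc n × ℝ => θ p.2) := hθm0.comp measurable_snd
  have hid := weak_identity hU hφ hsol hv hθ h1 h12 hlam hα
  -- integrability
  have iE : Integrable (fun p : Euc n × ℝ => W₁ p.1 * (θ p.2 * energyDensity a lam α v p))
      (cylinderMeasure U t₁ t₂) := by
    refine integrable_fst_mul_bdd hW₁
      (hθm.mul (measurable_energyDensity hv.lipschitz.continuous))
      (C := 1 * (M ^ (α - lam - 1) * K ^ (2 - a))) fun p => ?_
    rw [abs_mul, abs_of_nonneg (energyDensity_nonneg hv.nonneg p)]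
    exact mul_le_mul (hθ.abs_le_one _) (energyDensity_le hv ha1 hlam hα p)
      (energyDensity_nonneg hv.nonneg p) zero_le_one
  have i2 : Integrable (fun p : Euc n × ℝ => W₂ p.1 * (θ p.2 * v p ^ (α - lam - 1)))
      (cylinderMeasure U t₁ t₂) := by
    refine integrable_fst_mul_bdd hW₂ (hθm.mul (hv.measurable_rpow _))
      (C := 1 * M ^ (α - lam - 1)) fun p => ?_
    rw [abs_mul]
    exact mul_le_mul (hθ.abs_le_one _) (hv.rpow_le hβ.le p) (abs_nonneg _) zero_le_one
  have i3 : Integrable (fun p : Euc n × ℝ => W₃ a W₀ W₁ p.1 *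
      (θ p.2 * (v p ^ (α - lam - 1) *
        ((1 + v p) ^ (2 * lam * (1 - a)) * v p ^ (2 * lam * (2 - a))))))
      (cylinderMeasure U t₁ t₂) := by
    refine integrable_fst_mul_bdd hW₃ (by fun_prop)
      (C := 1 * (M ^ (α - lam - 1) *
        ((1 + M) ^ (2 * lam * (1 - a)) * M ^ (2 * lam * (2 - a))))) fun p => ?_
    have h0 := hv.nonneg p
    rw [abs_mul, abs_of_nonneg (by positivity : 0 ≤ v p ^ (α - lam - 1) *
        ((1 + v p) ^ (2 * lam * (1 - a)) * v p ^ (2 * lam * (2 - a))))]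
    have h3 := hv.le_bound p
    have h4 : 0 ≤ 2 * lam * (1 - a) := by nlinarith
    have h5 : 0 ≤ 2 * lam * (2 - a) := by nlinarith
    have h6 := hθ.abs_le_one p.2
    gcongr
  have iF : Integrable (fun p : Euc n × ℝ => (θ p.2 * ((α - lam) * v p ^ (α - lam - 1))) *
      inner ℝ (flux lam X Z u p.1 p.2) (spaceGrad v p)) (cylinderMeasure U t₁ t₂) := by
    refine integrable_flux_inner hsol hv h1 h12 (by fun_prop)
      (C := 1 * ((α - lam) * M ^ (α - lam - 1))) fun p => ?_
    rw [abs_mul, abs_mul, abs_of_pos (by linarith : 0 < α - lam)]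
    have h4 := hv.rpow_le hβ.le p
    have h6 := hθ.abs_le_one p.2
    have : 0 < α - lam := by linarith
    gcongr
  -- the interior term
  have hint : (α - lam) / (4 * χ ^ 2) *
        (∫ p, W₁ p.1 * (θ p.2 * energyDensity a lam α v p) ∂(cylinderMeasure U t₁ t₂)) ≤
      (∫ p, (θ p.2 * ((α - lam) * v p ^ (α - lam - 1))) *
          inner ℝ (flux lam X Z u p.1 p.2) (spaceGrad v p) ∂(cylinderMeasure U t₁ t₂)) +
      ((α - lam) * ∫ p, W₂ p.1 * (θ p.2 * v p ^ (α - lam - 1)) ∂(cylinderMeasure U t₁ t₂)) +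
      ((α - lam) * (cZ ^ (2 - a) * χ ^ (2 * (3 - 2 * a))) * ∫ p, W₃ a W₀ W₁ p.1 *
        (θ p.2 * (v p ^ (α - lam - 1) *
          ((1 + v p) ^ (2 * lam * (1 - a)) * v p ^ (2 * lam * (2 - a)))))
        ∂(cylinderMeasure U t₁ t₂)) := by
    have e1 := integral_add iF (i2.const_mul (α - lam))
    have e2 := integral_add (iF.add (i2.const_mul (α - lam)))
      (i3.const_mul ((α - lam) * (cZ ^ (2 - a) * χ ^ (2 * (3 - 2 * a)))))
    simp only [Pi.add_apply] at e2
    rw [← integral_const_mul, ← integral_const_mul, ← integral_const_mul, ← e1, ← e2]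
    refine integral_mono_ae (iE.const_mul _) ((iF.add (i2.const_mul _)).add (i3.const_mul _)) ?_
    filter_upwards [ae_cylinder hU.measurableSet t₁ t₂] with p hp
    have hxc := subset_closure hp.1
    have ht : p.2 ∈ Icc t₁ t₂ := Ioo_subset_Icc_self hp.2
    have hz : v p = u p.1 p.2 := hv.eq p.1 hxc p.2 ht
    have hgr : gradient (fun y => u y p.2) p.1 = spaceGrad v p :=
      spaceGrad_eq_of_eqOn hU (fun x hx => hv.eq x hx p.2 ht) hp.1
    have h0 := hv.nonneg p
    have hlow := inner_flux_lower_bound (X := flux lam X Z u p.1 p.2) (ζ := Z p.1 p.2)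
      (g := spaceGrad v p) (z := v p) ha0 ha1 hlam hχ hcZ h0
      (hX.pos₀ p.1 hxc) (hX.pos₁ p.1 hxc) (w₂ := W₂ p.1) (hZ p.1 hxc p.2 (h1.trans hp.2.1))
      (by
        have := hX.growth p.1 hxc (u p.1 p.2) (hz ▸ h0)
          (gradient (fun y => u y p.2) p.1 + (u p.1 p.2 ^ (2 * lam)) • Z p.1 p.2)
        rw [hgr, ← hz] at this
        unfold flux
        rwa [hgr, ← hz])
      (by
        have := hX.coercive p.1 hxc (u p.1 p.2) (hz ▸ h0)
          (gradient (fun y => u y p.2) p.1 + (u p.1 p.2 ^ (2 * lam)) • Z p.1 p.2)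
        rw [hgr, ← hz] at this
        unfold flux
        rwa [hgr, ← hz])
    have hθ0 := hθ.nonneg p.2
    have hmul : 0 ≤ θ p.2 * ((α - lam) * v p ^ (α - lam - 1)) := by
      have : 0 < α - lam := by linarith
      positivity
    have := mul_le_mul_of_nonneg_left hlow hmul
    calc _ = θ p.2 * ((α - lam) * v p ^ (α - lam - 1)) *
          (1 / (4 * χ ^ 2) * (W₁ p.1 * ‖spaceGrad v p‖ ^ (2 - a) / (1 + v p) ^ (2 * lam))) := by
          unfold energyDensity; ring
      _ ≤ _ := this
      _ = _ := by unfold W₃; ring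
  -- the boundary term
  have j1 : Integrable (fun p : Euc n × ℝ => max 0 (-ψ₁ p.1 p.2) * (v p ^ (α - lam) * θ p.2))
      (lateralMeasure U t₁ t₂) := by
    refine hψ₁.mul_bdd (c := M ^ (α - lam) * 1)
      ((hv.measurable_rpow _).mul hθm).aestronglyMeasurable (Eventually.of_forall fun p => ?_)
    rw [norm_mul]
    exact mul_le_mul (hv.rpow_le (by linarith) p) (hθ.abs_le_one _) (abs_nonneg _) (by positivity)
  have j2 : Integrable (fun p : Euc n × ℝ => max 0 (-ψ₂ p.1 p.2) * (v p ^ α * θ p.2))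
      (lateralMeasure U t₁ t₂) := by
    refine hψ₂.mul_bdd (c := M ^ α * 1)
      ((hv.measurable_rpow _).mul hθm).aestronglyMeasurable (Eventually.of_forall fun p => ?_)
    rw [norm_mul]
    exact mul_le_mul (hv.rpow_le (by linarith) p) (hθ.abs_le_one _) (abs_nonneg _) (by positivity)
  have j0 : Integrable (fun p : Euc n × ℝ => (ψ₁ p.1 p.2 + ψ₂ p.1 p.2 * v p ^ lam) *
      (v p ^ (α - lam) * θ p.2)) (lateralMeasure U t₁ t₂) := by
    have h3 : Integrable (fun p : Euc n × ℝ => ψ₁ p.1 p.2 + ψ₂ p.1 p.2 * v p ^ lam)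
        (lateralMeasure U t₁ t₂) := by
      refine (hsol.integrable_boundary t₁ t₂ h1 h12).congr ?_
      filter_upwards [ae_lateral (U := U) t₁ t₂] with p hp
      rw [← hv.eq p.1 hp.1 p.2 (Ioo_subset_Icc_self hp.2)]
    refine h3.mul_bdd (c := M ^ (α - lam) * 1)
      ((hv.measurable_rpow _).mul hθm).aestronglyMeasurable (Eventually.of_forall fun p => ?_)
    rw [norm_mul]
    exact mul_le_mul (hv.rpow_le (by linarith) p) (hθ.abs_le_one _) (abs_nonneg _) (by positivity)
  have hbd : -(∫ p, (ψ₁ p.1 p.2 + ψ₂ p.1 p.2 * v p ^ lam) * (v p ^ (α - lam) * θ p.2)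
          ∂(lateralMeasure U t₁ t₂)) ≤
      (∫ p, max 0 (-ψ₁ p.1 p.2) * (v p ^ (α - lam) * θ p.2) ∂(lateralMeasure U t₁ t₂)) +
      ∫ p, max 0 (-ψ₂ p.1 p.2) * (v p ^ α * θ p.2) ∂(lateralMeasure U t₁ t₂) := by
    rw [← integral_neg, ← integral_add j1 j2]
    refine integral_mono j0.neg (j1.add j2) fun p => ?_
    have h0 := hv.nonneg p
    have hθ0 := hθ.nonneg p.2
    -- The factor v^λ accompanying ψ₂ raises the boundary power from α-λ to α; hence two boundary
    -- terms with different exponents.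
    have e : v p ^ α = v p ^ lam * v p ^ (α - lam) := by
      rw [← Real.rpow_add_of_nonneg h0 hlam.le (by linarith)]; congr 1; ring
    have k1 : -ψ₁ p.1 p.2 ≤ max 0 (-ψ₁ p.1 p.2) := le_max_right _ _
    have k2 : -ψ₂ p.1 p.2 ≤ max 0 (-ψ₂ p.1 p.2) := le_max_right _ _
    have q1 : 0 ≤ v p ^ (α - lam) * θ p.2 := by positivity
    have q2 : 0 ≤ v p ^ α * θ p.2 := by positivity
    have := mul_le_mul_of_nonneg_right k1 q1
    have := mul_le_mul_of_nonneg_right k2 q2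
    calc _ = -ψ₁ p.1 p.2 * (v p ^ (α - lam) * θ p.2) + -ψ₂ p.1 p.2 * (v p ^ α * θ p.2) := by rw [e]; ring
      _ ≤ _ := add_le_add (by assumption) (by assumption)
  linarith

/-! ### Weighted Hölder inequalities on the cylinder -/

theorem lintegral_mul_rpow_three_le {Y : Type*} [MeasurableSpace Y] {μ : Measure Y}
    {f g h : Y → ENNReal} (hf : AEMeasurable f μ) (hg : AEMeasurable g μ) (hh : AEMeasurable h μ)
    {b₁ b₂ b₃ : ℝ} (h1 : 0 ≤ b₁) (h2 : 0 ≤ b₂) (h3 : 0 ≤ b₃) (hsum : b₁ + b₂ + b₃ = 1) :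
    ∫⁻ y, f y ^ b₁ * g y ^ b₂ * h y ^ b₃ ∂μ ≤
      (∫⁻ y, f y ∂μ) ^ b₁ * (∫⁻ y, g y ∂μ) ^ b₂ * (∫⁻ y, h y ∂μ) ^ b₃ := by
  have h := ENNReal.lintegral_prod_norm_pow_le (μ := μ) Finset.univ (f := ![f, g, h])
    (p := ![b₁, b₂, b₃]) (by
      intro i _; fin_cases i
      · exact hf
      · exact hg
      · exact hh) (by simp [Fin.sum_univ_three, hsum]) (by
      intro i _; fin_cases i
      · exact h1
      · exact h2
      · exact h3)
  simpa [Fin.prod_univ_three] using h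

theorem rpow_le_one_add {x e : ℝ} (hx : 0 ≤ x) (he0 : 0 ≤ e) (he1 : e ≤ 1) : x ^ e ≤ 1 + x := by
  calc x ^ e ≤ (1 + x) ^ e := Real.rpow_le_rpow hx (by linarith) he0
    _ ≤ (1 + x) ^ (1 : ℝ) := Real.rpow_le_rpow_of_exponent_le (by linarith) he1
    _ = 1 + x := Real.rpow_one _

theorem lintegral_fst_cylinder {f : Euc n → ℝ} (hf : IntegrableOn f U) (h0 : ∀ x ∈ U, 0 ≤ f x)
    (hU : MeasurableSet U) :
    ∫⁻ p, ENNReal.ofReal (f p.1) ∂(cylinderMeasure U t₁ t₂) =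
      ENNReal.ofReal ((t₂ - t₁) * ∫ x in U, f x) := by
  unfold cylinderMeasure
  rw [lintegral_prod (fun p : Euc n × ℝ => ENNReal.ofReal (f p.1))
    (hf.aestronglyMeasurable.aemeasurable.comp_fst.ennreal_ofReal)]
  simp only [lintegral_const, Measure.restrict_apply_univ, Real.volume_Ioo]
  rw [lintegral_mul_const'' _ hf.aestronglyMeasurable.aemeasurable.ennreal_ofReal,
    ← ofReal_integral_eq_lintegral_ofReal hf ((ae_restrict_mem hU).mono h0),
    ← ENNReal.ofReal_mul (setIntegral_nonneg hU h0), mul_comm]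

/-- Hölder's inequality with the weights `F`, `v^(κα) φ` and `φ` on the cylinder. -/
theorem lintegral_holder_cylinder {F : Euc n → ℝ} {T N R b₁ b₂ b₃ : ℝ} (hU : MeasurableSet U)
    (hφ : IntegrableOn φ U) (hφ0 : ∀ x ∈ U, 0 < φ x) (hF : IntegrableOn F U)
    (hF0 : ∀ x ∈ U, 0 ≤ F x) (ht1 : 0 ≤ t₁) (h12 : t₁ < t₂) (h2T : t₂ ≤ T)
    (hv : Measurable v) (hv0 : ∀ p, 0 ≤ v p) (hN0 : 0 ≤ N)
    (hN : ∫⁻ p, ENNReal.ofReal (v p ^ R * φ p.1) ∂(cylinderMeasure U t₁ t₂) ≤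
      ENNReal.ofReal (N ^ R))
    (hb1 : 0 ≤ b₁) (hb2 : 0 ≤ b₂) (hb3 : 0 ≤ b₃) (hsum : b₁ + b₂ + b₃ = 1) :
    ∫⁻ p, ENNReal.ofReal (F p.1 ^ b₁ * (v p ^ R * φ p.1) ^ b₂ * φ p.1 ^ b₃)
        ∂(cylinderMeasure U t₁ t₂) ≤
      ENNReal.ofReal ((1 + T) * (1 + ∫ x in U, φ x) * (∫ x in U, F x) ^ b₁ * N ^ (R * b₂)) := by
  have hmφ : AEMeasurable (fun p : Euc n × ℝ => φ p.1) (cylinderMeasure U t₁ t₂) :=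
    hφ.aestronglyMeasurable.aemeasurable.comp_fst
  have hmF : AEMeasurable (fun p : Euc n × ℝ => F p.1) (cylinderMeasure U t₁ t₂) :=
    hF.aestronglyMeasurable.aemeasurable.comp_fst
  have h := lintegral_mul_rpow_three_le hmF.ennreal_ofReal
    (((hv.pow_const R).aemeasurable.mul hmφ).ennreal_ofReal) hmφ.ennreal_ofReal hb1 hb2 hb3 hsum
  have hΦ : 0 ≤ ∫ x in U, φ x := setIntegral_nonneg hU fun x hx => (hφ0 x hx).le
  have hI : 0 ≤ ∫ x in U, F x := setIntegral_nonneg hU hF0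
  have hT : 0 < T := by linarith
  calc ∫⁻ p, ENNReal.ofReal (F p.1 ^ b₁ * (v p ^ R * φ p.1) ^ b₂ * φ p.1 ^ b₃)
        ∂(cylinderMeasure U t₁ t₂)
      = ∫⁻ p, ENNReal.ofReal (F p.1) ^ b₁ * ENNReal.ofReal (v p ^ R * φ p.1) ^ b₂ *
          ENNReal.ofReal (φ p.1) ^ b₃ ∂(cylinderMeasure U t₁ t₂) := by
        refine lintegral_congr_ae ?_
        filter_upwards [ae_cylinder hU t₁ t₂] with p hp
        have h1 := hφ0 p.1 hp.1
        have h2 := hF0 p.1 hp.1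
        have h3 := hv0 p
        rw [ENNReal.ofReal_rpow_of_nonneg h2 hb1, ENNReal.ofReal_rpow_of_nonneg (by positivity) hb2,
          ENNReal.ofReal_rpow_of_nonneg h1.le hb3, ← ENNReal.ofReal_mul (by positivity),
          ← ENNReal.ofReal_mul (by positivity)]
    _ ≤ _ := h
    _ ≤ ENNReal.ofReal (T * ∫ x in U, F x) ^ b₁ * ENNReal.ofReal (N ^ R) ^ b₂ *
          ENNReal.ofReal (T * ∫ x in U, φ x) ^ b₃ := by
        rw [lintegral_fst_cylinder hF hF0 hU,
          lintegral_fst_cylinder hφ (fun x hx => (hφ0 x hx).le) hU]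
        gcongr <;> first | linarith | exact hN
    _ = ENNReal.ofReal ((T * ∫ x in U, F x) ^ b₁ * (N ^ R) ^ b₂ * (T * ∫ x in U, φ x) ^ b₃) := by
        rw [ENNReal.ofReal_rpow_of_nonneg (by positivity) hb1,
          ENNReal.ofReal_rpow_of_nonneg (by positivity) hb2,
          ENNReal.ofReal_rpow_of_nonneg (by positivity) hb3, ← ENNReal.ofReal_mul (by positivity),
          ← ENNReal.ofReal_mul (by positivity)]
    _ ≤ _ := by
        refine ENNReal.ofReal_le_ofReal ?_
        rw [Real.mul_rpow hT.le hI, Real.mul_rpow hT.le hΦ, ← Real.rpow_mul hN0]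
        -- The two time-independent weights each contribute a power of the length of the time
        -- interval, with total exponent at most 1. This is where the factor 1+T comes from.
        have e1 : T ^ (b₁ + b₃) ≤ 1 + T := rpow_le_one_add hT.le (by linarith) (by linarith)
        have e2 : (∫ x in U, φ x) ^ b₃ ≤ 1 + ∫ x in U, φ x :=
          rpow_le_one_add hΦ hb3 (by linarith)
        rw [Real.rpow_add hT] at e1
        calc _ = (T ^ b₁ * T ^ b₃) * (∫ x in U, φ x) ^ b₃ * (∫ x in U, F x) ^ b₁ *
              N ^ (R * b₂) := by ring
          _ ≤ _ := by gcongr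

/-- Write w v^s = (w^q φ^(-q/p))^(1/q) · (v^R φ)^(s/R) · φ^(1/p - s/R) with q conjugate to p. The
exponents add up to 1, and the last is non-negative exactly when sp ≤ R. -/
theorem lintegral_weight_mul_rpow_le {w : Euc n → ℝ} {T N R p s : ℝ} (hU : MeasurableSet U)
    (hφ : IntegrableOn φ U) (hφ0 : ∀ x ∈ U, 0 < φ x)
    (hw0 : ∀ x ∈ U, 0 ≤ w x) (hw : IntegrableOn (fun x => w x ^ conj p * φ x ^ (-(conj p / p))) U)
    (ht1 : 0 ≤ t₁) (h12 : t₁ < t₂) (h2T : t₂ ≤ T)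
    (hv : Measurable v) (hv0 : ∀ p, 0 ≤ v p) (hN0 : 0 ≤ N)
    (hN : ∫⁻ p, ENNReal.ofReal (v p ^ R * φ p.1) ∂(cylinderMeasure U t₁ t₂) ≤
      ENNReal.ofReal (N ^ R))
    (hR : 0 < R) (hp : 1 < p) (hs : 0 ≤ s) (hsp : s * p ≤ R) :
    ∫⁻ z, ENNReal.ofReal (w z.1 * v z ^ s) ∂(cylinderMeasure U t₁ t₂) ≤
      ENNReal.ofReal ((1 + T) * (1 + ∫ x in U, φ x) *
        (∫ x in U, w x ^ conj p * φ x ^ (-(conj p / p))) ^ (1 / conj p) * N ^ s) := by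
  have hpq : p.HolderConjugate (conj p) := Real.HolderConjugate.conjExponent hp
  have hq : 0 < conj p := hpq.symm.pos
  have hp0 : 0 < p := by linarith
  have hsum : 1 / conj p + 1 / p = 1 := by
    have := hpq.inv_add_inv_eq_one
    simp only [one_div]; linarith
  have hb3 : 0 ≤ 1 / p - s / R := by
    rw [sub_nonneg, div_le_div_iff₀ hR hp0]; linarith
  have h := lintegral_holder_cylinder (b₁ := 1 / conj p) (b₂ := s / R) (b₃ := 1 / p - s / R)
    hU hφ hφ0 hw (fun x hx => by have := hφ0 x hx; have := hw0 x hx; positivity) ht1 h12 h2T hv hv0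
    hN0 hN (by positivity) (by positivity) hb3 (by linarith)
  have e : R * (s / R) = s := by field_simp
  rw [e] at h
  refine le_trans (le_of_eq (lintegral_congr_ae ?_)) h
  filter_upwards [ae_cylinder hU t₁ t₂] with z hz
  have h1 := hφ0 z.1 hz.1
  have h2 := hw0 z.1 hz.1
  have h3 := hv0 z
  congr 1
  rw [Real.mul_rpow (by positivity) (by positivity), Real.mul_rpow (by positivity) h1.le,
    ← Real.rpow_mul h2, ← Real.rpow_mul h1.le, ← Real.rpow_mul h3, e]
  have e1 : conj p * (1 / conj p) = 1 := by field_simp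
  have e2 : -(conj p / p) * (1 / conj p) = -(1 / p) := by field_simp
  rw [e1, e2, Real.rpow_one, Real.rpow_sub h1, Real.rpow_neg h1.le]
  have := (Real.rpow_pos_of_pos h1 (1 / p)).ne'
  have := (Real.rpow_pos_of_pos h1 (s / R)).ne'
  field_simp

theorem lintegral_phi_mul_rpow_le {T N κ : ℝ} (hU : MeasurableSet U)
    (hφ : IntegrableOn φ U) (hφ0 : ∀ x ∈ U, 0 < φ x)
    (ht1 : 0 ≤ t₁) (h12 : t₁ < t₂) (h2T : t₂ ≤ T)
    (hv : Measurable v) (hv0 : ∀ p, 0 ≤ v p) (hN0 : 0 ≤ N)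
    (hN : ∫⁻ p, ENNReal.ofReal (v p ^ (κ * α) * φ p.1) ∂(cylinderMeasure U t₁ t₂) ≤
      ENNReal.ofReal (N ^ (κ * α))) (hκ : 1 < κ) :
    ∫⁻ z, ENNReal.ofReal (φ z.1 * v z ^ α) ∂(cylinderMeasure U t₁ t₂) ≤
      ENNReal.ofReal ((1 + T) * (1 + ∫ x in U, φ x) * N ^ α) := by
  have hκ0 : 0 < κ := by linarith
  -- The first weight is switched off by the exponent 0: both 0^0 factors equal 1.
  have h := lintegral_holder_cylinder (F := fun _ => 0) (b₁ := 0) (b₂ := 1 / κ) (b₃ := 1 - 1 / κ)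
    hU hφ hφ0 (by simp) (fun x hx => le_rfl) ht1 h12 h2T hv hv0
    hN0 hN le_rfl (by positivity) (by rw [sub_nonneg, div_le_one hκ0]; linarith) (by ring)
  have e : κ * α * (1 / κ) = α := by field_simp
  simp only [e, Real.rpow_zero, mul_one, one_mul] at h
  refine le_trans (le_of_eq (lintegral_congr_ae ?_)) h
  filter_upwards [ae_cylinder hU t₁ t₂] with z hz
  have h1 := hφ0 z.1 hz.1
  have h3 := hv0 z
  congr 1
  rw [Real.mul_rpow (by positivity) h1.le, ← Real.rpow_mul h3, e, mul_assoc,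
    ← Real.rpow_add h1]
  simp [mul_comm]

theorem one_add_rpow_mul_rpow_le {z s d : ℝ} (hz : 0 ≤ z) (hs : 0 ≤ s) (hd : 0 ≤ d) :
    (1 + z) ^ d * z ^ s ≤ 2 ^ d * (z ^ s + z ^ (s + d)) := by
  rcases le_total z 1 with h | h
  · calc (1 + z) ^ d * z ^ s ≤ 2 ^ d * z ^ s := by gcongr; linarith
      _ ≤ 2 ^ d * (z ^ s + z ^ (s + d)) := by
        gcongr
        linarith [Real.rpow_nonneg hz (s + d)]
  · calc (1 + z) ^ d * z ^ s ≤ (2 * z) ^ d * z ^ s := by gcongr; linarith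
      _ = 2 ^ d * z ^ (s + d) := by
        rw [Real.mul_rpow (by norm_num) hz, Real.rpow_add_of_nonneg hz hs hd]; ring
      _ ≤ 2 ^ d * (z ^ s + z ^ (s + d)) := by
        gcongr
        linarith [Real.rpow_nonneg hz s]

/-- The previous estimate with an additional factor `(1+v)^d`. -/
theorem lintegral_weight_mul_one_add_rpow_le {w : Euc n → ℝ} {T N R p s d : ℝ}
    (hU : MeasurableSet U) (hwm : AEMeasurable w (volume.restrict U))
    (hφ : IntegrableOn φ U) (hφ0 : ∀ x ∈ U, 0 < φ x)
    (hw0 : ∀ x ∈ U, 0 ≤ w x) (hw : IntegrableOn (fun x => w x ^ conj p * φ x ^ (-(conj p / p))) U)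
    (ht1 : 0 ≤ t₁) (h12 : t₁ < t₂) (h2T : t₂ ≤ T)
    (hv : Measurable v) (hv0 : ∀ p, 0 ≤ v p) (hN0 : 0 ≤ N)
    (hN : ∫⁻ p, ENNReal.ofReal (v p ^ R * φ p.1) ∂(cylinderMeasure U t₁ t₂) ≤
      ENNReal.ofReal (N ^ R))
    (hR : 0 < R) (hp : 1 < p) (hs : 0 ≤ s) (hd : 0 ≤ d) (hsp : (s + d) * p ≤ R) :
    ∫⁻ z, ENNReal.ofReal (w z.1 * ((1 + v z) ^ d * v z ^ s)) ∂(cylinderMeasure U t₁ t₂) ≤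
      ENNReal.ofReal (2 ^ d * ((1 + T) * (1 + ∫ x in U, φ x) *
        (∫ x in U, w x ^ conj p * φ x ^ (-(conj p / p))) ^ (1 / conj p) *
          (N ^ s + N ^ (s + d)))) := by
  have hT : 0 < T := by linarith
  have hΦ : 0 ≤ ∫ x in U, φ x := setIntegral_nonneg hU fun x hx => (hφ0 x hx).le
  have hI : 0 ≤ ∫ x in U, w x ^ conj p * φ x ^ (-(conj p / p)) := setIntegral_nonneg hU
    fun x hx => by have := hφ0 x hx; have := hw0 x hx; positivity
  have hp0 : 0 < p := by linarith
  have hmw : AEMeasurable (fun p : Euc n × ℝ => w p.1) (cylinderMeasure U t₁ t₂) := hwm.comp_fst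
  have h1 := lintegral_weight_mul_rpow_le hU hφ hφ0 hw0 hw ht1 h12 h2T hv hv0 hN0 hN hR hp hs
    (by nlinarith)
  have h2 := lintegral_weight_mul_rpow_le hU hφ hφ0 hw0 hw ht1 h12 h2T hv hv0 hN0 hN hR hp
    (add_nonneg hs hd) hsp
  calc ∫⁻ z, ENNReal.ofReal (w z.1 * ((1 + v z) ^ d * v z ^ s)) ∂(cylinderMeasure U t₁ t₂)
      ≤ ∫⁻ z, ENNReal.ofReal (2 ^ d) * (ENNReal.ofReal (w z.1 * v z ^ s) +
          ENNReal.ofReal (w z.1 * v z ^ (s + d))) ∂(cylinderMeasure U t₁ t₂) := by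
        refine lintegral_mono_ae ?_
        filter_upwards [ae_cylinder hU t₁ t₂] with z hz
        have k1 := hw0 z.1 hz.1
        have k2 := hv0 z
        rw [← ENNReal.ofReal_add (by positivity) (by positivity),
          ← ENNReal.ofReal_mul (by positivity)]
        refine ENNReal.ofReal_le_ofReal ?_
        calc w z.1 * ((1 + v z) ^ d * v z ^ s) ≤ w z.1 * (2 ^ d * (v z ^ s + v z ^ (s + d))) :=
              mul_le_mul_of_nonneg_left (one_add_rpow_mul_rpow_le k2 hs hd) k1
          _ = _ := by ring
    _ = ENNReal.ofReal (2 ^ d) * (∫⁻ z, ENNReal.ofReal (w z.1 * v z ^ s)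
          ∂(cylinderMeasure U t₁ t₂) +
          ∫⁻ z, ENNReal.ofReal (w z.1 * v z ^ (s + d)) ∂(cylinderMeasure U t₁ t₂)) := by
        rw [lintegral_const_mul' _ _ ENNReal.ofReal_ne_top, lintegral_add_left']
        exact (hmw.mul (hv.pow_const s).aemeasurable).ennreal_ofReal
    _ ≤ _ := by
        refine (mul_le_mul_right (add_le_add h1 h2) _).trans (le_of_eq ?_)
        rw [← ENNReal.ofReal_add (by positivity) (by positivity),
          ← ENNReal.ofReal_mul (by positivity)]
        congr 1; ring

/-! ### The boundary term: trace, Hölder and absorption -/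

theorem lateral_trace_le [IsFiniteMeasure (surfaceMeasure U)] {C : NNReal}
    (hC : ∀ (L : NNReal) (f : Euc n → ℝ), LipschitzWith L f →
      ∫⁻ x, ENNReal.ofReal (f x) ∂(surfaceMeasure U) ≤
        C * ∫⁻ x in U, (ENNReal.ofReal (f x) + ENNReal.ofReal ‖gradient f x‖))
    (hv : IsSlabModel U u t₁ t₂ v K M) (hθ : IsTimeCutoff θ Kθ t₁ t₂) {m : ℝ} (hm : 1 ≤ m) :
    ∫⁻ p, ENNReal.ofReal (v p ^ m * θ p.2) ∂(lateralMeasure U t₁ t₂) ≤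
      C * ((∫⁻ p, ENNReal.ofReal (θ p.2 * v p ^ m) ∂(cylinderMeasure U t₁ t₂)) +
        ENNReal.ofReal m *
        ∫⁻ p, ENNReal.ofReal (θ p.2 * (v p ^ (m - 1) * ‖spaceGrad v p‖))
          ∂(cylinderMeasure U t₁ t₂)) := by
  have hθm0 : Measurable θ := hθ.lipschitz.continuous.measurable
  have hθm : Measurable (fun p : Euc n × ℝ => θ p.2) := hθm0.comp measurable_snd
  have hvm := hv.lipschitz.continuous.measurable
  have hgm := (measurable_spaceGrad hv.lipschitz.continuous).norm
  have m1 : Measurable (fun p => ENNReal.ofReal (v p ^ m * θ p.2)) :=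
    ((hvm.pow_const m).mul hθm).ennreal_ofReal
  have m2 : Measurable (fun p => ENNReal.ofReal (θ p.2 * v p ^ m)) :=
    (hθm.mul (hvm.pow_const m)).ennreal_ofReal
  have m3 : Measurable (fun p => ENNReal.ofReal (θ p.2 * (v p ^ (m - 1) * ‖spaceGrad v p‖))) :=
    (hθm.mul ((hvm.pow_const _).mul hgm)).ennreal_ofReal
  have m4 : Measurable (fun p => ENNReal.ofReal (θ p.2 * v p ^ m) + ENNReal.ofReal m *
      ENNReal.ofReal (θ p.2 * (v p ^ (m - 1) * ‖spaceGrad v p‖))) := m2.add (m3.const_mul _)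
  rw [← lintegral_const_mul _ m3, ← lintegral_add_left m2, lateralMeasure, cylinderMeasure,
    lintegral_prod_symm _ m1.aemeasurable, lintegral_prod_symm _ m4.aemeasurable,
    ← lintegral_const_mul _ (m4.lintegral_prod_left')]
  -- The trace inequality is applied to v^m in each time slice; the gradient of v^m supplies the
  -- factor m.
  refine lintegral_mono fun t => ?_
  obtain ⟨K', hK'⟩ := exists_lipschitzWith_rpow hv.lipschitz hv.nonneg hv.le_bound hm
  have h1 := hC K' (fun x => v (x, t) ^ m) (lipschitzWith_slice hK' t)
  have hθ0 := hθ.nonneg t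
  have s1 : Measurable (fun x => ENNReal.ofReal (v (x, t) ^ m)) :=
    ((hvm.pow_const m).comp measurable_prodMk_right).ennreal_ofReal
  calc ∫⁻ x, ENNReal.ofReal (v (x, t) ^ m * θ t) ∂(surfaceMeasure U)
      = ENNReal.ofReal (θ t) * ∫⁻ x, ENNReal.ofReal (v (x, t) ^ m) ∂(surfaceMeasure U) := by
        rw [← lintegral_const_mul _ s1]
        refine lintegral_congr fun x => ?_
        rw [← ENNReal.ofReal_mul hθ0, mul_comm]
    _ ≤ ENNReal.ofReal (θ t) * (C * ∫⁻ x in U, (ENNReal.ofReal (v (x, t) ^ m) +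
          ENNReal.ofReal ‖gradient (fun x => v (x, t) ^ m) x‖)) := by gcongr
    _ = C * ∫⁻ x in U, ENNReal.ofReal (θ t) * (ENNReal.ofReal (v (x, t) ^ m) +
          ENNReal.ofReal ‖gradient (fun x => v (x, t) ^ m) x‖) := by
        rw [lintegral_const_mul' _ _ ENNReal.ofReal_ne_top]
        ring
    _ = C * ∫⁻ x in U, (ENNReal.ofReal (θ t * v (x, t) ^ m) + ENNReal.ofReal m *
          ENNReal.ofReal (θ t * (v (x, t) ^ (m - 1) * ‖spaceGrad v (x, t)‖))) := by
        congr 1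
        refine lintegral_congr_ae (ae_restrict_of_ae ?_)
        filter_upwards [(lipschitzWith_slice hv.lipschitz t).ae_differentiableAt (μ := volume)]
          with x hx
        have h2 := gradient_rpow_mul (c := 1) hm hx
        simp only [mul_one, one_mul] at h2
        have hv0 := hv.nonneg (x, t)
        have hm0 : 0 ≤ m := by linarith
        rw [h2, norm_smul, Real.norm_of_nonneg (by positivity), mul_add,
          ← ENNReal.ofReal_mul hθ0, ← ENNReal.ofReal_mul hθ0, ← ENNReal.ofReal_mul hm0]
        congr 2
        unfold spaceGrad
        ring

theorem lateral_holder_le {G : Euc n × ℝ → ℝ} {Ψ β q : ℝ}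
    (hG : AEMeasurable G (lateralMeasure U t₁ t₂)) (hG0 : ∀ p, 0 ≤ G p) (hq : 1 < q)
    (hGΨ : ∫⁻ p, ENNReal.ofReal (G p ^ conj q) ∂(lateralMeasure U t₁ t₂) ≤ ENNReal.ofReal Ψ)
    (hv : IsSlabModel U u t₁ t₂ v K M) (hθ : IsTimeCutoff θ Kθ t₁ t₂) :
    ∫⁻ p, ENNReal.ofReal (G p * (v p ^ β * θ p.2)) ∂(lateralMeasure U t₁ t₂) ≤
      ENNReal.ofReal Ψ ^ (1 / conj q) *
        (∫⁻ p, ENNReal.ofReal (v p ^ (q * β) * θ p.2) ∂(lateralMeasure U t₁ t₂)) ^ (1 / q) := by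
  have hpq : q.HolderConjugate (conj q) := Real.HolderConjugate.conjExponent hq
  have hq' : 0 < conj q := hpq.symm.pos
  have hq0 : 0 < q := by linarith
  have hθm : Measurable (fun p : Euc n × ℝ => θ p.2) :=
    hθ.lipschitz.continuous.measurable.comp measurable_snd
  have hvm := hv.lipschitz.continuous.measurable
  have h := ENNReal.lintegral_mul_le_Lp_mul_Lq (lateralMeasure U t₁ t₂) hpq.symm
    hG.ennreal_ofReal (((hvm.pow_const β).mul hθm).ennreal_ofReal.aemeasurable)
  calc ∫⁻ p, ENNReal.ofReal (G p * (v p ^ β * θ p.2)) ∂(lateralMeasure U t₁ t₂)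
      = ∫⁻ p, ENNReal.ofReal (G p) * ENNReal.ofReal (v p ^ β * θ p.2)
          ∂(lateralMeasure U t₁ t₂) := lintegral_congr fun p => ENNReal.ofReal_mul (hG0 p)
    _ ≤ _ := h
    _ ≤ _ := by
        refine mul_le_mul' (ENNReal.rpow_le_rpow ?_ (by positivity))
          (ENNReal.rpow_le_rpow ?_ (by positivity))
        · refine le_trans (le_of_eq (lintegral_congr fun p => ?_)) hGΨ
          exact ENNReal.ofReal_rpow_of_nonneg (hG0 p) hq'.le
        · refine lintegral_mono fun p => ?_
          have h0 := hv.nonneg p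
          have h1 := hθ.nonneg p.2
          show ENNReal.ofReal (v p ^ β * θ p.2) ^ q ≤ _
          rw [ENNReal.ofReal_rpow_of_nonneg (by positivity) hq0.le]
          refine ENNReal.ofReal_le_ofReal ?_
          rw [Real.mul_rpow (by positivity) h1, ← Real.rpow_mul h0, mul_comm β]
          refine mul_le_mul_of_nonneg_left ?_ (by positivity)
          -- Since 0 ≤ θ ≤ 1 and q > 1, the power on the cut-off can be dropped, so that the energy
          -- later appears with θ itself.
          calc θ p.2 ^ q ≤ θ p.2 ^ (1 : ℝ) :=
                Real.rpow_le_rpow_of_exponent_ge' h1 (hθ.le_one _) zero_le_one hq.le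
            _ = θ p.2 := Real.rpow_one _

/-- Hölder with exponents 2-a and (2-a)/(1-a) reconstructs the energy density in the first factor.
The second factor compensates its weights W₁ and (1+v)^(-2λ), and s is the power of v which then
balances the exponent m-1. -/
theorem gradient_holder_le (hU : MeasurableSet U) (ha0 : 0 < a) (ha1 : a < 1)
    (hW₁m : AEMeasurable W₁ (volume.restrict U)) (hW₁ : ∀ x ∈ U, 0 < W₁ x)
    (hv : IsSlabModel U u t₁ t₂ v K M) (hθ : IsTimeCutoff θ Kθ t₁ t₂) {m s : ℝ}
    (hα : lam + 1 < α) (hs : 0 ≤ s)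
    (hms : (m - 1) * (2 - a) = (α - lam - 1) + s * (1 - a)) :
    ∫⁻ p, ENNReal.ofReal (θ p.2 * (v p ^ (m - 1) * ‖spaceGrad v p‖))
        ∂(cylinderMeasure U t₁ t₂) ≤
      (∫⁻ p, ENNReal.ofReal (W₁ p.1 * (θ p.2 * energyDensity a lam α v p))
        ∂(cylinderMeasure U t₁ t₂)) ^ (1 / (2 - a)) *
      (∫⁻ p, ENNReal.ofReal (W₁ p.1 ^ (-(1 / (1 - a))) * ((1 + v p) ^ (2 * lam / (1 - a)) * v p ^ s))
        ∂(cylinderMeasure U t₁ t₂)) ^ ((1 - a) / (2 - a)) := by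
  have h1a : 0 < 1 - a := by linarith
  have h2a : 0 < 2 - a := by linarith
  have hpq : (2 - a).HolderConjugate ((2 - a) / (1 - a)) := by
    rw [Real.holderConjugate_iff]
    refine ⟨by linarith, ?_⟩
    rw [inv_div]; field_simp; ring
  have hvm := hv.lipschitz.continuous.measurable
  have hθm : Measurable (fun p : Euc n × ℝ => θ p.2) :=
    hθ.lipschitz.continuous.measurable.comp measurable_snd
  have hWc : AEMeasurable (fun p : Euc n × ℝ => W₁ p.1) (cylinderMeasure U t₁ t₂) :=
    hW₁m.comp_fst
  have hem := measurable_energyDensity (a := a) (lam := lam) (α := α) hv.lipschitz.continuous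
  have hf : AEMeasurable (fun p => ENNReal.ofReal
      ((W₁ p.1 * (θ p.2 * energyDensity a lam α v p)) ^ (1 / (2 - a))))
      (cylinderMeasure U t₁ t₂) :=
    ((hWc.mul (hθm.mul hem).aemeasurable).pow_const _).ennreal_ofReal
  have hg : AEMeasurable (fun p => ENNReal.ofReal
      ((W₁ p.1 ^ (-(1 / (1 - a))) * ((1 + v p) ^ (2 * lam / (1 - a)) * v p ^ s)) ^
        ((1 - a) / (2 - a)))) (cylinderMeasure U t₁ t₂) :=
    (((hWc.pow_const _).mul (((hvm.const_add 1).pow_const _).mul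
      (hvm.pow_const s)).aemeasurable).pow_const _).ennreal_ofReal
  have h := ENNReal.lintegral_mul_le_Lp_mul_Lq (cylinderMeasure U t₁ t₂) hpq hf hg
  have e0 : 1 / ((2 - a) / (1 - a)) = (1 - a) / (2 - a) := one_div_div _ _
  rw [e0] at h
  refine le_trans (lintegral_mono_ae ?_) (h.trans (le_of_eq ?_))
  · filter_upwards [ae_cylinder hU t₁ t₂] with p hp
    have hw := hW₁ p.1 hp.1
    have hv0 := hv.nonneg p
    have hθ0 := hθ.nonneg p.2
    have he0 := energyDensity_nonneg (a := a) (lam := lam) (α := α) hv.nonneg p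
    have hv1 : 0 < 1 + v p := by linarith
    show _ ≤ ENNReal.ofReal _ * ENNReal.ofReal _
    rw [← ENNReal.ofReal_mul (by positivity)]
    refine ENNReal.ofReal_le_ofReal ?_
    unfold energyDensity
    set g := ‖spaceGrad v p‖ with hg
    have hg0 : 0 ≤ g := norm_nonneg _
    rw [Real.mul_rpow hw.le (by positivity), Real.mul_rpow hθ0 (by positivity),
      Real.mul_rpow (by positivity) (by positivity), Real.div_rpow (by positivity) (by positivity),
      Real.mul_rpow (by positivity) (by positivity), Real.mul_rpow (by positivity) (by positivity),
      ← Real.rpow_mul hv0, ← Real.rpow_mul hv1.le, ← Real.rpow_mul hg0, ← Real.rpow_mul hw.le,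
      ← Real.rpow_mul hv1.le, ← Real.rpow_mul hv0]
    have i1 : -(1 / (1 - a)) * ((1 - a) / (2 - a)) = -(1 / (2 - a)) := by field_simp
    have i2 : 2 * lam / (1 - a) * ((1 - a) / (2 - a)) = 2 * lam * (1 / (2 - a)) := by field_simp
    have i3 : (2 - a) * (1 / (2 - a)) = 1 := by field_simp
    have i4 : m - 1 = (α - lam - 1) * (1 / (2 - a)) + s * ((1 - a) / (2 - a)) := by
      field_simp; linarith
    rw [i1, i2, i3, i4, Real.rpow_one, Real.rpow_neg hw.le,
      Real.rpow_add_of_nonneg hv0 (by have : 0 < α - lam - 1 := by linarith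
                                      positivity) (by positivity)]
    -- The cut-off goes entirely to the energy factor; this is lossy but harmless because θ takes
    -- values in [0,1].
    have hθ1 : θ p.2 ≤ θ p.2 ^ (1 / (2 - a)) := by
      calc θ p.2 = θ p.2 ^ (1 : ℝ) := (Real.rpow_one _).symm
        _ ≤ _ := Real.rpow_le_rpow_of_exponent_ge' hθ0 (hθ.le_one _) (by positivity)
          (by rw [div_le_one h2a]; linarith)
    have k1 := (Real.rpow_pos_of_pos hw (1 / (2 - a))).ne'
    have k2 := (Real.rpow_pos_of_pos hv1 (2 * lam * (1 / (2 - a)))).ne'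
    calc _ ≤ θ p.2 ^ (1 / (2 - a)) * (v p ^ ((α - lam - 1) * (1 / (2 - a))) *
          v p ^ (s * ((1 - a) / (2 - a))) * g) := by gcongr
      _ = _ := by field_simp
  · congr 2
    · refine lintegral_congr_ae ?_
      filter_upwards [ae_cylinder hU t₁ t₂] with p hp
      have hw := hW₁ p.1 hp.1
      have hθ0 := hθ.nonneg p.2
      have he0 := energyDensity_nonneg (a := a) (lam := lam) (α := α) hv.nonneg p
      rw [ENNReal.ofReal_rpow_of_nonneg (by positivity) h2a.le, ← Real.rpow_mul (by positivity)]
      congr 1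
      rw [one_div, inv_mul_cancel₀ h2a.ne', Real.rpow_one]
    · refine lintegral_congr_ae ?_
      filter_upwards [ae_cylinder hU t₁ t₂] with p hp
      have hw := hW₁ p.1 hp.1
      have hv0 := hv.nonneg p
      rw [ENNReal.ofReal_rpow_of_nonneg (by positivity) (by positivity),
        ← Real.rpow_mul (by positivity)]
      congr 1
      have : (1 - a) / (2 - a) * ((2 - a) / (1 - a)) = 1 := by field_simp
      rw [this, Real.rpow_one]

/-- This is why only the two extreme powers of N occur in the final estimates: all intermediate ones
lie below their sum. -/
theorem rpow_le_add_rpow {N x lo hi : ℝ} (hN : 0 ≤ N) (hlo : 0 < lo) (h1 : lo ≤ x) (h2 : x ≤ hi) :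
    N ^ x ≤ N ^ lo + N ^ hi := by
  rcases le_total N 1 with h | h
  · have := Real.rpow_le_rpow_of_exponent_ge' hN h hlo.le h1
    have := Real.rpow_nonneg hN hi
    linarith
  · have := Real.rpow_le_rpow_of_exponent_le h h2
    have := Real.rpow_nonneg hN lo
    linarith

theorem mul_le_eps_rpow_add {x y ε P : ℝ} (hx : 0 ≤ x) (hy : 0 ≤ y) (hε : 0 < ε) (hP : 1 < P) :
    x * y ≤ ε * x ^ P + ε ^ (-(1 / (P - 1))) * y ^ (P / (P - 1)) := by
  have hP0 : 0 < P := by linarith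
  have hP1 : 0 < P - 1 := by linarith
  have hpq : P.HolderConjugate (P / (P - 1)) := Real.HolderConjugate.conjExponent hP
  have h := Real.young_inequality_of_nonneg (a := ε ^ (1 / P) * x) (b := ε ^ (-(1 / P)) * y)
    (by positivity) (by positivity) hpq
  have e1 : ε ^ (1 / P) * x * (ε ^ (-(1 / P)) * y) = x * y := by
    rw [Real.rpow_neg hε.le]
    have := (Real.rpow_pos_of_pos hε (1 / P)).ne'
    field_simp
  have e2 : (ε ^ (1 / P) * x) ^ P = ε * x ^ P := by
    rw [Real.mul_rpow (by positivity) hx, ← Real.rpow_mul hε.le, one_div, inv_mul_cancel₀ hP0.ne',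
      Real.rpow_one]
  have e3 : (ε ^ (-(1 / P)) * y) ^ (P / (P - 1)) = ε ^ (-(1 / (P - 1))) * y ^ (P / (P - 1)) := by
    rw [Real.mul_rpow (by positivity) hy, ← Real.rpow_mul hε.le]
    congr 2
    field_simp
  rw [e1, e2, e3] at h
  refine h.trans (add_le_add (div_le_self (by positivity) hP.le)
    (div_le_self (by positivity) hpq.symm.lt.le))

/-- The exponents of `N` in the gradient part of the boundary term. -/
theorem boundary_exponent_bounds {a lam α β p₃ s d : ℝ}
    (ha0 : 0 < a) (ha1 : a < 1) (hlam : 0 < lam) (hp₃ : 1 < p₃)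
    (hβ1 : α - lam ≤ β) (hβ2 : β ≤ α)
    (hs : s = ((p₃ * β - 1) * (2 - a) - (α - lam - 1)) / (1 - a)) (hd : d = 2 * lam / (1 - a)) :
    α - h₁ lam ≤ s * ((1 - a) / (p₃ * (2 - a) - 1)) ∧
      (s + d) * ((1 - a) / (p₃ * (2 - a) - 1)) ≤ α + h₂ a lam p₃ := by
  set P := p₃ * (2 - a) with hP
  have h1a : 0 < 1 - a := by linarith
  have hP1 : 1 - a < P - 1 := by nlinarith
  have hPm : 0 < P - 1 := by linarith
  have hsr : s * ((1 - a) / (P - 1)) = (β * P - α + lam - (1 - a)) / (P - 1) := by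
    rw [hs, hP]; field_simp; ring
  have hdr : d * ((1 - a) / (P - 1)) = 2 * lam / (P - 1) := by rw [hd]; field_simp
  have hh2b : (a + 3 * lam - 1) / (P - 1) ≤ h₂ a lam p₃ :=
    (le_max_right _ _).trans (le_max_right _ _)
  refine ⟨?_, ?_⟩
  -- With β ≥ α-λ the numerator is at least (α-λ)(P-1) - (1-a), and 1-a < P-1.
  · rw [hsr, le_div_iff₀ hPm]; unfold h₁
    nlinarith
  -- The gap vanishes for β = α, so this case dictates the third entry of `h₂`.
  · have e : α + (a + 3 * lam - 1) / (P - 1) - (s + d) * ((1 - a) / (P - 1)) =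
        (α - β) * P / (P - 1) := by
      rw [add_mul, hsr, hdr]; field_simp; ring
    have h0 : 0 ≤ α - β := by linarith
    have hP0 : 0 < P := by linarith
    have : 0 ≤ (α - β) * P / (P - 1) := by positivity
    linarith

theorem rpow_le_one_add_rpow {x e f : ℝ} (hx : 0 ≤ x) (he : 0 ≤ e) (hef : e ≤ f) :
    x ^ e ≤ 1 + x ^ f := by
  rcases le_total x 1 with h | h
  · have := Real.rpow_le_one hx h he
    have := Real.rpow_nonneg hx f
    linarith
  · have := Real.rpow_le_rpow_of_exponent_le h hef
    linarith

theorem rpow_le_self_of_one_le {D e : ℝ} (hD : 1 ≤ D) (he : e ≤ 1) : D ^ e ≤ D := by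
  calc D ^ e ≤ D ^ (1 : ℝ) := Real.rpow_le_rpow_of_exponent_le hD he
    _ = D := Real.rpow_one D

/-- This treats the part of the boundary term in which the trace inequality produces no gradient.
The root 1/p₃ brings N^(p₃β) back to N^β. -/
theorem boundary_first_part {C D J₄ Ψ N β p₃ q ΨT W S : ℝ} (hp₃ : 1 < p₃) (hC : 0 ≤ C)
    (hD : 1 ≤ D) (hJ₄ : 0 ≤ J₄) (hΨ : 0 ≤ Ψ) (hN : 0 ≤ N) (hΨT : Ψ ^ (1 / q) ≤ ΨT)
    (hW : J₄ ^ (1 / p₃) ≤ W) (hS : N ^ β ≤ S) :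
    Ψ ^ (1 / q) * (C * (D * J₄ * N ^ (p₃ * β))) ^ (1 / p₃) ≤
      C ^ (1 / p₃) * (D * W * ΨT * S) := by
  have hp0 : 0 < p₃ := by linarith
  have hD0 : 0 < D := by linarith
  have hp1 : 1 / p₃ ≤ 1 := by rw [div_le_one hp0]; exact hp₃.le
  have hDp := rpow_le_self_of_one_le hD hp1
  have i1 : p₃ * β * (1 / p₃) = β := by field_simp
  rw [Real.mul_rpow hC (by positivity), Real.mul_rpow (by positivity) (by positivity),
    Real.mul_rpow hD0.le hJ₄, ← Real.rpow_mul hN, i1]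
  have n1 := Real.rpow_nonneg hΨ (1 / q)
  have n2 := Real.rpow_nonneg hJ₄ (1 / p₃)
  have n3 := Real.rpow_nonneg hD0.le (1 / p₃)
  have n4 := Real.rpow_nonneg hN β
  have n5 := Real.rpow_nonneg hC (1 / p₃)
  calc Ψ ^ (1 / q) * (C ^ (1 / p₃) * (D ^ (1 / p₃) * J₄ ^ (1 / p₃) * N ^ β))
      = C ^ (1 / p₃) * (D ^ (1 / p₃) * J₄ ^ (1 / p₃) * Ψ ^ (1 / q) * N ^ β) := by ring
    _ ≤ C ^ (1 / p₃) * (D * W * ΨT * S) :=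
        mul_le_mul_of_nonneg_left (mul_le_mul (mul_le_mul (mul_le_mul hDp hW n2 hD0.le) hΨT n1
          (mul_nonneg hD0.le (n2.trans hW))) hS n4
          (mul_nonneg (mul_nonneg hD0.le (n2.trans hW)) (n1.trans hΨT))) n5

/-- This is the cofactor of the energy raised to the conjugate exponent P/(P-1), with P = p₃(2-a),
as it comes out of Young's inequality. Each factor is then measured by the corresponding ingredient
of the final bound. -/
theorem boundary_second_part {a α C D J₅ Ψ N β p₃ q ΨT W S s d : ℝ} (ha0 : 0 < a) (ha1 : a < 1)
    (hp₃ : 1 < p₃) (hα : 1 < α) (hβ0 : 0 < β) (hβ2 : β ≤ α) (hC : 0 ≤ C) (hq : 1 < q)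
    (hD : 1 ≤ D) (hJ₅ : 0 ≤ J₅) (hΨ : 0 ≤ Ψ) (hN : 0 ≤ N)
    (hΨT : Ψ ^ (p₃ * (2 - a) / (q * (p₃ * (2 - a) - 1))) ≤ ΨT)
    (hW : J₅ ^ ((1 - a) / (p₃ * (2 - a) - 1)) ≤ W)
    (hS1 : N ^ (s * ((1 - a) / (p₃ * (2 - a) - 1))) ≤ S)
    (hS2 : N ^ ((s + d) * ((1 - a) / (p₃ * (2 - a) - 1))) ≤ S) :
    (Ψ ^ (1 / q) * ((C * (p₃ * β)) ^ (1 / p₃) *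
        (2 ^ d * (D * J₅ * (N ^ s + N ^ (s + d)))) ^ ((1 - a) / (p₃ * (2 - a))))) ^
        (p₃ * (2 - a) / (p₃ * (2 - a) - 1)) ≤
      2 ^ (d * ((1 - a) / (p₃ * (2 - a) - 1)) + 1) * (C * p₃) ^ ((2 - a) / (p₃ * (2 - a) - 1)) *
        α ^ ((2 - a) / (1 - a)) * (D * W * ΨT * S) := by
  generalize hPP : p₃ * (2 - a) = P at *
  have h1a : 0 < 1 - a := by linarith
  have h2a : 0 < 2 - a := by linarith
  have hP1 : 1 - a < P - 1 := by rw [← hPP]; nlinarith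
  have hPm : 0 < P - 1 := by linarith
  have hP0 : 0 < P := by linarith
  have hp0 : 0 < p₃ := by linarith
  have hD0 : 0 < D := by linarith
  have hα0 : 0 < α := by linarith
  have hr1 : (1 - a) / (P - 1) ≤ 1 := by rw [div_le_one hPm]; exact hP1.le
  have hQ0 : 0 ≤ (2 : ℝ) ^ d * (D * J₅ * (N ^ s + N ^ (s + d))) := by positivity
  have hNN0 : 0 ≤ N ^ s + N ^ (s + d) := by positivity
  have i1 : 1 / q * (P / (P - 1)) = P / (q * (P - 1)) := by field_simp
  have i2 : 1 / p₃ * (P / (P - 1)) = (2 - a) / (P - 1) := by rw [← hPP]; field_simp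
  have i3 : (1 - a) / P * (P / (P - 1)) = (1 - a) / (P - 1) := by field_simp
  have hNN : (N ^ s + N ^ (s + d)) ^ ((1 - a) / (P - 1)) ≤ 2 * S := by
    refine (Real.rpow_add_le_add_rpow (by positivity) (by positivity) (by positivity) hr1).trans ?_
    rw [← Real.rpow_mul hN, ← Real.rpow_mul hN]
    linarith
  -- Replacing P-1 by the smaller 1-a makes the power of α independent of p₃.
  have hβα : β ^ ((2 - a) / (P - 1)) ≤ α ^ ((2 - a) / (1 - a)) :=
    (Real.rpow_le_rpow hβ0.le hβ2 (by positivity)).trans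
      (Real.rpow_le_rpow_of_exponent_le hα.le
        (div_le_div_of_nonneg_left h2a.le h1a hP1.le))
  have hDr := rpow_le_self_of_one_le hD hr1
  have i4 : (2 : ℝ) ^ (d * ((1 - a) / (P - 1)) + 1) = 2 ^ (d * ((1 - a) / (P - 1))) * 2 := by
    rw [Real.rpow_add (by norm_num), Real.rpow_one]
  rw [Real.mul_rpow (by positivity) (by positivity), Real.mul_rpow (by positivity) (by positivity),
    ← Real.rpow_mul hΨ, ← Real.rpow_mul (by positivity), ← Real.rpow_mul hQ0,
    i1, i2, i3, ← mul_assoc C, Real.mul_rpow (by positivity) hβ0.le,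
    Real.mul_rpow (x := (2 : ℝ) ^ d) (by positivity) (by positivity),
    Real.mul_rpow (x := D * J₅) (by positivity) hNN0,
    Real.mul_rpow hD0.le hJ₅, ← Real.rpow_mul (by norm_num), i4]
  have n1 := Real.rpow_nonneg hΨ (P / (q * (P - 1)))
  have n2 := Real.rpow_nonneg hJ₅ ((1 - a) / (P - 1))
  have n3 := Real.rpow_nonneg hNN0 ((1 - a) / (P - 1))
  have n4 := Real.rpow_nonneg hD0.le ((1 - a) / (P - 1))
  have n5 := Real.rpow_nonneg (mul_nonneg hC hp0.le) ((2 - a) / (P - 1))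
  have n6 := Real.rpow_nonneg hβ0.le ((2 - a) / (P - 1))
  have n7 : (0 : ℝ) ≤ 2 ^ (d * ((1 - a) / (P - 1))) := by positivity
  have n8 := n6.trans hβα
  generalize Ψ ^ (P / (q * (P - 1))) = x₁ at *
  generalize J₅ ^ ((1 - a) / (P - 1)) = x₂ at *
  generalize (N ^ s + N ^ (s + d)) ^ ((1 - a) / (P - 1)) = x₃ at *
  generalize D ^ ((1 - a) / (P - 1)) = x₄ at *
  generalize (C * p₃) ^ ((2 - a) / (P - 1)) = x₅ at *
  generalize β ^ ((2 - a) / (P - 1)) = x₆ at *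
  generalize (2 : ℝ) ^ (d * ((1 - a) / (P - 1))) = x₇ at *
  generalize α ^ ((2 - a) / (1 - a)) = x₈ at *
  calc x₁ * (x₅ * x₆ * (x₇ * (x₄ * x₂ * x₃))) = (x₇ * x₅ * x₆) * (x₄ * x₂ * x₁ * x₃) := by ring
    _ ≤ (x₇ * x₅ * x₈) * (D * W * ΨT * (2 * S)) := by
        refine mul_le_mul (mul_le_mul_of_nonneg_left hβα (by positivity))
          (mul_le_mul (mul_le_mul (mul_le_mul hDr hW n2 hD0.le) hΨT n1
          (mul_nonneg hD0.le (n2.trans hW))) hNN n3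
          (mul_nonneg (mul_nonneg hD0.le (n2.trans hW)) (n1.trans hΨT))) ?_ (by positivity)
        exact mul_nonneg (mul_nonneg (mul_nonneg n4 n2) n1) n3
    _ = _ := by ring

/-- Absorbing the energy from the boundary term by Young's inequality. -/
theorem boundary_absorption {a lam α β p₃ C D J₄ J₅ Ψ N E ε B s d S : ℝ}
    (ha0 : 0 < a) (ha1 : a < 1) (hlam : 0 < lam) (hp₃ : 1 < p₃) (hα : lam + 1 < α)
    (hβ1 : α - lam ≤ β) (hβ2 : β ≤ α) (hC : 0 ≤ C) (hD : 1 ≤ D) (hJ₄ : 0 ≤ J₄) (hJ₅ : 0 ≤ J₅)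
    (hΨ : 0 ≤ Ψ) (hN : 0 ≤ N) (hE : 0 ≤ E) (hε : 0 < ε)
    (hs : s = ((p₃ * β - 1) * (2 - a) - (α - lam - 1)) / (1 - a)) (hd : d = 2 * lam / (1 - a))
    (hS : S = N ^ (α - h₁ lam) + N ^ (α + h₂ a lam p₃))
    (hB : B ≤ Ψ ^ (1 / conj p₃) * (C * (D * J₄ * N ^ (p₃ * β) + p₃ * β * (E ^ (1 / (2 - a)) *
      (2 ^ d * (D * J₅ * (N ^ s + N ^ (s + d)))) ^ ((1 - a) / (2 - a))))) ^ (1 / p₃)) :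
    B ≤ ε * E + (C ^ (1 / p₃) + 2 ^ (d * ((1 - a) / (p₃ * (2 - a) - 1)) + 1) *
        (C * p₃) ^ ((2 - a) / (p₃ * (2 - a) - 1)) * ε ^ (-(1 / (p₃ * (2 - a) - 1))) *
        α ^ ((2 - a) / (1 - a))) *
      (D * (1 + J₄ ^ (1 / p₃) + J₅ ^ ((1 - a) / (p₃ * (2 - a) - 1))) *
        (1 + Ψ ^ (p₃ * (2 - a) / (conj p₃ * (p₃ * (2 - a) - 1)))) * S) := by
  have h1a : 0 < 1 - a := by linarith
  have h2a : 0 < 2 - a := by linarith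
  have hP1 : 1 - a < p₃ * (2 - a) - 1 := by nlinarith
  have hPgt : 1 < p₃ * (2 - a) := by linarith
  have hPm : 0 < p₃ * (2 - a) - 1 := by linarith
  have hP0 : 0 < p₃ * (2 - a) := by linarith
  have hp0 : 0 < p₃ := by linarith
  have hβ0 : 0 < β := by linarith
  have hα0 : 0 < α := by linarith
  have hD0 : 0 < D := by linarith
  have hq : 1 < conj p₃ := (Real.HolderConjugate.conjExponent hp₃).symm.lt
  have hd0 : 0 < d := by rw [hd]; positivity
  have hlo : 0 < α - h₁ lam := by unfold h₁; linarith
  have hh2a : 0 ≤ h₂ a lam p₃ := le_max_left _ _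
  obtain ⟨hx1, hx2⟩ := boundary_exponent_bounds ha0 ha1 hlam hp₃ hβ1 hβ2 hs hd
  have hr0 : 0 < (1 - a) / (p₃ * (2 - a) - 1) := by positivity
  have hdr0 : 0 < d * ((1 - a) / (p₃ * (2 - a) - 1)) := by positivity
  have hNβ : N ^ β ≤ S := by
    rw [hS]; exact rpow_le_add_rpow hN hlo (by unfold h₁; linarith) (by linarith)
  have hN1 : N ^ (s * ((1 - a) / (p₃ * (2 - a) - 1))) ≤ S := by
    rw [hS]; exact rpow_le_add_rpow hN hlo hx1 (by linarith)
  have hN2 : N ^ ((s + d) * ((1 - a) / (p₃ * (2 - a) - 1))) ≤ S := by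
    rw [hS]; exact rpow_le_add_rpow hN hlo (by linarith) hx2
  -- The part without gradient has a smaller power of the data; the added 1 covers the case Ψ < 1.
  have hΨ1 : Ψ ^ (1 / conj p₃) ≤
      1 + Ψ ^ (p₃ * (2 - a) / (conj p₃ * (p₃ * (2 - a) - 1))) := by
    refine rpow_le_one_add_rpow hΨ (by positivity) ?_
    rw [div_le_div_iff₀ (by linarith) (by positivity)]
    nlinarith
  have n4 : 0 ≤ J₄ ^ (1 / p₃) := by positivity
  have n5 : 0 ≤ J₅ ^ ((1 - a) / (p₃ * (2 - a) - 1)) := by positivity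
  have hfirst := boundary_first_part (W := 1 + J₄ ^ (1 / p₃) + J₅ ^ ((1 - a) / (p₃ * (2 - a) - 1)))
    hp₃ hC hD hJ₄ hΨ hN hΨ1 (by linarith) hNβ
  have hsecond := boundary_second_part (d := d)
    (W := 1 + J₄ ^ (1 / p₃) + J₅ ^ ((1 - a) / (p₃ * (2 - a) - 1)))
    (ΨT := 1 + Ψ ^ (p₃ * (2 - a) / (conj p₃ * (p₃ * (2 - a) - 1))))
    ha0 ha1 hp₃ (by linarith) hβ0 hβ2 hC hq hD hJ₅ hΨ hN (by linarith) (by linarith) hN1 hN2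
  have hp1 : 1 / p₃ ≤ 1 := by rw [div_le_one hp0]; exact hp₃.le
  have hQ0 : 0 ≤ (2 : ℝ) ^ d * (D * J₅ * (N ^ s + N ^ (s + d))) := by positivity
  generalize (2 : ℝ) ^ d * (D * J₅ * (N ^ s + N ^ (s + d))) = Q at *
  -- Subadditivity of the root 1/p₃ separates the two parts of the trace bound. The energy now has
  -- the exponent 1/(p₃(2-a)) < 1, which is what allows absorption.
  have hsplit : B ≤ Ψ ^ (1 / conj p₃) * (C * (D * J₄ * N ^ (p₃ * β))) ^ (1 / p₃) +
      E ^ (1 / (p₃ * (2 - a))) * (Ψ ^ (1 / conj p₃) * ((C * (p₃ * β)) ^ (1 / p₃) *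
        Q ^ ((1 - a) / (p₃ * (2 - a))))) := by
    refine hB.trans ?_
    rw [mul_add C]
    refine (mul_le_mul_of_nonneg_left (Real.rpow_add_le_add_rpow (by positivity) (by positivity)
      (by positivity) hp1) (by positivity)).trans (le_of_eq ?_)
    have e1 : (C * (p₃ * β * (E ^ (1 / (2 - a)) * Q ^ ((1 - a) / (2 - a))))) ^ (1 / p₃) =
        (C * (p₃ * β)) ^ (1 / p₃) * (E ^ (1 / (p₃ * (2 - a))) *
          Q ^ ((1 - a) / (p₃ * (2 - a)))) := by
      have m1 : 0 ≤ C * (p₃ * β) := by positivity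
      have m2 : 0 ≤ E ^ (1 / (2 - a)) := by positivity
      have m3 : 0 ≤ Q ^ ((1 - a) / (2 - a)) := by positivity
      rw [← mul_assoc C, Real.mul_rpow m1 (mul_nonneg m2 m3),
        Real.mul_rpow m2 m3, ← Real.rpow_mul hE, ← Real.rpow_mul hQ0]
      have i1 : 1 / (2 - a) * (1 / p₃) = 1 / (p₃ * (2 - a)) := by field_simp
      have i2 : (1 - a) / (2 - a) * (1 / p₃) = (1 - a) / (p₃ * (2 - a)) := by field_simp
      rw [i1, i2]
    rw [e1]; ring
  have hyoung := mul_le_eps_rpow_add (x := E ^ (1 / (p₃ * (2 - a))))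
    (y := Ψ ^ (1 / conj p₃) * ((C * (p₃ * β)) ^ (1 / p₃) * Q ^ ((1 - a) / (p₃ * (2 - a)))))
    (by positivity) (by positivity) hε hPgt
  rw [← Real.rpow_mul hE, one_div_mul_cancel hP0.ne', Real.rpow_one] at hyoung
  have h3 := mul_le_mul_of_nonneg_left hsecond
    (by positivity : 0 ≤ ε ^ (-(1 / (p₃ * (2 - a) - 1))))
  have h4 := hsplit.trans (add_le_add hfirst (hyoung.trans (add_le_add le_rfl h3)))
  refine h4.trans (le_of_eq ?_)
  ring

/-! ### Boundary integrals in terms of the energy -/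

theorem integral_le_of_lintegral_ofReal_le {Y : Type*} [MeasurableSpace Y] {μ : Measure Y}
    {f : Y → ℝ} {c : ℝ} (hf : 0 ≤ᵐ[μ] f) (hc : 0 ≤ c)
    (h : ∫⁻ y, ENNReal.ofReal (f y) ∂μ ≤ ENNReal.ofReal c) : ∫ y, f y ∂μ ≤ c := by
  by_cases hi : Integrable f μ
  · rw [integral_eq_lintegral_of_nonneg_ae hf hi.aestronglyMeasurable]
    exact ENNReal.toReal_le_of_le_ofReal hc h
  -- No integrability has to be checked beforehand: a non-integrable function has integral 0 by
  -- convention.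
  · rw [integral_undef hi]; exact hc

theorem integrable_energy (hv : IsSlabModel U u t₁ t₂ v K M) (hθ : IsTimeCutoff θ Kθ t₁ t₂)
    (hW₁ : IntegrableOn W₁ U) (ha1 : a < 1) (hlam : 0 < lam) (hα : lam + 1 < α) :
    Integrable (fun p : Euc n × ℝ => W₁ p.1 * (θ p.2 * energyDensity a lam α v p))
      (cylinderMeasure U t₁ t₂) := by
  have hθm : Measurable (fun p : Euc n × ℝ => θ p.2) :=
    hθ.lipschitz.continuous.measurable.comp measurable_snd
  refine integrable_fst_mul_bdd hW₁
    (hθm.mul (measurable_energyDensity hv.lipschitz.continuous))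
    (C := 1 * (M ^ (α - lam - 1) * K ^ (2 - a))) fun p => ?_
  rw [abs_mul, abs_of_nonneg (energyDensity_nonneg hv.nonneg p)]
  exact mul_le_mul (hθ.abs_le_one _) (energyDensity_le hv ha1 hlam hα p)
    (energyDensity_nonneg hv.nonneg p) zero_le_one

theorem ae_energy_nonneg (hU : MeasurableSet U) (hv : IsSlabModel U u t₁ t₂ v K M)
    (hθ : IsTimeCutoff θ Kθ t₁ t₂) (hW₁ : ∀ x ∈ U, 0 < W₁ x) :
    0 ≤ᵐ[cylinderMeasure U t₁ t₂]
      fun p : Euc n × ℝ => W₁ p.1 * (θ p.2 * energyDensity a lam α v p) := by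
  filter_upwards [ae_cylinder hU t₁ t₂] with p hp
  exact mul_nonneg (hW₁ p.1 hp.1).le
    (mul_nonneg (hθ.nonneg _) (energyDensity_nonneg hv.nonneg p))

/-- The negative part of the boundary flux is controlled by the energy and the norm of `u`. -/
theorem lateral_integral_le (hU : IsOpen U) [IsFiniteMeasure (surfaceMeasure U)] {C : NNReal}
    (hC : ∀ (L : NNReal) (f : Euc n → ℝ), LipschitzWith L f →
      ∫⁻ x, ENNReal.ofReal (f x) ∂(surfaceMeasure U) ≤
        C * ∫⁻ x in U, (ENNReal.ofReal (f x) + ENNReal.ofReal ‖gradient f x‖))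
    (hv : IsSlabModel U u t₁ t₂ v K M) (hθ : IsTimeCutoff θ Kθ t₁ t₂)
    {G : Euc n × ℝ → ℝ} {Ψ β p₃ p₄ p₅ R N T s d : ℝ}
    (hG : AEMeasurable G (lateralMeasure U t₁ t₂)) (hG0 : ∀ p, 0 ≤ G p) (hΨ : 0 ≤ Ψ)
    (hGΨ : ∫⁻ p, ENNReal.ofReal (G p ^ conj p₃) ∂(lateralMeasure U t₁ t₂) ≤ ENNReal.ofReal Ψ)
    (ha0 : 0 < a) (ha1 : a < 1) (hlam : 0 < lam) (hα : lam + 1 < α)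
    (hp₃ : 1 < p₃) (hp₄ : 1 < p₄) (hp₅ : 1 < p₅)
    (hφ : IntegrableOn φ U) (hφ0 : ∀ x ∈ U, 0 < φ x) (hW₁0 : ∀ x ∈ U, 0 < W₁ x)
    (hW₁ : IntegrableOn W₁ U)
    (hI₄ : IntegrableOn (fun x => φ x ^ (-(conj p₄ / p₄))) U)
    (hI₅ : IntegrableOn (fun x => W₁ x ^ (-(conj p₅ / (1 - a))) * φ x ^ (-(conj p₅ / p₅))) U)
    (ht1 : 0 ≤ t₁) (h12 : t₁ < t₂) (h2T : t₂ ≤ T) (hN0 : 0 ≤ N)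
    (hN : ∫⁻ p, ENNReal.ofReal (v p ^ R * φ p.1) ∂(cylinderMeasure U t₁ t₂) ≤
      ENNReal.ofReal (N ^ R)) (hR : 0 < R)
    (hβ : α - lam ≤ β) (hs : s = ((p₃ * β - 1) * (2 - a) - (α - lam - 1)) / (1 - a))
    (hd : d = 2 * lam / (1 - a)) (hR4 : p₃ * β * p₄ ≤ R) (hR5 : (s + d) * p₅ ≤ R) :
    ∫ p, G p * (v p ^ β * θ p.2) ∂(lateralMeasure U t₁ t₂) ≤
      Ψ ^ (1 / conj p₃) * (C * ((1 + T) * (1 + ∫ x in U, φ x) *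
        (∫ x in U, φ x ^ (-(conj p₄ / p₄))) ^ (1 / conj p₄) * N ^ (p₃ * β) + p₃ * β *
        ((∫ p, W₁ p.1 * (θ p.2 * energyDensity a lam α v p) ∂(cylinderMeasure U t₁ t₂)) ^
          (1 / (2 - a)) *
        (2 ^ d * ((1 + T) * (1 + ∫ x in U, φ x) *
          (∫ x in U, W₁ x ^ (-(conj p₅ / (1 - a))) * φ x ^ (-(conj p₅ / p₅))) ^ (1 / conj p₅) *
          (N ^ s + N ^ (s + d)))) ^ ((1 - a) / (2 - a))))) ^ (1 / p₃) := by
  have hUm := hU.measurableSet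
  have h1a : 0 < 1 - a := by linarith
  have h2a : 0 < 2 - a := by linarith
  have hp0 : 0 < p₃ := by linarith
  have hβ0 : 0 < β := by linarith
  have hT : 0 < T := by linarith
  have hm1 : α - lam ≤ p₃ * β := by nlinarith
  have hm : 1 ≤ p₃ * β := by linarith
  have hs0 : 0 ≤ s := by rw [hs]; apply div_nonneg _ h1a.le; nlinarith
  have hd0 : 0 < d := by rw [hd]; positivity
  have hq3 : 0 < conj p₃ := (Real.HolderConjugate.conjExponent hp₃).symm.pos
  have hq5 : 0 < conj p₅ := (Real.HolderConjugate.conjExponent hp₅).symm.pos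
  have hms : (p₃ * β - 1) * (2 - a) = (α - lam - 1) + s * (1 - a) := by
    rw [hs]; field_simp; ring
  have hΦ : 0 ≤ ∫ x in U, φ x := setIntegral_nonneg hUm fun x hx => (hφ0 x hx).le
  have hI4 : 0 ≤ ∫ x in U, φ x ^ (-(conj p₄ / p₄)) := setIntegral_nonneg hUm fun x hx =>
    Real.rpow_nonneg (hφ0 x hx).le _
  have hI5 : 0 ≤ ∫ x in U, W₁ x ^ (-(conj p₅ / (1 - a))) * φ x ^ (-(conj p₅ / p₅)) :=
    setIntegral_nonneg hUm fun x hx => mul_nonneg (Real.rpow_nonneg (hW₁0 x hx).le _)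
      (Real.rpow_nonneg (hφ0 x hx).le _)
  have hvm := hv.lipschitz.continuous.measurable
  have hE0 := integral_nonneg_of_ae (ae_energy_nonneg (a := a) (lam := lam) (α := α) hUm hv hθ hW₁0)
  have hEeq := ofReal_integral_eq_lintegral_ofReal (integrable_energy hv hθ hW₁ ha1 hlam hα)
    (ae_energy_nonneg hUm hv hθ hW₁0)
  -- the part without gradient
  have hA1 : ∫⁻ p, ENNReal.ofReal (θ p.2 * v p ^ (p₃ * β)) ∂(cylinderMeasure U t₁ t₂) ≤
      ENNReal.ofReal ((1 + T) * (1 + ∫ x in U, φ x) *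
        (∫ x in U, φ x ^ (-(conj p₄ / p₄))) ^ (1 / conj p₄) * N ^ (p₃ * β)) := by
    have h := lintegral_weight_mul_rpow_le (w := fun _ => 1) (p := p₄) (s := p₃ * β) hUm hφ hφ0
      (fun x _ => zero_le_one) (by simpa using hI₄) ht1 h12 h2T hvm hv.nonneg hN0 hN hR hp₄
      (by linarith) hR4
    simp only [Real.one_rpow, one_mul] at h
    refine le_trans (lintegral_mono fun p => ENNReal.ofReal_le_ofReal ?_) h
    exact mul_le_of_le_one_left (Real.rpow_nonneg (hv.nonneg p) _) (hθ.le_one _)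
  -- the gradient part
  have hA2 := gradient_holder_le (lam := lam) (W₁ := W₁) hUm ha0 ha1
    hW₁.aestronglyMeasurable.aemeasurable hW₁0 hv hθ hα hs0 hms
  -- The compensating weight W₁^(-1/(1-a)) of the gradient estimate, raised to the conjugate of p₅,
  -- is the weight assumed integrable.
  have e5 : ∀ x ∈ U, (W₁ x ^ (-(1 / (1 - a)))) ^ conj p₅ * φ x ^ (-(conj p₅ / p₅)) =
      W₁ x ^ (-(conj p₅ / (1 - a))) * φ x ^ (-(conj p₅ / p₅)) := by
    intro x hx
    rw [← Real.rpow_mul (hW₁0 x hx).le]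
    congr 2; ring
  have hQ := lintegral_weight_mul_one_add_rpow_le (w := fun x => W₁ x ^ (-(1 / (1 - a))))
    (p := p₅) (s := s) (d := d) hUm (hW₁.aestronglyMeasurable.aemeasurable.pow_const _) hφ hφ0
    (fun x hx => Real.rpow_nonneg (hW₁0 x hx).le _)
    ((integrableOn_congr_fun e5 hUm).2 hI₅) ht1 h12 h2T hvm hv.nonneg hN0 hN hR hp₅ hs0 hd0.le hR5
  rw [setIntegral_congr_fun hUm e5] at hQ
  rw [← hEeq, ← hd] at hA2
  set D := (1 + T) * (1 + ∫ x in U, φ x) with hD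
  have hD0 : 0 ≤ D := by positivity
  set E := ∫ p, W₁ p.1 * (θ p.2 * energyDensity a lam α v p) ∂(cylinderMeasure U t₁ t₂) with hE
  set J₅ := (∫ x in U, W₁ x ^ (-(conj p₅ / (1 - a))) * φ x ^ (-(conj p₅ / p₅))) ^ (1 / conj p₅)
    with hJ5
  set J₄ := (∫ x in U, φ x ^ (-(conj p₄ / p₄))) ^ (1 / conj p₄) with hJ4
  have hJ50 : 0 ≤ J₅ := Real.rpow_nonneg hI5 _
  have hJ40 : 0 ≤ J₄ := Real.rpow_nonneg hI4 _
  have hQ0 : 0 ≤ 2 ^ d * (D * J₅ * (N ^ s + N ^ (s + d))) := by positivity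
  set Q := 2 ^ d * (D * J₅ * (N ^ s + N ^ (s + d))) with hQdef
  have hN4 : 0 ≤ D * J₄ * N ^ (p₃ * β) := by positivity
  have hA2' : ∫⁻ p, ENNReal.ofReal (θ p.2 * (v p ^ (p₃ * β - 1) * ‖spaceGrad v p‖))
      ∂(cylinderMeasure U t₁ t₂) ≤
      ENNReal.ofReal (E ^ (1 / (2 - a)) * Q ^ ((1 - a) / (2 - a))) := by
    refine hA2.trans ?_
    rw [ENNReal.ofReal_mul (Real.rpow_nonneg hE0 _),
      ← ENNReal.ofReal_rpow_of_nonneg hE0 (by positivity),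
      ← ENNReal.ofReal_rpow_of_nonneg hQ0 (by positivity)]
    exact mul_le_mul' le_rfl (ENNReal.rpow_le_rpow hQ (by positivity))
  have hG2 : 0 ≤ E ^ (1 / (2 - a)) * Q ^ ((1 - a) / (2 - a)) :=
    mul_nonneg (Real.rpow_nonneg hE0 _) (Real.rpow_nonneg hQ0 _)
  have hin : 0 ≤ D * J₄ * N ^ (p₃ * β) +
      p₃ * β * (E ^ (1 / (2 - a)) * Q ^ ((1 - a) / (2 - a))) := by positivity
  refine integral_le_of_lintegral_ofReal_le (Eventually.of_forall fun p => mul_nonneg (hG0 p)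
    (mul_nonneg (Real.rpow_nonneg (hv.nonneg p) _) (hθ.nonneg _))) (by positivity) ?_
  refine (lateral_holder_le hG hG0 hp₃ hGΨ hv hθ).trans ?_
  rw [ENNReal.ofReal_mul (Real.rpow_nonneg hΨ _),
    ← ENNReal.ofReal_rpow_of_nonneg hΨ (by positivity),
    ← ENNReal.ofReal_rpow_of_nonneg (by positivity) (by positivity)]
  refine mul_le_mul' le_rfl (ENNReal.rpow_le_rpow ?_ (by positivity))
  refine (lateral_trace_le hC hv hθ hm).trans ?_
  rw [ENNReal.ofReal_mul (NNReal.coe_nonneg _), ENNReal.ofReal_coe_nnreal,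
    ENNReal.ofReal_add hN4 (by positivity), ENNReal.ofReal_mul (p := p₃ * β) (by positivity)]
  exact mul_le_mul' le_rfl (add_le_add hA1 (mul_le_mul' le_rfl hA2'))

/-! ### Consequences of the assumptions on the data, the weights and the exponents -/

theorem lateralMeasure_eq_restrict [IsFiniteMeasure (surfaceMeasure U)] (s t : ℝ) :
    lateralMeasure U s t = ((surfaceMeasure U).prod volume).restrict (univ ×ˢ Ioo s t) := by
  rw [lateralMeasure, ← Measure.prod_restrict, Measure.restrict_univ]

theorem lateralMeasure_mono [IsFiniteMeasure (surfaceMeasure U)] {s t s' t' : ℝ} (hs : s' ≤ s)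
    (ht : t ≤ t') : lateralMeasure U s t ≤ lateralMeasure U s' t' := by
  rw [lateralMeasure_eq_restrict, lateralMeasure_eq_restrict]
  exact Measure.restrict_mono (prod_mono le_rfl (Ioo_subset_Ioo hs ht)) le_rfl

theorem lateralMeasure_le_global [IsFiniteMeasure (surfaceMeasure U)] {s t : ℝ} (hs : 0 ≤ s) :
    lateralMeasure U s t ≤ globalLateralMeasure U := by
  have h : globalLateralMeasure U = ((surfaceMeasure U).prod volume).restrict (univ ×ˢ Ioi 0) := by
    rw [globalLateralMeasure, ← Measure.prod_restrict, Measure.restrict_univ]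
  rw [lateralMeasure_eq_restrict, h]
  exact Measure.restrict_mono (prod_mono le_rfl fun τ hτ => hs.trans_lt hτ.1) le_rfl

theorem boundaryIntegrand_nonneg (p₃ : ℝ) (p : Euc n × ℝ) : 0 ≤ boundaryIntegrand p₃ ψ₁ ψ₂ p := by
  unfold boundaryIntegrand
  positivity

/-- What the boundary condition on the data gives for one negative part on a time slab. -/
theorem negPart_bounds [IsFiniteMeasure (surfaceMeasure U)] {p₃ T : ℝ} (hp₃ : 1 < p₃)
    {ψ : Euc n → ℝ → ℝ}
    (hψ : AEMeasurable (fun p : Euc n × ℝ => ψ p.1 p.2) (globalLateralMeasure U))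
    (hb : Integrable (boundaryIntegrand p₃ ψ₁ ψ₂) (lateralMeasure U 0 T))
    (hle : ∀ p : Euc n × ℝ, max 0 (-ψ p.1 p.2) ^ conj p₃ ≤ boundaryIntegrand p₃ ψ₁ ψ₂ p)
    (h1 : 0 ≤ t₁) (h2 : t₂ ≤ T) :
    AEMeasurable (fun p : Euc n × ℝ => max 0 (-ψ p.1 p.2)) (lateralMeasure U t₁ t₂) ∧
    Integrable (fun p : Euc n × ℝ => max 0 (-ψ p.1 p.2)) (lateralMeasure U t₁ t₂) ∧
    ∫⁻ p, ENNReal.ofReal (max 0 (-ψ p.1 p.2) ^ conj p₃) ∂(lateralMeasure U t₁ t₂) ≤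
      ENNReal.ofReal (∫ p, boundaryIntegrand p₃ ψ₁ ψ₂ p ∂(lateralMeasure U 0 T)) := by
  have hm : AEMeasurable (fun p : Euc n × ℝ => max 0 (-ψ p.1 p.2)) (lateralMeasure U t₁ t₂) :=
    aemeasurable_const.max (hψ.mono_measure (lateralMeasure_le_global h1)).neg
  have hq : 1 < conj p₃ := (Real.HolderConjugate.conjExponent hp₃).symm.lt
  have : IsFiniteMeasure (lateralMeasure U t₁ t₂) := by unfold lateralMeasure; infer_instance
  refine ⟨hm, ?_, ?_⟩
  · refine Integrable.mono' ((integrable_const (1 : ℝ)).add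
      (hb.mono_measure (lateralMeasure_mono h1 h2))) hm.aestronglyMeasurable
      (Eventually.of_forall fun p => ?_)
    have h0 : 0 ≤ max 0 (-ψ p.1 p.2) := le_max_left _ _
    rw [Real.norm_of_nonneg h0]
    have h3 := rpow_le_one_add_rpow h0 zero_le_one hq.le
    rw [Real.rpow_one] at h3
    exact h3.trans (add_le_add le_rfl (hle p))
  · rw [ofReal_integral_eq_lintegral_ofReal hb
      (Eventually.of_forall fun p => boundaryIntegrand_nonneg p₃ p)]
    exact (lintegral_mono fun p => ENNReal.ofReal_le_ofReal (hle p)).trans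
      (lintegral_mono' (lateralMeasure_mono h1 h2) le_rfl)

theorem W₃_pos {x : Euc n} (h0 : 0 < W₀ x) (h1 : 0 < W₁ x) : 0 < W₃ a W₀ W₁ x := by
  unfold W₃; positivity

theorem W₁_le_W₃ {x : Euc n} (h0 : 0 < W₀ x) (h1 : 0 < W₁ x) : W₁ x ≤ W₃ a W₀ W₁ x := by
  unfold W₃
  have : 0 ≤ W₀ x ^ (2 - a) * W₁ x ^ (a - 1) := by positivity
  linarith

/-- The integrability conditions on the weights, one by one. -/
structure WeightsIntegrable (U : Set (Euc n)) (a p₁ p₂ p₄ p₅ : ℝ) (φ W₀ W₁ W₂ : Euc n → ℝ) :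
    Prop where
  phi : IntegrableOn φ U
  phi_neg : IntegrableOn (fun x => φ x ^ (-(conj p₄ / p₄))) U
  w₄ : IntegrableOn (fun x => W₄ a W₀ W₁ W₂ x ^ conj p₁ * φ x ^ (-(conj p₁ / p₁))) U
  w₃ : IntegrableOn (fun x => W₃ a W₀ W₁ x ^ conj p₂ * φ x ^ (-(conj p₂ / p₂))) U
  w₁ : IntegrableOn (fun x => W₁ x ^ (-(conj p₅ / (1 - a))) * φ x ^ (-(conj p₅ / p₅))) U
  meas₂ : AEMeasurable W₂ (volume.restrict U)
  meas₃ : AEMeasurable (W₃ a W₀ W₁) (volume.restrict U)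

/-- The summands of the assumed integrand are non-negative and measurable, so each is dominated by
the sum. -/
theorem weightsIntegrable {p₁ p₂ p₄ p₅ : ℝ} (hU : MeasurableSet U)
    (hφ0 : ∀ x ∈ U, 0 < φ x) (hφm : AEMeasurable φ (volume.restrict U))
    (hX : StructureConditions U a lam χ X W₀ W₁ W₂)
    (h : IntegrableOn (weightIntegrand a p₁ p₂ p₄ p₅ φ W₀ W₁ W₂) U) :
    WeightsIntegrable U a p₁ p₂ p₄ p₅ φ W₀ W₁ W₂ := by
  have m3 : AEMeasurable (W₃ a W₀ W₁) (volume.restrict U) :=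
    ((hX.meas₀.pow_const _).mul (hX.meas₁.pow_const _)).add hX.meas₁
  have m4 : AEMeasurable (W₄ a W₀ W₁ W₂) (volume.restrict U) := hX.meas₂.add m3
  have key : ∀ f : Euc n → ℝ, AEMeasurable f (volume.restrict U) → (∀ x ∈ U, 0 ≤ f x) →
      (∀ x ∈ U, f x ≤ weightIntegrand a p₁ p₂ p₄ p₅ φ W₀ W₁ W₂ x) → IntegrableOn f U := by
    intro f hf h0 hle
    refine Integrable.mono' h hf.aestronglyMeasurable ?_
    filter_upwards [ae_restrict_mem hU] with x hx
    rw [Real.norm_of_nonneg (h0 x hx)]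
    exact hle x hx
  have hpos : ∀ x ∈ U, 0 ≤ φ x ∧ 0 ≤ φ x ^ (-(conj p₄ / p₄)) ∧
      0 ≤ W₄ a W₀ W₁ W₂ x ^ conj p₁ * φ x ^ (-(conj p₁ / p₁)) ∧
      0 ≤ W₃ a W₀ W₁ x ^ conj p₂ * φ x ^ (-(conj p₂ / p₂)) ∧
      0 ≤ W₁ x ^ (-(conj p₅ / (1 - a))) * φ x ^ (-(conj p₅ / p₅)) := by
    intro x hx
    have k := hφ0 x hx
    have k1 := hX.pos₁ x (subset_closure hx)
    have k2 := hX.pos₂ x (subset_closure hx)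
    have k3 := W₃_pos (a := a) (hX.pos₀ x (subset_closure hx)) k1
    have k4 : 0 < W₄ a W₀ W₁ W₂ x := add_pos k2 k3
    refine ⟨by positivity, by positivity, by positivity, by positivity, by positivity⟩
  refine ⟨key _ hφm (fun x hx => (hpos x hx).1) ?_,
    key _ (hφm.pow_const _) (fun x hx => (hpos x hx).2.1) ?_,
    key _ ((m4.pow_const _).mul (hφm.pow_const _)) (fun x hx => (hpos x hx).2.2.1) ?_,
    key _ ((m3.pow_const _).mul (hφm.pow_const _)) (fun x hx => (hpos x hx).2.2.2.1) ?_,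
    key _ ((hX.meas₁.pow_const _).mul (hφm.pow_const _)) (fun x hx => (hpos x hx).2.2.2.2) ?_,
    hX.meas₂, m3⟩ <;>
  · intro x hx
    obtain ⟨k1, k2, k3, k4, k5⟩ := hpos x hx
    unfold weightIntegrand
    linarith

/-- Young's inequality for the product of fφ^(-1/p) and φ^(1/p) gives f ≤ f^q φ^(-q/p) + φ with q
conjugate to p. Plain integrability of the weights makes the integrals in the energy inequality
meaningful. -/
theorem integrableOn_of_weight {w : Euc n → ℝ} {p : ℝ} (hU : MeasurableSet U) (hp : 1 < p)
    (hφ0 : ∀ x ∈ U, 0 < φ x) (hφ : IntegrableOn φ U)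
    (hwm : AEMeasurable w (volume.restrict U)) {f : Euc n → ℝ} (hw0 : ∀ x ∈ U, 0 ≤ w x)
    (hwf : ∀ x ∈ U, w x ≤ f x)
    (hf : IntegrableOn (fun x => f x ^ conj p * φ x ^ (-(conj p / p))) U) : IntegrableOn w U := by
  have hpq : p.HolderConjugate (conj p) := Real.HolderConjugate.conjExponent hp
  have hp0 : 0 < p := by linarith
  have hq0 : 0 < conj p := hpq.symm.pos
  refine Integrable.mono' (hf.add hφ) hwm.aestronglyMeasurable ?_
  filter_upwards [ae_restrict_mem hU] with x hx
  have k := hφ0 x hx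
  have k0 := hw0 x hx
  have k1 : 0 ≤ f x := k0.trans (hwf x hx)
  rw [Real.norm_of_nonneg k0]
  have h := Real.young_inequality_of_nonneg (a := f x * φ x ^ (-(1 / p))) (b := φ x ^ (1 / p))
    (by positivity) (by positivity) hpq.symm
  have e1 : f x * φ x ^ (-(1 / p)) * φ x ^ (1 / p) = f x := by
    rw [mul_assoc, ← Real.rpow_add k]; simp
  have e2 : (f x * φ x ^ (-(1 / p))) ^ conj p = f x ^ conj p * φ x ^ (-(conj p / p)) := by
    rw [Real.mul_rpow k1 (by positivity), ← Real.rpow_mul k.le]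
    congr 2; ring
  have e3 : (φ x ^ (1 / p)) ^ p = φ x := by
    rw [← Real.rpow_mul k.le, one_div_mul_cancel hp0.ne', Real.rpow_one]
  rw [e1, e2, e3] at h
  calc w x ≤ f x := hwf x hx
    _ ≤ _ := h
    _ ≤ f x ^ conj p * φ x ^ (-(conj p / p)) + φ x :=
      add_le_add (div_le_self (by positivity) hpq.symm.lt.le) (div_le_self k.le hp.le)

theorem WeightsIntegrable.integrable_weights {p₁ p₂ p₄ p₅ : ℝ}
    (h : WeightsIntegrable U a p₁ p₂ p₄ p₅ φ W₀ W₁ W₂) (hU : MeasurableSet U) (hp₁ : 1 < p₁)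
    (hp₂ : 1 < p₂) (hφ0 : ∀ x ∈ U, 0 < φ x) (hX : StructureConditions U a lam χ X W₀ W₁ W₂) :
    IntegrableOn W₁ U ∧ IntegrableOn W₂ U ∧ IntegrableOn (W₃ a W₀ W₁) U := by
  have k0 := fun x (hx : x ∈ U) => hX.pos₀ x (subset_closure hx)
  have k1 := fun x (hx : x ∈ U) => hX.pos₁ x (subset_closure hx)
  have k2 := fun x (hx : x ∈ U) => hX.pos₂ x (subset_closure hx)
  have k3 := fun x (hx : x ∈ U) => W₃_pos (a := a) (k0 x hx) (k1 x hx)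
  exact ⟨integrableOn_of_weight hU hp₂ hφ0 h.phi hX.meas₁ (fun x hx => (k1 x hx).le)
      (fun x hx => W₁_le_W₃ (k0 x hx) (k1 x hx)) h.w₃,
    integrableOn_of_weight hU hp₁ hφ0 h.phi h.meas₂ (fun x hx => (k2 x hx).le)
      (fun x hx => le_add_of_nonneg_right (k3 x hx).le) h.w₄,
    integrableOn_of_weight hU hp₂ hφ0 h.phi h.meas₃ (fun x hx => (k3 x hx).le)
      (fun x hx => le_rfl) h.w₃⟩

/-- The consequences of `α > alphaThreshold` for the Hölder exponents. -/
theorem exponent_conditions {κ p₁ p₂ p₃ p₄ p₅ β : ℝ} (ha0 : 0 < a) (ha1 : a < 1)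
    (hlam : 0 < lam) (hp₁ : 1 < p₁) (hp₃ : 1 < p₃) (hp₄ : 1 < p₄) (hp₅ : 1 < p₅)
    (h1 : p₁ < κ) (h2 : p₂ < κ) (h34 : p₃ * p₄ < κ) (h6 : exponentP₆ a p₃ p₅ < κ)
    (hα : alphaThreshold a lam κ p₂ p₃ p₅ < α) (hβ2 : β ≤ α) :
    lam + 1 < α ∧ (α - lam - 1) * p₁ ≤ κ * α ∧ (α + lam * (5 - 4 * a) - 1) * p₂ ≤ κ * α ∧
      p₃ * β * p₄ ≤ κ * α ∧
      (((p₃ * β - 1) * (2 - a) - (α - lam - 1)) / (1 - a) + 2 * lam / (1 - a)) * p₅ ≤ κ * α := by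
  unfold alphaThreshold at hα
  rw [max_lt_iff, max_lt_iff] at hα
  obtain ⟨q1, q2, q3⟩ := hα
  have h1a : 0 < 1 - a := by linarith
  have hα0 : 0 < α := by linarith
  have k2 : 0 < κ - p₂ := by linarith
  have k6 : 0 < κ - exponentP₆ a p₃ p₅ := by linarith
  refine ⟨q1, by nlinarith, ?_, ?_, ?_⟩
  · rw [div_lt_iff₀ k2] at q2
    linarith
  · have : p₃ * β * p₄ ≤ p₃ * p₄ * α := by
      have : 0 ≤ p₃ * p₄ := by positivity
      nlinarith
    nlinarith
  · rw [div_lt_iff₀ (by positivity)] at q3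
    -- For β = α the condition reads p₅(α(p₃(2-a)-1) + a+3λ-1) ≤ (1-a)κα; solving it for α yields
    -- the third entry of the threshold, and p₆ < κ makes the coefficient of α positive.
    have e : (1 - a) * (κ - exponentP₆ a p₃ p₅) = (1 - a) * κ - p₅ * (p₃ * (2 - a) - 1) := by
      unfold exponentP₆; field_simp
    rw [e] at q3
    rw [← add_div, div_mul_eq_mul_div, div_le_iff₀ h1a]
    have : (p₃ * β * (2 - a)) * p₅ ≤ (p₃ * α * (2 - a)) * p₅ := by
      have : 0 < 2 - a := by linarith
      gcongr
    nlinarith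

/-! ### Assembling the absorbed energy estimate -/

/-- The part of the constant in the energy estimate which comes from one boundary term. -/
def boundaryConst (a lam p₃ C : ℝ) : ℝ :=
  C ^ (1 / p₃) + 2 ^ (2 * lam / (1 - a) * ((1 - a) / (p₃ * (2 - a) - 1)) + 1) *
    (C * p₃) ^ ((2 - a) / (p₃ * (2 - a) - 1)) * 16 ^ (1 / (p₃ * (2 - a) - 1))

/-- The constant in the energy estimate. -/
def energyConst (a lam cZ p₃ C : ℝ) : ℝ :=
  1 + 2 ^ (2 * lam * (1 - a) + 1) * cZ ^ (2 - a) + 2 * boundaryConst a lam p₃ C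

theorem boundaryConst_nonneg {p₃ C : ℝ} (hp₃ : 1 < p₃) (hC : 0 ≤ C) :
    0 ≤ boundaryConst a lam p₃ C := by
  unfold boundaryConst; positivity

theorem one_le_energyConst {p₃ C : ℝ} (hcZ : 0 < cZ) (hp₃ : 1 < p₃) (hC : 0 ≤ C) :
    1 ≤ energyConst a lam cZ p₃ C := by
  have := boundaryConst_nonneg (a := a) (lam := lam) hp₃ hC
  have : 0 ≤ (2 : ℝ) ^ (2 * lam * (1 - a) + 1) * cZ ^ (2 - a) := by positivity
  unfold energyConst; linarith

/-- The exponent γ is the larger of the two powers of χ that occur: the first comes from the drift,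
the second from the Young parameter, which contains χ^(-2). -/
theorem chi_rpow_bounds {p₃ : ℝ} (hχ : 1 ≤ χ) (ha0 : 0 < a) (ha1 : a < 1) (hp₃ : 1 < p₃) :
    1 ≤ χ ^ exponentγ a p₃ ∧ χ ^ (2 * (3 - 2 * a)) ≤ χ ^ exponentγ a p₃ ∧
      (χ ^ 2) ^ (1 / (p₃ * (2 - a) - 1)) ≤ χ ^ exponentγ a p₃ := by
  have hPm : 0 < p₃ * (2 - a) - 1 := by nlinarith
  have hle : 2 * (3 - 2 * a) ≤ exponentγ a p₃ := by
    unfold exponentγ; linarith [le_max_left (3 - 2 * a) (1 / (p₃ * (2 - a) - 1))]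
  refine ⟨Real.one_le_rpow hχ (by linarith), Real.rpow_le_rpow_of_exponent_le hχ hle, ?_⟩
  rw [← Real.rpow_natCast, ← Real.rpow_mul (by linarith)]
  refine Real.rpow_le_rpow_of_exponent_le hχ ?_
  unfold exponentγ
  push_cast
  linarith [le_max_right (3 - 2 * a) (1 / (p₃ * (2 - a) - 1))]

/-- One boundary term, after absorption, in the form used in the energy estimate. -/
theorem boundary_term_le {β p₃ C D J₄ J₅ Ψ N E B s d S Y : ℝ}
    (ha0 : 0 < a) (ha1 : a < 1) (hlam : 0 < lam) (hχ : 1 ≤ χ) (hp₃ : 1 < p₃) (hα : lam + 1 < α)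
    (hβ1 : α - lam ≤ β) (hβ2 : β ≤ α) (hC : 0 ≤ C) (hD : 1 ≤ D) (hJ₄ : 0 ≤ J₄) (hJ₅ : 0 ≤ J₅)
    (hΨ : 0 ≤ Ψ) (hN : 0 ≤ N) (hE : 0 ≤ E)
    (hs : s = ((p₃ * β - 1) * (2 - a) - (α - lam - 1)) / (1 - a)) (hd : d = 2 * lam / (1 - a))
    (hS : S = N ^ (α - h₁ lam) + N ^ (α + h₂ a lam p₃))
    (hB : B ≤ Ψ ^ (1 / conj p₃) * (C * (D * J₄ * N ^ (p₃ * β) + p₃ * β * (E ^ (1 / (2 - a)) *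
      (2 ^ d * (D * J₅ * (N ^ s + N ^ (s + d)))) ^ ((1 - a) / (2 - a))))) ^ (1 / p₃))
    (hY : D * (1 + J₄ ^ (1 / p₃) + J₅ ^ ((1 - a) / (p₃ * (2 - a) - 1))) *
        (1 + Ψ ^ (p₃ * (2 - a) / (conj p₃ * (p₃ * (2 - a) - 1)))) * S ≤ Y) :
    B ≤ (α - lam) / (16 * χ ^ 2) * E +
      boundaryConst a lam p₃ C * (χ ^ exponentγ a p₃ * α ^ ((2 - a) / (1 - a)) * Y) := by
  have hχ0 : 0 < χ := by linarith
  have hβ0 : 0 < α - lam := by linarith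
  have h1a : 0 < 1 - a := by linarith
  have hε : 0 < (α - lam) / (16 * χ ^ 2) := by positivity
  have hPm : 0 < p₃ * (2 - a) - 1 := by nlinarith
  have h := boundary_absorption ha0 ha1 hlam hp₃ hα hβ1 hβ2 hC hD hJ₄ hJ₅ hΨ hN hE hε hs hd hS hB
  obtain ⟨g1, -, g3⟩ := chi_rpow_bounds hχ ha0 ha1 hp₃
  have hαe : 1 ≤ α ^ ((2 - a) / (1 - a)) :=
    Real.one_le_rpow (by linarith) (div_nonneg (by linarith) h1a.le)
  -- Since α-λ ≥ 1, the negative power of ε is bounded by a power of 16χ², without dependence on α.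
  have hεe : ((α - lam) / (16 * χ ^ 2)) ^ (-(1 / (p₃ * (2 - a) - 1))) ≤
      16 ^ (1 / (p₃ * (2 - a) - 1)) * χ ^ exponentγ a p₃ := by
    rw [Real.rpow_neg hε.le, ← Real.inv_rpow hε.le, inv_div]
    have h16 : 16 * χ ^ 2 / (α - lam) ≤ 16 * χ ^ 2 :=
      div_le_self (by positivity) (by linarith)
    refine (Real.rpow_le_rpow (by positivity) h16 (by positivity)).trans ?_
    rw [Real.mul_rpow (by norm_num) (by positivity)]
    exact mul_le_mul_of_nonneg_left g3 (by positivity)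
  have hS0 : 0 ≤ S := by rw [hS]; positivity
  have hD0 : 0 < D := by linarith
  have hY0 : 0 ≤ D * (1 + J₄ ^ (1 / p₃) + J₅ ^ ((1 - a) / (p₃ * (2 - a) - 1))) *
        (1 + Ψ ^ (p₃ * (2 - a) / (conj p₃ * (p₃ * (2 - a) - 1)))) * S := by positivity
  have hC1 : 0 ≤ C ^ (1 / p₃) := by positivity
  have hC2 : 0 ≤ (2 : ℝ) ^ (d * ((1 - a) / (p₃ * (2 - a) - 1)) + 1) *
    (C * p₃) ^ ((2 - a) / (p₃ * (2 - a) - 1)) := by positivity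
  unfold boundaryConst
  rw [← hd]
  have hcoef : C ^ (1 / p₃) + 2 ^ (d * ((1 - a) / (p₃ * (2 - a) - 1)) + 1) *
      (C * p₃) ^ ((2 - a) / (p₃ * (2 - a) - 1)) *
        ((α - lam) / (16 * χ ^ 2)) ^ (-(1 / (p₃ * (2 - a) - 1))) * α ^ ((2 - a) / (1 - a)) ≤
      (C ^ (1 / p₃) + 2 ^ (d * ((1 - a) / (p₃ * (2 - a) - 1)) + 1) *
        (C * p₃) ^ ((2 - a) / (p₃ * (2 - a) - 1)) * 16 ^ (1 / (p₃ * (2 - a) - 1))) *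
        (χ ^ exponentγ a p₃ * α ^ ((2 - a) / (1 - a))) := by
    generalize χ ^ exponentγ a p₃ = x₁ at *
    generalize α ^ ((2 - a) / (1 - a)) = x₂ at *
    generalize (2 : ℝ) ^ (d * ((1 - a) / (p₃ * (2 - a) - 1)) + 1) *
      (C * p₃) ^ ((2 - a) / (p₃ * (2 - a) - 1)) = x₃ at *
    generalize ((α - lam) / (16 * χ ^ 2)) ^ (-(1 / (p₃ * (2 - a) - 1))) = x₄ at *
    generalize (16 : ℝ) ^ (1 / (p₃ * (2 - a) - 1)) = x₅ at *
    generalize C ^ (1 / p₃) = x₆ at *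
    have hx12 : 1 ≤ x₁ * x₂ := one_le_mul_of_one_le_of_one_le g1 hαe
    calc x₆ + x₃ * x₄ * x₂ ≤ x₆ * (x₁ * x₂) + x₃ * (x₅ * x₁) * x₂ := by
          refine add_le_add (le_mul_of_one_le_right hC1 hx12) ?_
          exact mul_le_mul_of_nonneg_right (mul_le_mul_of_nonneg_left hεe hC2) (by linarith)
      _ = _ := by ring
  refine h.trans (add_le_add le_rfl ?_)
  rw [← mul_assoc (_ + _) (_ * _) Y]
  refine le_trans ?_ (mul_le_mul hcoef hY hY0 (by positivity))
  exact le_of_eq (by ring)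

theorem source_term_le {R p₁ p₂ p₃ p₄ p₅ T N : ℝ}
    (hU : MeasurableSet U) (hlam : 0 < lam) (hα : lam + 1 < α)
    (hφ0 : ∀ x ∈ U, 0 < φ x) (hW : WeightsIntegrable U a p₁ p₂ p₄ p₅ φ W₀ W₁ W₂)
    (hX : StructureConditions U a lam χ X W₀ W₁ W₂) (h1 : 0 < t₁) (h12 : t₁ < t₂) (h2T : t₂ ≤ T)
    (hv : IsSlabModel U u t₁ t₂ v K M) (hθ : IsTimeCutoff θ Kθ t₁ t₂) (hN0 : 0 ≤ N)
    (hN : ∫⁻ p, ENNReal.ofReal (v p ^ R * φ p.1) ∂(cylinderMeasure U t₁ t₂) ≤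
      ENNReal.ofReal (N ^ R)) (hR : 0 < R)
    (hp₁ : 1 < p₁) (hc : (α - lam - 1) * p₁ ≤ R) :
    ∫ p, W₂ p.1 * (θ p.2 * v p ^ (α - lam - 1)) ∂(cylinderMeasure U t₁ t₂) ≤
      (1 + T) * (1 + ∫ x in U, φ x) *
        (∫ x in U, W₄ a W₀ W₁ W₂ x ^ conj p₁ * φ x ^ (-(conj p₁ / p₁))) ^ (1 / conj p₁) *
        (N ^ (α - h₁ lam) + N ^ (α + h₂ a lam p₃)) := by
  have k0 := fun x (hx : x ∈ U) => hX.pos₀ x (subset_closure hx)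
  have k1 := fun x (hx : x ∈ U) => hX.pos₁ x (subset_closure hx)
  have k2 := fun x (hx : x ∈ U) => hX.pos₂ x (subset_closure hx)
  have k3 := fun x (hx : x ∈ U) => W₃_pos (a := a) (k0 x hx) (k1 x hx)
  have k4 : ∀ x ∈ U, 0 < W₄ a W₀ W₁ W₂ x := fun x hx => add_pos (k2 x hx) (k3 x hx)
  have hvm := hv.lipschitz.continuous.measurable
  have hT : 0 < T := by linarith
  have hΦ : 0 ≤ ∫ x in U, φ x := setIntegral_nonneg hU fun x hx => (hφ0 x hx).le
  have hI1 : 0 ≤ ∫ x in U, W₄ a W₀ W₁ W₂ x ^ conj p₁ * φ x ^ (-(conj p₁ / p₁)) :=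
    setIntegral_nonneg hU fun x hx => mul_nonneg (Real.rpow_nonneg (k4 x hx).le _)
      (Real.rpow_nonneg (hφ0 x hx).le _)
  have hlo : 0 < α - h₁ lam := by unfold h₁; linarith
  have hh2a : 0 ≤ h₂ a lam p₃ := le_max_left _ _
  set S := N ^ (α - h₁ lam) + N ^ (α + h₂ a lam p₃) with hS
  have hS0 : 0 ≤ S := by positivity
  have h := lintegral_weight_mul_rpow_le (w := W₄ a W₀ W₁ W₂) (p := p₁) (s := α - lam - 1) hU
    hW.phi hφ0 (fun x hx => (k4 x hx).le) hW.w₄ h1.le h12 h2T hvm hv.nonneg hN0 hN hR hp₁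
    (by linarith) hc
  have hNS : N ^ (α - lam - 1) ≤ S := by
    rw [hS]; exact rpow_le_add_rpow hN0 hlo (by unfold h₁; linarith) (by linarith)
  refine integral_le_of_lintegral_ofReal_le ?_ (by positivity) ?_
  · filter_upwards [ae_cylinder hU t₁ t₂] with p hp
    exact mul_nonneg (k2 p.1 hp.1).le (mul_nonneg (hθ.nonneg _) (Real.rpow_nonneg (hv.nonneg p) _))
  · refine (lintegral_mono_ae ?_).trans (h.trans (ENNReal.ofReal_le_ofReal (by gcongr)))
    filter_upwards [ae_cylinder hU t₁ t₂] with p hp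
    refine ENNReal.ofReal_le_ofReal (mul_le_mul (le_add_of_nonneg_right (k3 p.1 hp.1).le)
      (mul_le_of_le_one_left (Real.rpow_nonneg (hv.nonneg p) _) (hθ.le_one _))
      (mul_nonneg (hθ.nonneg _) (Real.rpow_nonneg (hv.nonneg p) _)) (k4 p.1 hp.1).le)

/-- The integrand has v-exponents between α-λ-1+2λ(2-a) and, once (1+v)^(2λ(1-a)) is expanded,
α+λ(5-4a)-1. The larger one gives the second entry of `h₂` and, through p₂, the second entry of the
threshold. -/
theorem drift_term_le {R p₁ p₂ p₃ p₄ p₅ T N : ℝ}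
    (hU : MeasurableSet U) (ha1 : a < 1) (hlam : 0 < lam) (hα : lam + 1 < α)
    (hφ0 : ∀ x ∈ U, 0 < φ x) (hW : WeightsIntegrable U a p₁ p₂ p₄ p₅ φ W₀ W₁ W₂)
    (hX : StructureConditions U a lam χ X W₀ W₁ W₂) (h1 : 0 < t₁) (h12 : t₁ < t₂) (h2T : t₂ ≤ T)
    (hv : IsSlabModel U u t₁ t₂ v K M) (hθ : IsTimeCutoff θ Kθ t₁ t₂) (hN0 : 0 ≤ N)
    (hN : ∫⁻ p, ENNReal.ofReal (v p ^ R * φ p.1) ∂(cylinderMeasure U t₁ t₂) ≤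
      ENNReal.ofReal (N ^ R)) (hR : 0 < R)
    (hp₂ : 1 < p₂) (hc : (α + lam * (5 - 4 * a) - 1) * p₂ ≤ R) :
    ∫ p, W₃ a W₀ W₁ p.1 * (θ p.2 * (v p ^ (α - lam - 1) *
          ((1 + v p) ^ (2 * lam * (1 - a)) * v p ^ (2 * lam * (2 - a)))))
        ∂(cylinderMeasure U t₁ t₂) ≤
      2 ^ (2 * lam * (1 - a)) * ((1 + T) * (1 + ∫ x in U, φ x) *
        (∫ x in U, W₃ a W₀ W₁ x ^ conj p₂ * φ x ^ (-(conj p₂ / p₂))) ^ (1 / conj p₂) *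
          (2 * (N ^ (α - h₁ lam) + N ^ (α + h₂ a lam p₃)))) := by
  have k0 := fun x (hx : x ∈ U) => hX.pos₀ x (subset_closure hx)
  have k1 := fun x (hx : x ∈ U) => hX.pos₁ x (subset_closure hx)
  have k3 := fun x (hx : x ∈ U) => W₃_pos (a := a) (k0 x hx) (k1 x hx)
  have hvm := hv.lipschitz.continuous.measurable
  have hT : 0 < T := by linarith
  have hΦ : 0 ≤ ∫ x in U, φ x := setIntegral_nonneg hU fun x hx => (hφ0 x hx).le
  have h1a : 0 < 1 - a := by linarith
  have hI2 : 0 ≤ ∫ x in U, W₃ a W₀ W₁ x ^ conj p₂ * φ x ^ (-(conj p₂ / p₂)) :=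
    setIntegral_nonneg hU fun x hx => mul_nonneg (Real.rpow_nonneg (k3 x hx).le _)
      (Real.rpow_nonneg (hφ0 x hx).le _)
  have hh2b : lam * (5 - 4 * a) - 1 ≤ h₂ a lam p₃ :=
    (le_max_left _ _).trans (le_max_right _ _)
  have hlo : 0 < α - h₁ lam := by unfold h₁; linarith
  have hh2a : 0 ≤ h₂ a lam p₃ := le_max_left _ _
  set S := N ^ (α - h₁ lam) + N ^ (α + h₂ a lam p₃) with hS
  have hS0 : 0 ≤ S := by positivity
  have hla : 0 < lam * (2 - a) := mul_pos hlam (by linarith)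
  have hlb : 0 < lam * (1 - a) := mul_pos hlam h1a
  have es : α - lam - 1 + 2 * lam * (2 - a) + 2 * lam * (1 - a) = α + lam * (5 - 4 * a) - 1 := by
    ring
  have h := lintegral_weight_mul_one_add_rpow_le (w := W₃ a W₀ W₁) (p := p₂)
    (s := α - lam - 1 + 2 * lam * (2 - a)) (d := 2 * lam * (1 - a)) hU hW.meas₃
    hW.phi hφ0 (fun x hx => (k3 x hx).le) hW.w₃ h1.le h12 h2T hvm hv.nonneg hN0 hN hR hp₂
    (by linarith) (by linarith) (by rw [es]; exact hc)
  rw [es] at h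
  have hNS1 : N ^ (α - lam - 1 + 2 * lam * (2 - a)) ≤ S := by
    rw [hS]; exact rpow_le_add_rpow hN0 hlo (by unfold h₁; linarith) (by linarith)
  have hNS2 : N ^ (α + lam * (5 - 4 * a) - 1) ≤ S := by
    rw [hS]; exact rpow_le_add_rpow hN0 hlo (by unfold h₁; linarith) (by linarith)
  have hNS : N ^ (α - lam - 1 + 2 * lam * (2 - a)) + N ^ (α + lam * (5 - 4 * a) - 1) ≤ 2 * S := by
    linarith
  refine integral_le_of_lintegral_ofReal_le ?_ (by positivity) ?_
  · filter_upwards [ae_cylinder hU t₁ t₂] with p hp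
    have := hv.nonneg p
    have := hθ.nonneg p.2
    have := (k3 p.1 hp.1).le
    show 0 ≤ _
    positivity
  · refine (lintegral_mono_ae ?_).trans (h.trans (ENNReal.ofReal_le_ofReal (by gcongr)))
    filter_upwards [ae_cylinder hU t₁ t₂] with p hp
    have g0 := hv.nonneg p
    refine ENNReal.ofReal_le_ofReal (mul_le_mul_of_nonneg_left ?_ (k3 p.1 hp.1).le)
    refine (mul_le_of_le_one_left (by positivity) (hθ.le_one _)).trans (le_of_eq ?_)
    rw [Real.rpow_add_of_nonneg g0 (by linarith) (by linarith)]
    ring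

/-- Collecting the terms of the energy inequality. -/
theorem collect_energy_terms {p₃ C E I₂ I₃ B₁ B₂ G Y : ℝ} (ha0 : 0 < a) (ha1 : a < 1)
    (hlam : 0 < lam) (hχ : 1 ≤ χ) (hcZ : 0 < cZ) (hp₃ : 1 < p₃) (hα : lam + 1 < α) (hY0 : 0 ≤ Y)
    (hI₂ : I₂ ≤ Y) (hI₃ : I₃ ≤ 2 ^ (2 * lam * (1 - a)) * (2 * Y))
    (hB₁ : B₁ ≤ (α - lam) / (16 * χ ^ 2) * E +
      boundaryConst a lam p₃ C * (χ ^ exponentγ a p₃ * α ^ ((2 - a) / (1 - a)) * Y))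
    (hB₂ : B₂ ≤ (α - lam) / (16 * χ ^ 2) * E +
      boundaryConst a lam p₃ C * (χ ^ exponentγ a p₃ * α ^ ((2 - a) / (1 - a)) * Y))
    (h : (α - lam) / (4 * χ ^ 2) * E ≤ G + ((α - lam) * I₂) +
      ((α - lam) * (cZ ^ (2 - a) * χ ^ (2 * (3 - 2 * a))) * I₃) + (B₁ + B₂)) :
    (α - lam) / (8 * χ ^ 2) * E ≤ G + energyConst a lam cZ p₃ C *
      (χ ^ exponentγ a p₃ * α ^ ((2 - a) / (1 - a)) * Y) := by
  have h1a : 0 < 1 - a := by linarith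
  obtain ⟨g1, g2, -⟩ := chi_rpow_bounds hχ ha0 ha1 hp₃
  have hαe : α ≤ α ^ ((2 - a) / (1 - a)) := by
    calc α = α ^ (1 : ℝ) := (Real.rpow_one α).symm
      _ ≤ _ := Real.rpow_le_rpow_of_exponent_le (by linarith)
        (by rw [le_div_iff₀ h1a]; linarith)
  have hβ0 : 0 < α - lam := by linarith
  have hχ0 : 0 < χ := by linarith
  have f1 : (α - lam) * I₂ ≤ χ ^ exponentγ a p₃ * α ^ ((2 - a) / (1 - a)) * Y := by
    calc _ ≤ (α - lam) * Y := mul_le_mul_of_nonneg_left hI₂ hβ0.le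
      _ ≤ (1 * α ^ ((2 - a) / (1 - a))) * Y := by
        rw [one_mul]; exact mul_le_mul_of_nonneg_right (by linarith) hY0
      _ ≤ _ := mul_le_mul_of_nonneg_right (mul_le_mul_of_nonneg_right g1 (by linarith)) hY0
  have f2 : (α - lam) * (cZ ^ (2 - a) * χ ^ (2 * (3 - 2 * a))) * I₃ ≤
      2 ^ (2 * lam * (1 - a) + 1) * cZ ^ (2 - a) *
        (χ ^ exponentγ a p₃ * α ^ ((2 - a) / (1 - a)) * Y) := by
    have i : (2 : ℝ) ^ (2 * lam * (1 - a) + 1) = 2 ^ (2 * lam * (1 - a)) * 2 := by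
      rw [Real.rpow_add (by norm_num), Real.rpow_one]
    calc _ ≤ (α - lam) * (cZ ^ (2 - a) * χ ^ (2 * (3 - 2 * a))) *
          (2 ^ (2 * lam * (1 - a)) * (2 * Y)) := mul_le_mul_of_nonneg_left hI₃ (by positivity)
      _ = 2 ^ (2 * lam * (1 - a) + 1) * cZ ^ (2 - a) *
          (χ ^ (2 * (3 - 2 * a)) * (α - lam) * Y) := by rw [i]; ring
      _ ≤ _ := by
        refine mul_le_mul_of_nonneg_left (mul_le_mul_of_nonneg_right ?_ hY0) (by positivity)
        exact mul_le_mul g2 (by linarith) hβ0.le (by linarith)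
  -- Each of the two boundary terms consumes one sixteenth, so 1/4 - 2/16 = 1/8 of the energy
  -- remains.
  have e8 : (α - lam) / (4 * χ ^ 2) * E = (α - lam) / (8 * χ ^ 2) * E +
      2 * ((α - lam) / (16 * χ ^ 2) * E) := by
    field_simp; ring
  rw [e8] at h
  unfold energyConst
  linarith

/-- The energy estimate for a general time cut-off, with the boundary terms absorbed. -/
theorem absorbed_energy {κ p₁ p₂ p₃ p₄ p₅ T N : ℝ} {C : NNReal}
    (hU : IsOpen U) [IsFiniteMeasure (surfaceMeasure U)]
    (hC : ∀ (L : NNReal) (f : Euc n → ℝ), LipschitzWith L f →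
      ∫⁻ x, ENNReal.ofReal (f x) ∂(surfaceMeasure U) ≤
        C * ∫⁻ x in U, (ENNReal.ofReal (f x) + ENNReal.ofReal ‖gradient f x‖))
    (ha0 : 0 < a) (ha1 : a < 1) (hlam : 0 < lam) (hχ : 1 ≤ χ) (hcZ : 0 < cZ)
    (hκ : 1 < κ) (hp₁ : 1 < p₁) (hp₂ : 1 < p₂) (hp₃ : 1 < p₃) (hp₄ : 1 < p₄) (hp₅ : 1 < p₅)
    (h1κ : p₁ < κ) (h2κ : p₂ < κ) (h34κ : p₃ * p₄ < κ) (h6κ : exponentP₆ a p₃ p₅ < κ)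
    (hα' : alphaThreshold a lam κ p₂ p₃ p₅ < α) (hφ0 : ∀ x ∈ U, 0 < φ x)
    (hW : WeightsIntegrable U a p₁ p₂ p₄ p₅ φ W₀ W₁ W₂)
    (hX : StructureConditions U a lam χ X W₀ W₁ W₂)
    (hZ : ∀ x ∈ closure U, ∀ t : ℝ, 0 < t → ‖Z x t‖ ≤ cZ * χ ^ 2)
    (hψ₁ : AEMeasurable (fun p : Euc n × ℝ => ψ₁ p.1 p.2) (globalLateralMeasure U))
    (hψ₂ : AEMeasurable (fun p : Euc n × ℝ => ψ₂ p.1 p.2) (globalLateralMeasure U))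
    (hb : Integrable (boundaryIntegrand p₃ ψ₁ ψ₂) (lateralMeasure U 0 T))
    (hsol : IsSolution U lam φ X Z u₀ ψ₁ ψ₂ u)
    (h1 : 0 < t₁) (h12 : t₁ < t₂) (h2T : t₂ ≤ T)
    (hv : IsSlabModel U u t₁ t₂ v K M) (hθ : IsTimeCutoff θ Kθ t₁ t₂) (hN0 : 0 ≤ N)
    (hN : ∫⁻ p, ENNReal.ofReal (v p ^ (κ * α) * φ p.1) ∂(cylinderMeasure U t₁ t₂) ≤
      ENNReal.ofReal (N ^ (κ * α))) :
    (α - lam) / (8 * χ ^ 2) *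
        (∫ p, W₁ p.1 * (θ p.2 * energyDensity a lam α v p) ∂(cylinderMeasure U t₁ t₂)) ≤
      lam / α * (∫ p, φ p.1 * (v p ^ α * deriv θ p.2) ∂(cylinderMeasure U t₁ t₂)) +
      energyConst a lam cZ p₃ C * (χ ^ exponentγ a p₃ * α ^ ((2 - a) / (1 - a)) *
        ((1 + T) * weightQuantity U a p₁ p₂ p₃ p₄ p₅ φ W₀ W₁ W₂ *
          boundaryQuantity U a p₃ T ψ₁ ψ₂ *
          (N ^ (α - h₁ lam) + N ^ (α + h₂ a lam p₃)))) := by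
  obtain ⟨hα, hc1, hc2, hc4, hc5⟩ := exponent_conditions ha0 ha1 hlam hp₁ hp₃ hp₄ hp₅ h1κ h2κ h34κ
    h6κ hα' (le_refl α)
  obtain ⟨-, -, -, hc4', hc5'⟩ := exponent_conditions (β := α - lam) ha0 ha1 hlam hp₁ hp₃ hp₄ hp₅
    h1κ h2κ h34κ h6κ hα' (by linarith)
  have hUm := hU.measurableSet
  obtain ⟨hW₁, hW₂, hW₃⟩ := hW.integrable_weights hUm hp₁ hp₂ hφ0 hX
  have hq3 : conj p₃ ≠ 0 := (Real.HolderConjugate.conjExponent hp₃).symm.pos.ne'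
  obtain ⟨m1, i1, l1⟩ := negPart_bounds hp₃ hψ₁ hb (fun p => by
    unfold boundaryIntegrand
    exact le_add_of_nonneg_right (by positivity)) h1.le h2T
  obtain ⟨m2, i2, l2⟩ := negPart_bounds hp₃ hψ₂ hb (fun p => by
    unfold boundaryIntegrand
    exact le_add_of_nonneg_left (by positivity)) h1.le h2T
  have hEI := energy_inequality hU ha0 ha1 hlam hχ hcZ hW.phi hW₁ hW₂ hW₃ hX hZ hsol h1 h12 hα
    i1 i2 hv hθ
  have k0 := fun x (hx : x ∈ U) => hX.pos₀ x (subset_closure hx)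
  have k1 := fun x (hx : x ∈ U) => hX.pos₁ x (subset_closure hx)
  have k2 := fun x (hx : x ∈ U) => hX.pos₂ x (subset_closure hx)
  have k3 := fun x (hx : x ∈ U) => W₃_pos (a := a) (k0 x hx) (k1 x hx)
  have k4 : ∀ x ∈ U, 0 < W₄ a W₀ W₁ W₂ x := fun x hx => add_pos (k2 x hx) (k3 x hx)
  have hvm := hv.lipschitz.continuous.measurable
  have hα0 : 0 < α := by linarith
  have hR : 0 < κ * α := by positivity
  have hT : 0 < T := by linarith
  have h1a : 0 < 1 - a := by linarith
  have hΨ0 : 0 ≤ ∫ p, boundaryIntegrand p₃ ψ₁ ψ₂ p ∂(lateralMeasure U 0 T) :=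
    integral_nonneg fun p => boundaryIntegrand_nonneg p₃ p
  have hΦ : 0 ≤ ∫ x in U, φ x := setIntegral_nonneg hUm fun x hx => (hφ0 x hx).le
  have hI1 : 0 ≤ ∫ x in U, W₄ a W₀ W₁ W₂ x ^ conj p₁ * φ x ^ (-(conj p₁ / p₁)) :=
    setIntegral_nonneg hUm fun x hx => mul_nonneg (Real.rpow_nonneg (k4 x hx).le _)
      (Real.rpow_nonneg (hφ0 x hx).le _)
  have hI2 : 0 ≤ ∫ x in U, W₃ a W₀ W₁ x ^ conj p₂ * φ x ^ (-(conj p₂ / p₂)) :=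
    setIntegral_nonneg hUm fun x hx => mul_nonneg (Real.rpow_nonneg (k3 x hx).le _)
      (Real.rpow_nonneg (hφ0 x hx).le _)
  have hI4 : 0 ≤ ∫ x in U, φ x ^ (-(conj p₄ / p₄)) := setIntegral_nonneg hUm fun x hx =>
    Real.rpow_nonneg (hφ0 x hx).le _
  have hI5 : 0 ≤ ∫ x in U, W₁ x ^ (-(conj p₅ / (1 - a))) * φ x ^ (-(conj p₅ / p₅)) :=
    setIntegral_nonneg hUm fun x hx => mul_nonneg (Real.rpow_nonneg (k1 x hx).le _)
      (Real.rpow_nonneg (hφ0 x hx).le _)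
  have hlo : 0 < α - h₁ lam := by unfold h₁; linarith
  have hh2a : 0 ≤ h₂ a lam p₃ := le_max_left _ _
  have hh2b : lam * (5 - 4 * a) - 1 ≤ h₂ a lam p₃ :=
    (le_max_left _ _).trans (le_max_right _ _)
  set S := N ^ (α - h₁ lam) + N ^ (α + h₂ a lam p₃) with hS
  have hS0 : 0 ≤ S := by positivity
  have b1 := source_term_le (p₃ := p₃) hUm hlam hα hφ0 hW hX h1 h12 h2T hv hθ hN0 hN hR hp₁ hc1
  have b2 := drift_term_le (p₃ := p₃) hUm ha1 hlam hα hφ0 hW hX h1 h12 h2T hv hθ hN0 hN hR hp₂ hc2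
  rw [← hS] at b1 b2
  set E := ∫ p, W₁ p.1 * (θ p.2 * energyDensity a lam α v p) ∂(cylinderMeasure U t₁ t₂) with hE
  have hE0 : 0 ≤ E := integral_nonneg_of_ae (ae_energy_nonneg hUm hv hθ k1)
  -- The boundary bound is used twice: with β = α-λ for ψ₁⁻ and with β = α for ψ₂⁻.
  have L1 := lateral_integral_le (s := ((p₃ * (α - lam) - 1) * (2 - a) - (α - lam - 1)) / (1 - a))
    (d := 2 * lam / (1 - a)) hU hC hv hθ m1 (fun p => le_max_left _ _) hΨ0 l1
    ha0 ha1 hlam hα hp₃ hp₄ hp₅ hW.phi hφ0 k1 hW₁ hW.phi_neg hW.w₁ h1.le h12 h2T hN0 hN hR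
    le_rfl rfl rfl hc4' hc5'
  have L2 := lateral_integral_le (s := ((p₃ * α - 1) * (2 - a) - (α - lam - 1)) / (1 - a))
    (d := 2 * lam / (1 - a)) hU hC hv hθ m2 (fun p => le_max_left _ _) hΨ0 l2
    ha0 ha1 hlam hα hp₃ hp₄ hp₅ hW.phi hφ0 k1 hW₁ hW.phi_neg hW.w₁ h1.le h12 h2T hN0 hN hR
    (by linarith) rfl rfl hc4 hc5
  rw [← hE] at L1 L2
  set ΨT := boundaryQuantity U a p₃ T ψ₁ ψ₂ with hΨT
  have hΨT1 : 1 ≤ ΨT := by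
    rw [hΨT, boundaryQuantity]
    exact le_add_of_nonneg_right (Real.rpow_nonneg hΨ0 _)
  set N1 := weightQuantity U a p₁ p₂ p₃ p₄ p₅ φ W₀ W₁ W₂ with hN1
  -- The iterated roots coming from Hölder, trace and Young are merged into the single exponents of
  -- the weight quantity.
  have hN1e : N1 = (1 + ∫ x in U, φ x) *
    (1 + (∫ x in U, W₄ a W₀ W₁ W₂ x ^ conj p₁ * φ x ^ (-(conj p₁ / p₁))) ^ (1 / conj p₁)
      + (∫ x in U, W₃ a W₀ W₁ x ^ conj p₂ * φ x ^ (-(conj p₂ / p₂))) ^ (1 / conj p₂)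
      + ((∫ x in U, φ x ^ (-(conj p₄ / p₄))) ^ (1 / conj p₄)) ^ (1 / p₃)
      + ((∫ x in U, W₁ x ^ (-(conj p₅ / (1 - a))) * φ x ^ (-(conj p₅ / p₅))) ^ (1 / conj p₅))
          ^ ((1 - a) / (p₃ * (2 - a) - 1))) := by
    rw [hN1, weightQuantity, ← Real.rpow_mul hI4, ← Real.rpow_mul hI5, div_mul_div_comm,
      div_mul_div_comm, one_mul, one_mul, mul_comm (conj p₄)]
  set Φ := ∫ x in U, φ x with hΦdef
  set J₁ := (∫ x in U, W₄ a W₀ W₁ W₂ x ^ conj p₁ * φ x ^ (-(conj p₁ / p₁))) ^ (1 / conj p₁)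
    with hJ1
  set J₂ := (∫ x in U, W₃ a W₀ W₁ x ^ conj p₂ * φ x ^ (-(conj p₂ / p₂))) ^ (1 / conj p₂) with hJ2
  set J₄ := (∫ x in U, φ x ^ (-(conj p₄ / p₄))) ^ (1 / conj p₄) with hJ4
  set J₅ := (∫ x in U, W₁ x ^ (-(conj p₅ / (1 - a))) * φ x ^ (-(conj p₅ / p₅))) ^ (1 / conj p₅)
    with hJ5
  have hJ10 : 0 ≤ J₁ := Real.rpow_nonneg hI1 _
  have hJ20 : 0 ≤ J₂ := Real.rpow_nonneg hI2 _
  have hJ40 : 0 ≤ J₄ := Real.rpow_nonneg hI4 _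
  have hJ50 : 0 ≤ J₅ := Real.rpow_nonneg hI5 _
  have n4 : 0 ≤ J₄ ^ (1 / p₃) := Real.rpow_nonneg hJ40 _
  have n5 : 0 ≤ J₅ ^ ((1 - a) / (p₃ * (2 - a) - 1)) := Real.rpow_nonneg hJ50 _
  have hD1 : 1 ≤ (1 + T) * (1 + Φ) := one_le_mul_of_one_le_of_one_le (by linarith) (by linarith)
  set Y := (1 + T) * N1 * ΨT * S with hY
  have hYb : (1 + T) * (1 + Φ) * (1 + J₄ ^ (1 / p₃) + J₅ ^ ((1 - a) / (p₃ * (2 - a) - 1))) *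
      (1 + (∫ p, boundaryIntegrand p₃ ψ₁ ψ₂ p ∂(lateralMeasure U 0 T)) ^
        (p₃ * (2 - a) / (conj p₃ * (p₃ * (2 - a) - 1)))) * S ≤ Y := by
    change (1 + T) * (1 + Φ) * (1 + J₄ ^ (1 / p₃) + J₅ ^ ((1 - a) / (p₃ * (2 - a) - 1))) *
      ΨT * S ≤ Y
    rw [hY, hN1e, ← mul_assoc (1 + T)]
    refine mul_le_mul_of_nonneg_right (mul_le_mul_of_nonneg_right
      (mul_le_mul_of_nonneg_left ?_ (by linarith)) (by linarith)) hS0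
    linarith
  have c1 := boundary_term_le ha0 ha1 hlam hχ hp₃ hα le_rfl (by linarith) C.coe_nonneg hD1 hJ40 hJ50
    hΨ0 hN0 hE0 rfl rfl hS L1 hYb
  have c2 := boundary_term_le ha0 ha1 hlam hχ hp₃ hα (by linarith) le_rfl C.coe_nonneg hD1 hJ40 hJ50
    hΨ0 hN0 hE0 rfl rfl hS L2 hYb
  have hY1 : (1 + T) * (1 + Φ) * J₁ * S ≤ Y := by
    rw [hY, hN1e, ← mul_assoc (1 + T)]
    refine mul_le_mul_of_nonneg_right ?_ hS0
    refine le_trans ?_ (le_mul_of_one_le_right (by positivity) hΨT1)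
    exact mul_le_mul_of_nonneg_left (by linarith) (by linarith)
  have hY2 : (1 + T) * (1 + Φ) * J₂ * S ≤ Y := by
    rw [hY, hN1e, ← mul_assoc (1 + T)]
    refine mul_le_mul_of_nonneg_right ?_ hS0
    refine le_trans ?_ (le_mul_of_one_le_right (by positivity) hΨT1)
    exact mul_le_mul_of_nonneg_left (by linarith) (by linarith)
  have hY0 : 0 ≤ Y := le_trans (by positivity) hY1
  refine collect_energy_terms ha0 ha1 hlam hχ hcZ hp₃ hα hY0 (b1.trans hY1) (b2.trans ?_) c1 c2 hEI
  refine mul_le_mul_of_nonneg_left ?_ (by positivity)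
  linarith

/-! ### Trapezoidal cut-offs and the mass at the final time -/

/-- The piecewise affine cut-off which increases on `[s, T₂]`, is `1` on `[T₂, r]` and decreases on
`[r, t]`. -/
def trapezoid (s T₂ r t τ : ℝ) : ℝ := max 0 (min 1 (min ((τ - s) / (T₂ - s)) ((t - τ) / (t - r))))

theorem exists_isTimeCutoff_trapezoid {s T₂ r t : ℝ} (hs : s < T₂) (hr : r < t) :
    ∃ K : NNReal, IsTimeCutoff (trapezoid s T₂ r t) K s t := by
  have aff : ∀ c d : ℝ, LipschitzWith ‖c‖₊ (fun τ : ℝ => c * τ + d) := fun c d =>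
    LipschitzWith.of_dist_le_mul fun x y => by
      rw [Real.dist_eq, Real.dist_eq, coe_nnnorm, Real.norm_eq_abs, ← abs_mul]
      exact le_of_eq (by congr 1; ring)
  have h1 : 0 < T₂ - s := by linarith
  have h2 : 0 < t - r := by linarith
  have e : trapezoid s T₂ r t = fun τ => max 0 (min 1 (min (1 / (T₂ - s) * τ + -s / (T₂ - s))
      (-1 / (t - r) * τ + t / (t - r)))) := by
    funext τ
    unfold trapezoid
    congr 3 <;> ring
  have hl := (((aff (1 / (T₂ - s)) (-s / (T₂ - s))).min
    (aff (-1 / (t - r)) (t / (t - r)))).const_min 1).const_max 0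
  rw [← e] at hl
  refine ⟨_, hl, fun τ => le_max_left _ _, fun τ => max_le zero_le_one (min_le_left _ _),
    fun τ hτ => max_eq_left ((min_le_right _ _).trans ?_)⟩
  by_cases h : s < τ
  · exact (min_le_right _ _).trans
      (div_nonpos_of_nonpos_of_nonneg (by linarith [not_lt.1 fun k => hτ ⟨h, k⟩]) h2.le)
  · exact (min_le_left _ _).trans
      (div_nonpos_of_nonpos_of_nonneg (by linarith [not_lt.1 h]) h1.le)

theorem trapezoid_eq_one {s T₂ r t τ : ℝ} (hs : s < T₂) (hr : r < t) (h1 : T₂ ≤ τ) (h2 : τ ≤ r) :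
    trapezoid s T₂ r t τ = 1 := by
  have k1 : 1 ≤ (τ - s) / (T₂ - s) := by rw [le_div_iff₀ (by linarith)]; linarith
  have k2 : 1 ≤ (t - τ) / (t - r) := by rw [le_div_iff₀ (by linarith)]; linarith
  rw [trapezoid, min_eq_left (le_min k1 k2), max_eq_right zero_le_one]

/-- One upper bound covers all three pieces: the positive slope is kept everywhere as a majorant,
and the negative slope only on (r,t). The two kinks are excluded and form a null set. -/
theorem deriv_trapezoid_le {s T₂ r t τ : ℝ} (hs : s < T₂) (hT : T₂ ≤ r) (hr : r < t)
    (hτ : τ ∈ Ioo s t) (h1 : τ ≠ T₂) (h2 : τ ≠ r) :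
    deriv (trapezoid s T₂ r t) τ ≤
      1 / (T₂ - s) - (Ioo r t).indicator (fun _ => 1 / (t - r)) τ := by
  have k1 : 0 < T₂ - s := by linarith
  have k2 : 0 < t - r := by linarith
  rcases lt_or_gt_of_ne h1 with h | h
  · have e : trapezoid s T₂ r t =ᶠ[𝓝 τ] fun x => (x - s) / (T₂ - s) := by
      filter_upwards [Ioo_mem_nhds hτ.1 h] with x hx
      have a1 : (x - s) / (T₂ - s) ≤ 1 := by rw [div_le_one k1]; linarith [hx.2]
      have a2 : 1 ≤ (t - x) / (t - r) := by rw [le_div_iff₀ k2]; linarith [hx.2]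
      rw [trapezoid, min_eq_left (a1.trans a2), min_eq_right a1,
        max_eq_right (div_nonneg (by linarith [hx.1]) k1.le)]
    rw [e.deriv_eq, indicator_of_notMem (fun k => by linarith [k.1]), sub_zero]
    simp
  · rcases lt_or_gt_of_ne h2 with h' | h'
    · have e : trapezoid s T₂ r t =ᶠ[𝓝 τ] fun _ => 1 := by
        filter_upwards [Ioo_mem_nhds h h'] with x hx
        exact trapezoid_eq_one hs hr hx.1.le hx.2.le
      rw [e.deriv_eq, indicator_of_notMem (fun k => by linarith [k.1]), sub_zero]
      simp [k1.le]
    · have e : trapezoid s T₂ r t =ᶠ[𝓝 τ] fun x => (t - x) / (t - r) := by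
        filter_upwards [Ioo_mem_nhds h' hτ.2] with x hx
        have a1 : (t - x) / (t - r) ≤ 1 := by rw [div_le_one k2]; linarith [hx.1]
        have a2 : 1 ≤ (x - s) / (T₂ - s) := by rw [le_div_iff₀ k1]; linarith [hx.1]
        rw [trapezoid, min_eq_right (a1.trans a2), min_eq_right a1,
          max_eq_right (div_nonneg (by linarith [hx.2]) k2.le)]
      rw [e.deriv_eq, indicator_of_mem (show τ ∈ Ioo r t from ⟨h', hτ.2⟩)]
      have : deriv (fun x => (t - x) / (t - r)) τ = -(1 / (t - r)) := by
        simp [deriv_div_const, neg_div]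
      rw [this]
      have : 0 < 1 / (T₂ - s) := by positivity
      linarith

/-- The time derivative of the trapezoidal cut-off yields the weighted mass at the final time. -/
theorem time_term_le {s T₂ r t : ℝ} {L : NNReal} (hU : MeasurableSet U)
    (hφ : IntegrableOn φ U) (hφ0 : ∀ x ∈ U, 0 < φ x) (hv : IsSlabModel U u s t v K M)
    (hα : 0 ≤ α) (hL : LipschitzWith L (fun p => v p ^ α)) (hs : s < T₂) (hT : T₂ ≤ r)
    (hr : r < t) :
    ∫ p, φ p.1 * (v p ^ α * deriv (trapezoid s T₂ r t) p.2) ∂(cylinderMeasure U s t) ≤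
      1 / (T₂ - s) * (∫ p, φ p.1 * v p ^ α ∂(cylinderMeasure U s t)) -
        ((∫ x in U, φ x * v (x, t) ^ α) - L * (t - r) * ∫ x in U, φ x) := by
  obtain ⟨Kθ, hθ⟩ := exists_isTimeCutoff_trapezoid hs hr
  have k1 : 0 < T₂ - s := by linarith
  have k2 : 0 < t - r := by linarith
  have hvm : Measurable fun p => v p ^ α := hv.measurable_rpow α
  have i1 : Integrable (fun p : Euc n × ℝ =>
      φ p.1 * (v p ^ α * deriv (trapezoid s T₂ r t) p.2)) (cylinderMeasure U s t) := by
    refine integrable_fst_mul_bdd hφ (hvm.mul ((measurable_deriv _).comp measurable_snd))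
      (C := M ^ α * Kθ) fun p => ?_
    rw [abs_mul]
    exact mul_le_mul (hv.rpow_le hα p) (abs_deriv_le_of_lipschitz hθ.lipschitz _) (abs_nonneg _)
      (Real.rpow_nonneg hv.nonneg_bound _)
  have i2 : Integrable (fun p : Euc n × ℝ => φ p.1 * v p ^ α) (cylinderMeasure U s t) :=
    integrable_fst_mul_bdd hφ hvm (hv.rpow_le hα)
  have i3 : IntegrableOn (fun x => φ x * v (x, t) ^ α) U :=
    Integrable.mul_bdd hφ (hvm.comp measurable_prodMk_right).aestronglyMeasurable
      (Eventually.of_forall fun x => hv.rpow_le hα (x, t))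
  have i4 : IntegrableOn (fun x => φ x * v (x, t) ^ α - L * (t - r) * φ x) U :=
    i3.sub (hφ.const_mul _)
  have i5 : Integrable ((Ioo r t).indicator fun _ => 1 / (t - r)) (volume.restrict (Ioo s t)) :=
    (integrable_const _).indicator measurableSet_Ioo
  have hint : ∫ τ in Ioo s t, (Ioo r t).indicator (fun _ => 1 / (t - r)) τ = 1 := by
    rw [integral_indicator measurableSet_Ioo, Measure.restrict_restrict measurableSet_Ioo,
      inter_eq_left.2 (Ioo_subset_Ioo_left (by linarith)), setIntegral_const, Measure.real,
      Real.volume_Ioo, ENNReal.toReal_ofReal k2.le, smul_eq_mul, mul_one_div_cancel k2.ne']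
  have i6 : Integrable (fun p : Euc n × ℝ => (φ p.1 * v (p.1, t) ^ α - L * (t - r) * φ p.1) *
      (Ioo r t).indicator (fun _ => 1 / (t - r)) p.2) (cylinderMeasure U s t) := i4.mul_prod i5
  have hne : ∀ c : ℝ, ∀ᵐ p ∂(cylinderMeasure U s t), p.2 ≠ c := fun c =>
    Measure.quasiMeasurePreserving_snd.ae (ae_restrict_of_ae (Measure.ae_ne volume c))
  have e : 1 / (T₂ - s) * (∫ p, φ p.1 * v p ^ α ∂(cylinderMeasure U s t)) -
        ((∫ x in U, φ x * v (x, t) ^ α) - L * (t - r) * ∫ x in U, φ x) =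
      ∫ p, (1 / (T₂ - s) * (φ p.1 * v p ^ α) -
        (φ p.1 * v (p.1, t) ^ α - L * (t - r) * φ p.1) *
          (Ioo r t).indicator (fun _ => 1 / (t - r)) p.2) ∂(cylinderMeasure U s t) := by
    rw [integral_sub (i2.const_mul _) i6, integral_const_mul]
    congr 1
    rw [cylinderMeasure, integral_prod_mul (fun x => φ x * v (x, t) ^ α - L * (t - r) * φ x)
      ((Ioo r t).indicator (fun _ => 1 / (t - r))), hint, mul_one,
      integral_sub i3 (hφ.const_mul _), integral_const_mul]
  rw [e]
  refine integral_mono_ae i1 ((i2.const_mul _).sub i6) ?_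
  filter_upwards [ae_cylinder hU s t, hne T₂, hne r] with p hp h1 h2
  have hφp := (hφ0 p.1 hp.1).le
  have hvp : 0 ≤ v p ^ α := Real.rpow_nonneg (hv.nonneg p) _
  have hd := deriv_trapezoid_le hs hT hr hp.2 h1 h2
  by_cases h : p.2 ∈ Ioo r t
  · rw [indicator_of_mem h] at hd ⊢
    have hl := hL.dist_le_mul (p.1, t) p
    rw [Real.dist_eq, Prod.dist_eq] at hl
    simp only [dist_self] at hl
    rw [max_eq_right dist_nonneg, Real.dist_eq, abs_of_pos (by linarith [h.2] : 0 < t - p.2)] at hl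
    -- On the falling flank v^α is compared with its value at the final time; the Lipschitz error is
    -- at most L(t-r).
    have hl' : v (p.1, t) ^ α - L * (t - r) ≤ v p ^ α := by
      have : (L : ℝ) * (t - p.2) ≤ L * (t - r) :=
        mul_le_mul_of_nonneg_left (by linarith [h.1]) L.coe_nonneg
      linarith [le_abs_self (v (p.1, t) ^ α - v p ^ α)]
    calc φ p.1 * (v p ^ α * deriv (trapezoid s T₂ r t) p.2)
        ≤ φ p.1 * (v p ^ α * (1 / (T₂ - s) - 1 / (t - r))) := by gcongr
      _ = 1 / (T₂ - s) * (φ p.1 * v p ^ α) - φ p.1 * (v p ^ α * (1 / (t - r))) := by ring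
      _ ≤ 1 / (T₂ - s) * (φ p.1 * v p ^ α) -
          φ p.1 * ((v (p.1, t) ^ α - L * (t - r)) * (1 / (t - r))) := by
        have : 0 ≤ 1 / (t - r) := by positivity
        gcongr
      _ = _ := by ring
  · rw [indicator_of_notMem h] at hd ⊢
    rw [mul_zero, sub_zero]
    calc φ p.1 * (v p ^ α * deriv (trapezoid s T₂ r t) p.2)
        ≤ φ p.1 * (v p ^ α * (1 / (T₂ - s))) := by gcongr; linarith
      _ = _ := by ring

/-- This removes the error of the falling flank as r increases to t, for a quantity A which does not
depend on r. -/
theorem le_of_forall_le_add_mul {A R c r₀ t : ℝ} (h0 : r₀ < t)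
    (h : ∀ r, r₀ ≤ r → r < t → A ≤ R + c * (t - r)) : A ≤ R := by
  have hc : Tendsto (fun r => R + c * (t - r)) (𝓝[<] t) (𝓝 R) := by
    have : Continuous fun r : ℝ => R + c * (t - r) := by fun_prop
    exact (this.tendsto' t R (by simp)).mono_left nhdsWithin_le_nhds
  refine ge_of_tendsto hc ?_
  filter_upwards [Ioo_mem_nhdsLT h0] with r hr
  exact h r hr.1.le hr.2

theorem one_add_integral_le_weightQuantity {p₁ p₂ p₃ p₄ p₅ : ℝ} (hU : MeasurableSet U)
    (hφ0 : ∀ x ∈ U, 0 < φ x) (hX : StructureConditions U a lam χ X W₀ W₁ W₂) :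
    1 + ∫ x in U, φ x ≤ weightQuantity U a p₁ p₂ p₃ p₄ p₅ φ W₀ W₁ W₂ ∧ 0 ≤ ∫ x in U, φ x := by
  have k1 := fun x (hx : x ∈ U) => hX.pos₁ x (subset_closure hx)
  have k3 := fun x (hx : x ∈ U) =>
    W₃_pos (a := a) (hX.pos₀ x (subset_closure hx)) (k1 x hx)
  have k4 : ∀ x ∈ U, 0 < W₄ a W₀ W₁ W₂ x := fun x hx =>
    add_pos (hX.pos₂ x (subset_closure hx)) (k3 x hx)
  have hΦ : 0 ≤ ∫ x in U, φ x := setIntegral_nonneg hU fun x hx => (hφ0 x hx).le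
  have hI1 : 0 ≤ ∫ x in U, W₄ a W₀ W₁ W₂ x ^ conj p₁ * φ x ^ (-(conj p₁ / p₁)) :=
    setIntegral_nonneg hU fun x hx => mul_nonneg (Real.rpow_nonneg (k4 x hx).le _)
      (Real.rpow_nonneg (hφ0 x hx).le _)
  have hI2 : 0 ≤ ∫ x in U, W₃ a W₀ W₁ x ^ conj p₂ * φ x ^ (-(conj p₂ / p₂)) :=
    setIntegral_nonneg hU fun x hx => mul_nonneg (Real.rpow_nonneg (k3 x hx).le _)
      (Real.rpow_nonneg (hφ0 x hx).le _)
  have hI4 : 0 ≤ ∫ x in U, φ x ^ (-(conj p₄ / p₄)) := setIntegral_nonneg hU fun x hx =>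
    Real.rpow_nonneg (hφ0 x hx).le _
  have hI5 : 0 ≤ ∫ x in U, W₁ x ^ (-(conj p₅ / (1 - a))) * φ x ^ (-(conj p₅ / p₅)) :=
    setIntegral_nonneg hU fun x hx => mul_nonneg (Real.rpow_nonneg (k1 x hx).le _)
      (Real.rpow_nonneg (hφ0 x hx).le _)
  refine ⟨?_, hΦ⟩
  unfold weightQuantity
  refine le_mul_of_one_le_right (by linarith) ?_
  rw [add_assoc, add_assoc, add_assoc]
  exact le_add_of_nonneg_right (by positivity)

theorem one_le_boundaryQuantity (p₃ T : ℝ) : 1 ≤ boundaryQuantity U a p₃ T ψ₁ ψ₂ := by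
  rw [boundaryQuantity]
  exact le_add_of_nonneg_right
    (Real.rpow_nonneg (integral_nonneg fun p => boundaryIntegrand_nonneg p₃ p) _)

/-- The energy estimate for the trapezoidal cut-offs. -/
theorem trapezoid_energy {κ p₁ p₂ p₃ p₄ p₅ T T₁ T₂ t N : ℝ} {C : NNReal}
    (hU : IsOpen U) [IsFiniteMeasure (surfaceMeasure U)]
    (hC : ∀ (L : NNReal) (f : Euc n → ℝ), LipschitzWith L f →
      ∫⁻ x, ENNReal.ofReal (f x) ∂(surfaceMeasure U) ≤
        C * ∫⁻ x in U, (ENNReal.ofReal (f x) + ENNReal.ofReal ‖gradient f x‖))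
    (ha0 : 0 < a) (ha1 : a < 1) (hlam : 0 < lam) (hχ : 1 ≤ χ) (hcZ : 0 < cZ)
    (hκ : 1 < κ) (hp₁ : 1 < p₁) (hp₂ : 1 < p₂) (hp₃ : 1 < p₃) (hp₄ : 1 < p₄) (hp₅ : 1 < p₅)
    (h1κ : p₁ < κ) (h2κ : p₂ < κ) (h34κ : p₃ * p₄ < κ) (h6κ : exponentP₆ a p₃ p₅ < κ)
    (hα' : alphaThreshold a lam κ p₂ p₃ p₅ < α) (hφ0 : ∀ x ∈ U, 0 < φ x)
    (hW : WeightsIntegrable U a p₁ p₂ p₄ p₅ φ W₀ W₁ W₂)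
    (hX : StructureConditions U a lam χ X W₀ W₁ W₂)
    (hZ : ∀ x ∈ closure U, ∀ t : ℝ, 0 < t → ‖Z x t‖ ≤ cZ * χ ^ 2)
    (hψ₁ : AEMeasurable (fun p : Euc n × ℝ => ψ₁ p.1 p.2) (globalLateralMeasure U))
    (hψ₂ : AEMeasurable (fun p : Euc n × ℝ => ψ₂ p.1 p.2) (globalLateralMeasure U))
    (hb : Integrable (boundaryIntegrand p₃ ψ₁ ψ₂) (lateralMeasure U 0 T))
    (hsol : IsSolution U lam φ X Z u₀ ψ₁ ψ₂ u)
    (h0 : 0 ≤ T₁) (h12 : T₁ < T₂) (h2t : T₂ < t) (htT : t ≤ T)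
    (hv : IsSlabModel U u ((T₁ + T₂) / 2) t v K M) (hN0 : 0 ≤ N)
    (hN : ∫⁻ p, ENNReal.ofReal (v p ^ (κ * α) * φ p.1) ∂(cylinderMeasure U ((T₁ + T₂) / 2) t) ≤
      ENNReal.ofReal (N ^ (κ * α))) :
    ∃ c : ℝ, ∀ r, T₂ ≤ r → r < t →
      lam / α * (∫ x in U, φ x * v (x, t) ^ α) + (α - lam) / (8 * χ ^ 2) *
        (∫ p, W₁ p.1 * (trapezoid ((T₁ + T₂) / 2) T₂ r t p.2 * energyDensity a lam α v p)
          ∂(cylinderMeasure U ((T₁ + T₂) / 2) t)) ≤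
      (2 + energyConst a lam cZ p₃ C) *
      (χ ^ exponentγ a p₃ * α ^ ((2 - a) / (1 - a)) * (1 + 1 / (T₂ - T₁)) *
        ((1 + T) * weightQuantity U a p₁ p₂ p₃ p₄ p₅ φ W₀ W₁ W₂ *
          boundaryQuantity U a p₃ T ψ₁ ψ₂ * (N ^ (α - h₁ lam) + N ^ (α + h₂ a lam p₃)))) + c * (t - r) := by
  obtain ⟨hα, -⟩ := exponent_conditions ha0 ha1 hlam hp₁ hp₃ hp₄ hp₅ h1κ h2κ h34κ
    h6κ hα' (le_refl α)
  have hUm := hU.measurableSet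
  obtain ⟨L, hL⟩ := exists_lipschitzWith_rpow (β := α) hv.lipschitz hv.nonneg hv.le_bound
    (by linarith)
  obtain ⟨hN1, hΦ⟩ := one_add_integral_le_weightQuantity (p₁ := p₁) (p₂ := p₂) (p₃ := p₃)
    (p₄ := p₄) (p₅ := p₅) hUm hφ0 hX
  have hΨ1 := one_le_boundaryQuantity (U := U) (a := a) (ψ₁ := ψ₁) (ψ₂ := ψ₂) p₃ T
  have hα0 : 0 < α := by linarith
  have hsT : (T₁ + T₂) / 2 < T₂ := by linarith
  have hEC := one_le_energyConst (a := a) (lam := lam) hcZ hp₃ C.coe_nonneg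
  -- The constant may depend on the solution through L, because it is multiplied by t-r and
  -- disappears in the limit.
  refine ⟨lam / α * (L * ∫ x in U, φ x), fun r hr hrt => ?_⟩
  obtain ⟨Kθ, hθ⟩ := exists_isTimeCutoff_trapezoid hsT hrt
  have hA := absorbed_energy hU hC ha0 ha1 hlam hχ hcZ hκ hp₁ hp₂ hp₃ hp₄ hp₅ h1κ h2κ h34κ h6κ
    hα' hφ0 hW hX hZ hψ₁ hψ₂ hb hsol (by linarith) (by linarith) htT hv hθ hN0 hN
  have hB := time_term_le hUm hW.phi hφ0 hv hα0.le hL hsT hr hrt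
  have hI : ∫ p, φ p.1 * v p ^ α ∂(cylinderMeasure U ((T₁ + T₂) / 2) t) ≤
      (1 + T) * (1 + ∫ x in U, φ x) * N ^ α := by
    have hT : 0 < T := by linarith
    refine integral_le_of_lintegral_ofReal_le ?_ (by positivity)
      (lintegral_phi_mul_rpow_le hUm hW.phi hφ0 (by linarith) (by linarith) htT
        hv.lipschitz.continuous.measurable hv.nonneg hN0 hN hκ)
    filter_upwards [ae_cylinder hUm ((T₁ + T₂) / 2) t] with p hp
    exact mul_nonneg (hφ0 p.1 hp.1).le (Real.rpow_nonneg (hv.nonneg p) _)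
  have hNS : N ^ α ≤ N ^ (α - h₁ lam) + N ^ (α + h₂ a lam p₃) :=
    rpow_le_add_rpow hN0 (by unfold h₁; linarith) (by unfold h₁; linarith)
      (le_add_of_nonneg_right (le_max_left _ _))
  have hx : 1 ≤ χ ^ exponentγ a p₃ * α ^ ((2 - a) / (1 - a)) :=
    one_le_mul_of_one_le_of_one_le (chi_rpow_bounds hχ ha0 ha1 hp₃).1
      (Real.one_le_rpow (by linarith) (div_nonneg (by linarith) (by linarith)))
  have hY : (1 + T) * (1 + ∫ x in U, φ x) * N ^ α ≤
      (1 + T) * weightQuantity U a p₁ p₂ p₃ p₄ p₅ φ W₀ W₁ W₂ *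
        boundaryQuantity U a p₃ T ψ₁ ψ₂ * (N ^ (α - h₁ lam) + N ^ (α + h₂ a lam p₃)) := by
    have hT : 0 < T := by linarith
    refine mul_le_mul ?_ hNS (by positivity) ?_
    · refine le_trans ?_ (le_mul_of_one_le_right ?_ hΨ1)
      · exact mul_le_mul_of_nonneg_left hN1 (by linarith)
      · exact mul_nonneg (by linarith) (by linarith)
    · exact mul_nonneg (mul_nonneg (by linarith) (by linarith)) (by linarith)
  have hY0 : 0 ≤ (1 + T) * (1 + ∫ x in U, φ x) * N ^ α := by
    have hT : 0 < T := by linarith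
    positivity
  have hlα : lam / α ≤ 1 := by rw [div_le_one hα0]; linarith
  have hlα0 : 0 ≤ lam / α := by positivity
  have hd0 : 0 < 1 / (T₂ - T₁) := by
    have : 0 < T₂ - T₁ := by linarith
    positivity
  -- Starting the cut-off at the midpoint instead of T₁ costs a factor 2.
  have hd : 1 / (T₂ - (T₁ + T₂) / 2) = 2 * (1 / (T₂ - T₁)) := by
    have : T₂ - (T₁ + T₂) / 2 = (T₂ - T₁) / 2 := by ring
    rw [this, one_div_div]; ring
  rw [hd] at hB
  have hI0 := hI.trans hY
  have hC1 := hY0.trans hY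
  clear hY hY0 hI hN1 hΨ1 hNS hN hsol
  generalize (1 + T) * weightQuantity U a p₁ p₂ p₃ p₄ p₅ φ W₀ W₁ W₂ *
        boundaryQuantity U a p₃ T ψ₁ ψ₂ * (N ^ (α - h₁ lam) + N ^ (α + h₂ a lam p₃)) = Y at *
  generalize χ ^ exponentγ a p₃ * α ^ ((2 - a) / (1 - a)) = x at *
  generalize ∫ p, φ p.1 * v p ^ α ∂(cylinderMeasure U ((T₁ + T₂) / 2) t) = I at *
  generalize ∫ p, φ p.1 * (v p ^ α * deriv (trapezoid ((T₁ + T₂) / 2) T₂ r t) p.2)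
    ∂(cylinderMeasure U ((T₁ + T₂) / 2) t) = I' at *
  generalize energyConst a lam cZ p₃ C = e at *
  generalize 1 / (T₂ - T₁) = d at *
  have h1 := mul_le_mul_of_nonneg_left hB hlα0
  have h2 : lam / α * (2 * d * I) ≤ 2 * (x * (1 + d) * Y) := by
    calc lam / α * (2 * d * I) ≤ lam / α * (2 * d * Y) := by gcongr
      _ ≤ 1 * (2 * d * Y) := by gcongr
      _ = 2 * (1 * d * Y) := by ring
      _ ≤ 2 * (x * (1 + d) * Y) := by gcongr; linarith
  have h3 : e * (x * Y) ≤ e * (x * (1 + d) * Y) := by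
    gcongr
    exact le_mul_of_one_le_right (by linarith) (by linarith)
  linarith

/-! ### From the cut-off energy to the gradient energy -/

theorem cylinderMeasure_eq_restrict (s t : ℝ) :
    cylinderMeasure U s t = ((volume.restrict U).prod volume).restrict (univ ×ˢ Ioo s t) := by
  rw [cylinderMeasure, ← Measure.prod_restrict, Measure.restrict_univ]

/-- The cut-off equals 1 on (T₂, r₀) as long as r₀ ≤ r, and there v and u have the same spatial
gradient in the open set U. Keeping r₀ separate from r allows r to tend to t with the left side
fixed. -/
theorem gradientEnergy_le_integral {s T₂ r₀ r t : ℝ} (hU : IsOpen U)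
    (hW₁0 : ∀ x ∈ U, 0 < W₁ x) (hW₁ : IntegrableOn W₁ U) (ha1 : a < 1) (hlam : 0 < lam)
    (hα : lam + 1 < α) (hv : IsSlabModel U u s t v K M) (hs : s < T₂) (hr : r₀ ≤ r)
    (hrt : r < t) :
    gradientEnergy U W₁ a lam α T₂ r₀ u ≤ ENNReal.ofReal
      (∫ p, W₁ p.1 * (trapezoid s T₂ r t p.2 * energyDensity a lam α v p)
        ∂(cylinderMeasure U s t)) := by
  obtain ⟨Kθ, hθ⟩ := exists_isTimeCutoff_trapezoid hs hrt
  have hUm := hU.measurableSet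
  rw [ofReal_integral_eq_lintegral_ofReal (integrable_energy hv hθ hW₁ ha1 hlam hα)
    (ae_energy_nonneg hUm hv hθ hW₁0)]
  have hm : AEMeasurable (fun p : Euc n × ℝ =>
      ENNReal.ofReal (W₁ p.1 * energyDensity a lam α v p)) (cylinderMeasure U T₂ r₀) :=
    (hW₁.aestronglyMeasurable.aemeasurable.comp_fst.mul
      (measurable_energyDensity hv.lipschitz.continuous).aemeasurable).ennreal_ofReal
  have e : gradientEnergy U W₁ a lam α T₂ r₀ u = ∫⁻ p,
      ENNReal.ofReal (W₁ p.1 * energyDensity a lam α v p) ∂(cylinderMeasure U T₂ r₀) := by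
    rw [cylinderMeasure, lintegral_prod_symm _ hm, gradientEnergy]
    refine setLIntegral_congr_fun measurableSet_Ioo fun τ hτ => ?_
    refine setLIntegral_congr_fun hUm fun x hx => ?_
    have hvt : ∀ y ∈ closure U, v (y, τ) = u y τ := fun y hy =>
      hv.eq y hy τ ⟨by linarith [hτ.1], by linarith [hτ.2]⟩
    simp only [energyDensity]
    rw [spaceGrad_eq_of_eqOn hU hvt hx, hvt x (subset_closure hx), mul_comm (W₁ x)]
  have e2 : cylinderMeasure U T₂ r₀ = (cylinderMeasure U s t).restrict (univ ×ˢ Ioo T₂ r₀) := by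
    rcases le_or_gt r₀ T₂ with h | h
    · rw [Ioo_eq_empty (not_lt.2 h), prod_empty, Measure.restrict_empty, cylinderMeasure,
        Ioo_eq_empty (not_lt.2 h), Measure.restrict_empty, Measure.prod_zero]
    · rw [cylinderMeasure_eq_restrict, cylinderMeasure_eq_restrict s t,
        Measure.restrict_restrict (MeasurableSet.univ.prod measurableSet_Ioo),
        inter_eq_left.2 (prod_mono le_rfl (Ioo_subset_Ioo hs.le (by linarith)))]
  rw [e, e2]
  refine le_trans (le_of_eq ?_) (setLIntegral_le_lintegral (univ ×ˢ Ioo T₂ r₀) _)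
  refine setLIntegral_congr_fun (MeasurableSet.univ.prod measurableSet_Ioo) fun p hp => ?_
  rw [trapezoid_eq_one hs hrt hp.2.1.le (by linarith [hp.2.2]), one_mul]

/-- Monotone convergence along an increasing sequence of intervals. It is needed because every
cut-off vanishes at the final time. -/
theorem gradientEnergy_le_of_forall_lt {s t : ℝ} {B : ENNReal}
    (h : ∀ r, s ≤ r → r < t → gradientEnergy U W₁ a lam α s r u ≤ B) :
    gradientEnergy U W₁ a lam α s t u ≤ B := by
  have e : Ioo s t = ⋃ k : ℕ, Ioo s (t - 1 / ((k : ℝ) + 1)) := by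
    ext τ
    simp only [mem_Ioo, mem_iUnion]
    refine ⟨fun hτ => ?_, fun ⟨k, h1, h2⟩ => ⟨h1, ?_⟩⟩
    · obtain ⟨k, hk⟩ := exists_nat_one_div_lt (sub_pos.2 hτ.2)
      exact ⟨k, hτ.1, by linarith⟩
    · have : 0 < 1 / ((k : ℝ) + 1) := by positivity
      linarith
  have hmono : Monotone fun k : ℕ => Ioo s (t - 1 / ((k : ℝ) + 1)) := fun i j hij =>
    Ioo_subset_Ioo_right (sub_le_sub_left (Nat.one_div_le_one_div hij) t)
  rw [gradientEnergy, e, setLIntegral_iUnion_of_directed _ hmono.directed_le]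
  refine iSup_le fun k => ?_
  rcases le_or_gt s (t - 1 / ((k : ℝ) + 1)) with hk | hk
  · have : 0 < 1 / ((k : ℝ) + 1) := by positivity
    exact h _ hk (by linarith)
  · rw [Ioo_eq_empty (by linarith), Measure.restrict_empty, lintegral_zero_measure]
    exact bot_le

/-- The two estimates at a given final time, for a finite norm `N`. -/
theorem mass_and_gradient_bounds {κ p₁ p₂ p₃ p₄ p₅ T T₁ T₂ t N : ℝ} {C : NNReal}
    (hU : IsOpen U) (hUb : Bornology.IsBounded U) [IsFiniteMeasure (surfaceMeasure U)]
    (hC : ∀ (L : NNReal) (f : Euc n → ℝ), LipschitzWith L f →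
      ∫⁻ x, ENNReal.ofReal (f x) ∂(surfaceMeasure U) ≤
        C * ∫⁻ x in U, (ENNReal.ofReal (f x) + ENNReal.ofReal ‖gradient f x‖))
    (ha0 : 0 < a) (ha1 : a < 1) (hlam : 0 < lam) (hχ : 1 ≤ χ) (hcZ : 0 < cZ)
    (hκ : 1 < κ) (hp₁ : 1 < p₁) (hp₂ : 1 < p₂) (hp₃ : 1 < p₃) (hp₄ : 1 < p₄) (hp₅ : 1 < p₅)
    (h1κ : p₁ < κ) (h2κ : p₂ < κ) (h34κ : p₃ * p₄ < κ) (h6κ : exponentP₆ a p₃ p₅ < κ)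
    (hα' : alphaThreshold a lam κ p₂ p₃ p₅ < α) (hφ0 : ∀ x ∈ U, 0 < φ x)
    (hW : WeightsIntegrable U a p₁ p₂ p₄ p₅ φ W₀ W₁ W₂)
    (hX : StructureConditions U a lam χ X W₀ W₁ W₂)
    (hZ : ∀ x ∈ closure U, ∀ t : ℝ, 0 < t → ‖Z x t‖ ≤ cZ * χ ^ 2)
    (hψ₁ : AEMeasurable (fun p : Euc n × ℝ => ψ₁ p.1 p.2) (globalLateralMeasure U))
    (hψ₂ : AEMeasurable (fun p : Euc n × ℝ => ψ₂ p.1 p.2) (globalLateralMeasure U))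
    (hb : Integrable (boundaryIntegrand p₃ ψ₁ ψ₂) (lateralMeasure U 0 T))
    (hsol : IsSolution U lam φ X Z u₀ ψ₁ ψ₂ u)
    (h0 : 0 ≤ T₁) (h12 : T₁ < T₂) (h2t : T₂ < t) (htT : t ≤ T) (hN0 : 0 ≤ N)
    (hN : ∫⁻ τ in Ioo T₁ T, weightedMass U φ (κ * α) u τ ≤ ENNReal.ofReal (N ^ (κ * α))) :
    weightedMass U φ α u t ≤ ENNReal.ofReal (α / lam * ((2 + energyConst a lam cZ p₃ C) *
      (χ ^ exponentγ a p₃ * α ^ ((2 - a) / (1 - a)) * (1 + 1 / (T₂ - T₁)) *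
        ((1 + T) * weightQuantity U a p₁ p₂ p₃ p₄ p₅ φ W₀ W₁ W₂ *
          boundaryQuantity U a p₃ T ψ₁ ψ₂ * (N ^ (α - h₁ lam) + N ^ (α + h₂ a lam p₃)))))) ∧
    gradientEnergy U W₁ a lam α T₂ t u ≤ ENNReal.ofReal (8 * χ ^ 2 / (α - lam) *
      ((2 + energyConst a lam cZ p₃ C) *
      (χ ^ exponentγ a p₃ * α ^ ((2 - a) / (1 - a)) * (1 + 1 / (T₂ - T₁)) *
        ((1 + T) * weightQuantity U a p₁ p₂ p₃ p₄ p₅ φ W₀ W₁ W₂ *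
          boundaryQuantity U a p₃ T ψ₁ ψ₂ * (N ^ (α - h₁ lam) + N ^ (α + h₂ a lam p₃)))))) := by
  obtain ⟨hα, -⟩ := exponent_conditions ha0 ha1 hlam hp₁ hp₃ hp₄ hp₅ h1κ h2κ h34κ
    h6κ hα' (le_refl α)
  have hUm := hU.measurableSet
  have hα0 : 0 < α := by linarith
  have hs0 : 0 < (T₁ + T₂) / 2 := by linarith
  have hst : (T₁ + T₂) / 2 < t := by linarith
  have hχ0 : 0 < χ := by linarith
  have hβ0 : 0 < α - lam := by linarith
  have hW₁0 := fun x (hx : x ∈ U) => hX.pos₁ x (subset_closure hx)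
  obtain ⟨hW₁, -⟩ := hW.integrable_weights hUm hp₁ hp₂ hφ0 hX
  -- The Lipschitz bound is available only away from time 0; the midpoint is positive even when T₁ =
  -- 0.
  obtain ⟨K, hK⟩ := hsol.lipschitz _ _ hs0 hst
  obtain ⟨v, M, hM, hvL, hv0, hvM, hveq⟩ := exists_bounded_extension hUb hK
    fun x hx τ hτ => hsol.nonneg x hx τ (hs0.le.trans hτ.1)
  have hv : IsSlabModel U u ((T₁ + T₂) / 2) t v K M := ⟨hM, hvL, hv0, hvM, hveq⟩
  have hNv : ∫⁻ p, ENNReal.ofReal (v p ^ (κ * α) * φ p.1)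
      ∂(cylinderMeasure U ((T₁ + T₂) / 2) t) ≤ ENNReal.ofReal (N ^ (κ * α)) := by
    refine le_trans ?_ hN
    have hm : AEMeasurable (fun p : Euc n × ℝ => ENNReal.ofReal (v p ^ (κ * α) * φ p.1))
        (cylinderMeasure U ((T₁ + T₂) / 2) t) :=
      ((hv.measurable_rpow _).aemeasurable.mul
        hW.phi.aestronglyMeasurable.aemeasurable.comp_fst).ennreal_ofReal
    rw [cylinderMeasure, lintegral_prod_symm _ hm]
    refine le_trans (le_of_eq ?_) (lintegral_mono_set (Ioo_subset_Ioo
      (by linarith : T₁ ≤ (T₁ + T₂) / 2) htT))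
    refine setLIntegral_congr_fun measurableSet_Ioo fun τ hτ => ?_
    refine setLIntegral_congr_fun hUm fun x hx => ?_
    simp only [hveq x (subset_closure hx) τ ⟨hτ.1.le, hτ.2.le⟩]
  obtain ⟨c, hc⟩ := trapezoid_energy hU hC ha0 ha1 hlam hχ hcZ hκ hp₁ hp₂ hp₃ hp₄ hp₅ h1κ h2κ
    h34κ h6κ hα' hφ0 hW hX hZ hψ₁ hψ₂ hb hsol h0 h12 h2t htT hv hN0 hNv
  have hJ0 : 0 ≤ ∫ x in U, φ x * v (x, t) ^ α := setIntegral_nonneg hUm fun x hx =>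
    mul_nonneg (hφ0 x hx).le (Real.rpow_nonneg (hv0 _) _)
  have hE0 : ∀ r < t, 0 ≤ ∫ p, W₁ p.1 * (trapezoid ((T₁ + T₂) / 2) T₂ r t p.2 *
      energyDensity a lam α v p) ∂(cylinderMeasure U ((T₁ + T₂) / 2) t) := fun r hr => by
    obtain ⟨Kθ, hθ⟩ := exists_isTimeCutoff_trapezoid (by linarith : (T₁ + T₂) / 2 < T₂) hr
    exact integral_nonneg_of_ae (ae_energy_nonneg hUm hv hθ hW₁0)
  generalize ((2 + energyConst a lam cZ p₃ C) *
      (χ ^ exponentγ a p₃ * α ^ ((2 - a) / (1 - a)) * (1 + 1 / (T₂ - T₁)) *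
        ((1 + T) * weightQuantity U a p₁ p₂ p₃ p₄ p₅ φ W₀ W₁ W₂ *
          boundaryQuantity U a p₃ T ψ₁ ψ₂ * (N ^ (α - h₁ lam) + N ^ (α + h₂ a lam p₃))))) = R at *
  constructor
  -- The energy is non-negative and is discarded here; for the gradient bound the mass is discarded
  -- instead.
  · have hJ : lam / α * (∫ x in U, φ x * v (x, t) ^ α) ≤ R :=
      le_of_forall_le_add_mul h2t fun r hr hrt => le_trans
        (le_add_of_nonneg_right (mul_nonneg (by positivity) (hE0 r hrt))) (hc r hr hrt)
    have e : weightedMass U φ α u t = ENNReal.ofReal (∫ x in U, φ x * v (x, t) ^ α) := by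
      rw [ofReal_integral_eq_lintegral_ofReal, weightedMass]
      · refine setLIntegral_congr_fun hUm fun x hx => ?_
        simp only [hveq x (subset_closure hx) t ⟨hst.le, le_rfl⟩, mul_comm]
      · exact Integrable.mul_bdd hW.phi
          ((hv.measurable_rpow α).comp measurable_prodMk_right).aestronglyMeasurable
          (Eventually.of_forall fun x => hv.rpow_le hα0.le (x, t))
      · filter_upwards [ae_restrict_mem hUm] with x hx
        exact mul_nonneg (hφ0 x hx).le (Real.rpow_nonneg (hv0 _) _)
    rw [e]
    refine ENNReal.ofReal_le_ofReal ?_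
    calc ∫ x in U, φ x * v (x, t) ^ α = α / lam * (lam / α * ∫ x in U, φ x * v (x, t) ^ α) := by
          field_simp
      _ ≤ α / lam * R := mul_le_mul_of_nonneg_left hJ (by positivity)
  · refine gradientEnergy_le_of_forall_lt fun r₀ hr₀ hr₀t => ?_
    have hle : gradientEnergy U W₁ a lam α T₂ r₀ u ≤ ENNReal.ofReal
        (∫ p, W₁ p.1 * (trapezoid ((T₁ + T₂) / 2) T₂ r₀ t p.2 * energyDensity a lam α v p)
          ∂(cylinderMeasure U ((T₁ + T₂) / 2) t)) :=
      gradientEnergy_le_integral hU hW₁0 hW₁ ha1 hlam hα hv (by linarith) le_rfl hr₀t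
    -- Finiteness, obtained from the cut-off with r = r₀, allows the limit in r to be taken in real
    -- numbers.
    have hfin : gradientEnergy U W₁ a lam α T₂ r₀ u ≠ ⊤ := ne_top_of_le_ne_top ENNReal.ofReal_ne_top hle
    rw [← ENNReal.ofReal_toReal hfin]
    refine ENNReal.ofReal_le_ofReal ?_
    have hE : (α - lam) / (8 * χ ^ 2) * (gradientEnergy U W₁ a lam α T₂ r₀ u).toReal ≤ R := by
      refine le_of_forall_le_add_mul hr₀t fun r hr hrt => le_trans ?_ (hc r (hr₀.trans hr) hrt)
      refine le_add_of_nonneg_of_le (mul_nonneg (by positivity) hJ0)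
        (mul_le_mul_of_nonneg_left ?_ (by positivity))
      exact ENNReal.toReal_le_of_le_ofReal (hE0 r hrt)
        (gradientEnergy_le_integral hU hW₁0 hW₁ ha1 hlam hα hv (by linarith) hr hrt)
    calc (gradientEnergy U W₁ a lam α T₂ r₀ u).toReal = 8 * χ ^ 2 / (α - lam) *
        ((α - lam) / (8 * χ ^ 2) * (gradientEnergy U W₁ a lam α T₂ r₀ u).toReal) := by
          field_simp
      _ ≤ 8 * χ ^ 2 / (α - lam) * R := mul_le_mul_of_nonneg_left hE (by positivity)

/-- If the norm is infinite the right side is ⊤, because c and the exponent x are positive; so only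
finite norms have to be treated. -/
theorem le_ofReal_mul_of_forall_real {A m : ENNReal} {c x y : ℝ} (hc : 0 < c) (hx : 0 < x)
    (hy : 0 ≤ y) (h : ∀ N : ℝ, 0 ≤ N → m = ENNReal.ofReal N →
      A ≤ ENNReal.ofReal (c * (N ^ x + N ^ y))) :
    A ≤ ENNReal.ofReal c * (m ^ x + m ^ y) := by
  by_cases hm : m = ⊤
  · rw [hm, ENNReal.top_rpow_of_pos hx, top_add, ENNReal.mul_top]
    · exact le_top
    · simpa using hc
  · have hN := ENNReal.toReal_nonneg (a := m)
    have e := ENNReal.ofReal_toReal hm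
    have h' := h m.toReal hN e.symm
    rwa [ENNReal.ofReal_mul hc.le, ENNReal.ofReal_add (by positivity) (by positivity),
      ← ENNReal.ofReal_rpow_of_nonneg hN hx.le, ← ENNReal.ofReal_rpow_of_nonneg hN hy, e] at h'

theorem lintegral_weightedMass_eq {p s t N : ℝ} (hp : 0 < p) (hN : 0 ≤ N)
    (h : weightedNorm U φ p s t u = ENNReal.ofReal N) :
    ∫⁻ τ in Ioo s t, weightedMass U φ p u τ = ENNReal.ofReal (N ^ p) := by
  rw [← ENNReal.ofReal_rpow_of_nonneg hN hp.le, ← h, weightedNorm, ← ENNReal.rpow_mul,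
    one_div_mul_cancel hp.ne', ENNReal.rpow_one]

end Forchheimer

end

/-! ### The two estimates -/

theorem mainTheorem8 {n : ℕ} (hn : 2 ≤ n)
    (U : Set (Forchheimer.Euc n)) (hUopen : IsOpen U) (hUne : U.Nonempty)
    (hUbdd : Bornology.IsBounded U) (hUC1 : Forchheimer.HasC1Boundary U)
    (a lam cZ p₃ : ℝ) (ha0 : 0 < a) (ha1 : a < 1) (hlam : 0 < lam) (hcZ : 0 < cZ)
    (hp₃ : 1 < p₃) :
    ∃ c₈ c₉ : ℝ, 1 < c₈ ∧ 1 < c₉ ∧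
      ∀ (κ p₁ p₂ p₄ p₅ : ℝ), 1 < κ → 1 < p₁ → 1 < p₂ → 1 < p₄ → 1 < p₅ →
      p₁ < κ → p₂ < κ → p₃ * p₄ < κ → Forchheimer.exponentP₆ a p₃ p₅ < κ →
      ∀ (χ : ℝ), 1 ≤ χ →
      ∀ (φ : Forchheimer.Euc n → ℝ), (∀ x ∈ U, 0 < φ x) → AEMeasurable φ (volume.restrict U) →
      ∀ (X : Forchheimer.Euc n → ℝ → Forchheimer.Euc n → Forchheimer.Euc n)
        (W₀ W₁ W₂ : Forchheimer.Euc n → ℝ),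
      Forchheimer.StructureConditions U a lam χ X W₀ W₁ W₂ →
      ∀ (Z : Forchheimer.Euc n → ℝ → Forchheimer.Euc n),
      (∀ x ∈ closure U, ∀ t : ℝ, 0 < t → ‖Z x t‖ ≤ cZ * χ ^ 2) →
      ∀ (u₀ : Forchheimer.Euc n → ℝ), (∀ x ∈ U, 0 ≤ u₀ x) →
      ∀ (ψ₁ ψ₂ : Forchheimer.Euc n → ℝ → ℝ),
      AEMeasurable (fun p : Forchheimer.Euc n × ℝ => ψ₁ p.1 p.2)
        (Forchheimer.globalLateralMeasure U) →
      AEMeasurable (fun p : Forchheimer.Euc n × ℝ => ψ₂ p.1 p.2)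
        (Forchheimer.globalLateralMeasure U) →
      ∀ (u : Forchheimer.Euc n → ℝ → ℝ),
      Forchheimer.IsSolution U lam φ X Z u₀ ψ₁ ψ₂ u →
      IntegrableOn (Forchheimer.weightIntegrand a p₁ p₂ p₄ p₅ φ W₀ W₁ W₂) U →
      ∀ (T₁ T₂ T : ℝ), 0 ≤ T₁ → T₁ < T₂ → T₂ < T →
      Integrable (Forchheimer.boundaryIntegrand p₃ ψ₁ ψ₂) (Forchheimer.lateralMeasure U 0 T) →
      ∀ (α : ℝ), Forchheimer.alphaThreshold a lam κ p₂ p₃ p₅ < α →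
        (essSup (fun t => Forchheimer.weightedMass U φ α u t) (volume.restrict (Ioo T₂ T)) ≤
          ENNReal.ofReal
            (c₈ * χ ^ Forchheimer.exponentγ a p₃ * α ^ ((3 - 2 * a) / (1 - a)) * (1 + T)
              * (1 + 1 / (T₂ - T₁))
              * Forchheimer.weightQuantity U a p₁ p₂ p₃ p₄ p₅ φ W₀ W₁ W₂
              * Forchheimer.boundaryQuantity U a p₃ T ψ₁ ψ₂)
            * (Forchheimer.weightedNorm U φ (κ * α) T₁ T u ^ (α - Forchheimer.h₁ lam)
              + Forchheimer.weightedNorm U φ (κ * α) T₁ T u ^ (α + Forchheimer.h₂ a lam p₃))) ∧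
        (Forchheimer.gradientEnergy U W₁ a lam α T₂ T u ≤
          ENNReal.ofReal
            (c₉ * χ ^ (2 + Forchheimer.exponentγ a p₃) * α ^ ((2 - a) / (1 - a)) * (1 + T)
              * (1 + 1 / (T₂ - T₁))
              * Forchheimer.weightQuantity U a p₁ p₂ p₃ p₄ p₅ φ W₀ W₁ W₂
              * Forchheimer.boundaryQuantity U a p₃ T ψ₁ ψ₂)
            * (Forchheimer.weightedNorm U φ (κ * α) T₁ T u ^ (α - Forchheimer.h₁ lam)
              + Forchheimer.weightedNorm U φ (κ * α) T₁ T u ^ (α + Forchheimer.h₂ a lam p₃))) := by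
  have hn0 : n ≠ 0 := by omega
  obtain ⟨C, hC⟩ := Forchheimer.exists_trace_inequality hn0 hUopen hUbdd hUC1
  have hfin := Forchheimer.isFiniteMeasure_surfaceMeasure hn0 hUopen hUbdd hUC1
  have hEC := Forchheimer.one_le_energyConst (a := a) (lam := lam) hcZ hp₃ C.coe_nonneg
  set e := Forchheimer.energyConst a lam cZ p₃ C with he
  have hc8 : 0 < (2 + e) / lam := by positivity
  -- Dividing the common estimate by λ/α gives (2+e)/λ and one more power of α; the summand 2 only
  -- ensures that the constant exceeds 1. Dividing by (α-λ)/(8χ²), with α-λ ≥ 1, gives 8(2+e) and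
  -- the factor χ². Here e involves only a, λ, the bound on Z, p₃ and the trace constant of U.
  refine ⟨2 + (2 + e) / lam, 8 * (2 + e), by linarith, by linarith, ?_⟩
  intro κ p₁ p₂ p₄ p₅ hκ hp₁ hp₂ hp₄ hp₅ h1κ h2κ h34κ h6κ χ hχ φ hφ0 hφm X W₀ W₁ W₂ hX Z hZ u₀ _
    ψ₁ ψ₂ hψ₁ hψ₂ u hsol hw T₁ T₂ T hT₁ h12 h2T hb α hα'
  have hUm := hUopen.measurableSet
  have hW := Forchheimer.weightsIntegrable hUm hφ0 hφm hX hw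
  obtain ⟨hα, -⟩ := Forchheimer.exponent_conditions ha0 ha1 hlam hp₁ hp₃ hp₄ hp₅ h1κ h2κ h34κ
    h6κ hα' (le_refl α)
  have hα0 : 0 < α := by linarith
  have hχ0 : 0 < χ := by linarith
  have hx : 0 < α - Forchheimer.h₁ lam := by unfold Forchheimer.h₁; linarith
  have hy : 0 ≤ α + Forchheimer.h₂ a lam p₃ := add_nonneg hα0.le (le_max_left _ _)
  have hN1 : 0 < Forchheimer.weightQuantity U a p₁ p₂ p₃ p₄ p₅ φ W₀ W₁ W₂ := by
    have h := Forchheimer.one_add_integral_le_weightQuantity (p₁ := p₁) (p₂ := p₂) (p₃ := p₃)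
      (p₄ := p₄) (p₅ := p₅) hUm hφ0 hX
    linarith [h.1, h.2]
  have hΨ : 0 < Forchheimer.boundaryQuantity U a p₃ T ψ₁ ψ₂ :=
    zero_lt_one.trans_le (Forchheimer.one_le_boundaryQuantity p₃ T)
  have hd : 0 < 1 / (T₂ - T₁) := one_div_pos.2 (by linarith)
  have hT : 0 < T := by linarith
  have key := fun (t N : ℝ) (h2t : T₂ < t) (htT : t ≤ T) (hN0 : 0 ≤ N)
      (hN : Forchheimer.weightedNorm U φ (κ * α) T₁ T u = ENNReal.ofReal N) =>
    Forchheimer.mass_and_gradient_bounds hUopen hUbdd hC ha0 ha1 hlam hχ hcZ hκ hp₁ hp₂ hp₃ hp₄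
      hp₅ h1κ h2κ h34κ h6κ hα' hφ0 hW hX hZ hψ₁ hψ₂ hb hsol hT₁ h12 h2t htT hN0
      (Forchheimer.lintegral_weightedMass_eq (by positivity) hN0 hN).le
  rw [← he] at key
  -- The extra factor α of the mass estimate accounts for the larger exponent (3-2a)/(1-a).
  have hpow : α * α ^ ((2 - a) / (1 - a)) = α ^ ((3 - 2 * a) / (1 - a)) := by
    have h1a : 1 - a ≠ 0 := by linarith
    rw [show (3 - 2 * a) / (1 - a) = 1 + (2 - a) / (1 - a) by field_simp; ring,
      Real.rpow_add hα0, Real.rpow_one]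
  have hpow2 : χ ^ (2 + Forchheimer.exponentγ a p₃) = χ ^ 2 * χ ^ Forchheimer.exponentγ a p₃ := by
    rw [Real.rpow_add hχ0, Real.rpow_two]
  constructor
  · refine Forchheimer.le_ofReal_mul_of_forall_real (by positivity) hx hy fun N hN0 hN => ?_
    refine essSup_le_of_ae_le _ ?_
    filter_upwards [ae_restrict_mem measurableSet_Ioo] with t ht
    refine (key t N ht.1 ht.2.le hN0 hN).1.trans (ENNReal.ofReal_le_ofReal ?_)
    rw [← hpow]
    have h8 : (2 + e) / lam ≤ 2 + (2 + e) / lam := by linarith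
    refine le_trans (le_of_eq ?_) (mul_le_mul_of_nonneg_right h8 (show 0 ≤
      χ ^ Forchheimer.exponentγ a p₃ * (α * α ^ ((2 - a) / (1 - a))) * (1 + T) *
        (1 + 1 / (T₂ - T₁)) * Forchheimer.weightQuantity U a p₁ p₂ p₃ p₄ p₅ φ W₀ W₁ W₂ *
        Forchheimer.boundaryQuantity U a p₃ T ψ₁ ψ₂ *
        (N ^ (α - Forchheimer.h₁ lam) + N ^ (α + Forchheimer.h₂ a lam p₃)) by
          positivity) |>.trans (le_of_eq ?_)) <;> ring
  · refine Forchheimer.le_ofReal_mul_of_forall_real (by positivity) hx hy fun N hN0 hN => ?_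
    refine (key T N h2T le_rfl hN0 hN).2.trans (ENNReal.ofReal_le_ofReal ?_)
    rw [hpow2]
    have h9 : 8 * χ ^ 2 / (α - lam) ≤ 8 * χ ^ 2 := div_le_self (by positivity) (by linarith)
    refine le_trans (mul_le_mul_of_nonneg_right h9 (by positivity)) (le_of_eq ?_)
    ring
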